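/- Let $1 \le n \le N$ be integers and $\rho \in (0,1]$. Write $v \sim \mathrm{BR}(N,\rho)$ if $v \in \mathbb{R}^N$ has i.i.d. entries equal to $0$ with probability $1-\rho$ and to each of $\pm 1/\sqrt{N\rho}$ with probability $\rho/2$. Given $v \sim \mathrm{BR}(N,\rho)$, let $Y \in \mathbb{R}^{N \times n}$ be the matrix whose first column is $v$ and whose other $n-1$ columns are i.i.d. $\mathcal{N}(0, \frac1N I_N)$ vectors, independent of $v$. Let $Q \in \mathbb{R}^{n\times n}$ be an arbitrary orthogonal matrix (possibly random, and possibly dependent on $Y$), and put $\tilde Y = YQ$, with rows $\tilde y_1^\top, \dots, \tilde y_N^\top$. Define $$\tilde M = \sum_{i=1}^N \Big( \|\tilde y_i\|^2 - \frac{n-1}{N} \Big) \tilde y_i \tilde y_i^\top - \frac{3}{N} I_n .$$ A leading eigenvector of $\tilde M$ is a unit eigenvector for an eigenvalue of largest absolute value. **Corollary.** For every constant $c_1 \in (0, 0.1)$ there exist constants $C_2, c_3 > 0$ depending only on $c_1$ such that the following holds. Let $N, n, \rho$ be as above and let $\delta \in (0, 1/2)$. Suppose that $$N \ge \log^7(N/\delta),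 \qquad \rho \ge C_2 \frac{\log(1/\delta)}{N}, \qquad \Big|\rho - \frac13\Big| \ge c_1, \qquad \Big( \frac{n\rho}{\sqrt N} + \sqrt{\frac nN}\, \Big) \log \frac N\delta \le c_3 .$$ Then, with probability at least $1-\delta$, every leading eigenvector $\tilde u$ of $\tilde M$ satisfies, after possibly replacing $\tilde u$ by $-\tilde u$, $$\frac{\mathrm{sign}\big(\tilde Y \tilde u\big)}{\sqrt{N\rho}} \cdot \mathbf{1}\Big\{ \big|\tilde Y \tilde u\big| \ge \frac{0.5}{\sqrt{N\rho}} \Big\} = v ,$$ where $\mathrm{sign}$ (with $\mathrm{sign}(0)=0$) and the indicator are applied entrywise. -/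

import Mathlib

open MeasureTheory ProbabilityTheory
open scoped NNReal ENNReal Matrix

noncomputable section

namespace PlantedVector

/-- The law of one entry of a Bernoulli-Rademacher vector `BR(N, ρ)`: the value `0` has
probability `1 - ρ`, and each of the values `± 1 / √(N ρ)` has probability `ρ / 2`. -/
def brEntryLaw (N : ℕ) (ρ : ℝ) : Measure ℝ :=
  ENNReal.ofReal (1 - ρ) • Measure.dirac 0
    + ENNReal.ofReal (ρ / 2) • Measure.dirac (1 / √((N : ℝ) * ρ))
    + ENNReal.ofReal (ρ / 2) • Measure.dirac (-(1 / √((N : ℝ) * ρ)))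

/-- The random vector `v` is distributed as `BR(N, ρ)`: its entries are independent, each with
law `brEntryLaw N ρ`. -/
structure IsBernoulliRademacher {Ω : Type*} [MeasurableSpace Ω] (P : Measure Ω) {N : ℕ}
    (ρ : ℝ) (v : Ω → Fin N → ℝ) : Prop where
  hasLaw : ∀ i, HasLaw (fun ω => v ω i) (brEntryLaw N ρ) P
  indep : iIndepFun (fun i ω => v ω i) P

/-- `Y` is the unrotated `N × n` matrix of the Gaussian-basis model with planted vector `v`: its
first column is `v`, the entries of its other `n - 1` columns are i.i.d. `𝒩(0, 1/N)`, and these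
Gaussian columns are independent of `v`. -/
structure IsGaussianBasis {Ω : Type*} [MeasurableSpace Ω] (P : Measure Ω) {N n : ℕ} [NeZero n]
    (v : Ω → Fin N → ℝ) (Y : Ω → Matrix (Fin N) (Fin n) ℝ) : Prop where
  firstCol : ∀ ω i, Y ω i 0 = v ω i
  hasLaw : ∀ (i : Fin N) (j : Fin n), j ≠ 0 →
    HasLaw (fun ω => Y ω i j) (gaussianReal 0 ((N : ℝ≥0)⁻¹)) P
  indep : iIndepFun (fun (p : Fin N × {j : Fin n // j ≠ 0}) ω => Y ω p.1 p.2) P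
  indep_planted :
    IndepFun v (fun ω (p : Fin N × {j : Fin n // j ≠ 0}) => Y ω p.1 p.2) P

/-- The matrix `∑ i, (‖yᵢ‖² - (n - 1) / N) yᵢ yᵢᵀ - (3 / N) Iₙ`, where `yᵢᵀ` is the `i`-th row
of `Y` and `‖·‖` is the Euclidean norm. -/
def spectralMatrix {N n : ℕ} (Y : Matrix (Fin N) (Fin n) ℝ) : Matrix (Fin n) (Fin n) ℝ :=
  ∑ i, (Y i ⬝ᵥ Y i - ((n : ℝ) - 1) / N) • Matrix.vecMulVec (Y i) (Y i)
    - (3 / (N : ℝ)) • (1 : Matrix (Fin n) (Fin n) ℝ)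

/-- `u` is a leading eigenvector of `M`: a vector of Euclidean norm one that is an eigenvector
for an eigenvalue of largest absolute value. -/
def IsLeadingEigenvector {n : ℕ} (M : Matrix (Fin n) (Fin n) ℝ) (u : Fin n → ℝ) : Prop :=
  u ⬝ᵥ u = 1 ∧ ∃ l : ℝ, M *ᵥ u = l • u ∧
    ∀ μ : ℝ, Module.End.HasEigenvalue (Matrix.toLin' M) μ → |μ| ≤ |l|

/-- Entrywise thresholding of `x` at level `0.5 / √(N ρ)`, with the surviving entries replaced by
their signs divided by `√(N ρ)`. Here `Real.sign 0 = 0`. -/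
def signThreshold {N : ℕ} (ρ : ℝ) (x : Fin N → ℝ) : Fin N → ℝ := fun i =>
  Real.sign (x i) / √((N : ℝ) * ρ) * (if 0.5 / √((N : ℝ) * ρ) ≤ |x i| then 1 else 0)

end PlantedVector

end

/-! Rotating the columns of `Y` conjugates the spectral matrix, so for each outcome the claim
reduces to `Q = 1`, and the joint law of `Y` and `Q` never enters. Write the rows as `y i = (σ i /
√(N ρ), g i)` with `σ i ∈ {-1, 0, 1}`, `g i = x i / √N` and `x i` standard Gaussian. After
multiplication by `N ρ`, row `i` has weight `σ i ^ 2 + ρ (‖x i‖ ^ 2 - (n - 1))`. Since the mean of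
`(‖x‖ ^ 2 - dim) ⟪q, x⟫ ^ 2` is `2 ‖q‖ ^ 2`, the weighted sum of the `y i (y i)ᵀ` has corner about
`1` and Gaussian block about `(ρ + 2 ρ) I`. Subtracting `3 ρ I` cancels the block and leaves `1 - 3
ρ` in the corner, which is bounded away from zero because `|ρ - 1/3| ≥ c₁`. Divided by `1 - 3 ρ`,
the matrix is a block operator `(α, β; β, D)` close to the projection on the first coordinate
(`IsRegularSample.isNearRankOne`).

A leading eigenvector is then `u₀ (1, ζ)`, with `|u₀|` close to `1` and `ζ` a fixed point of the
contraction `ratioMap`. Entry `i` of `Y u` is `u₀ (σ i / √(N ρ) + ⟪g i, ζ⟫)`, so thresholding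
succeeds once `|⟪g i, ζ⟫| ≤ 0.1 / √(N ρ)` for all `i`. Cauchy-Schwarz is too weak for this, and `ζ`
depends on `g i`. The remedy is leave-one-out: the power iteration without row `i` produces a vector
`z` independent of `g i`, so `⟪g i, z⟫` is Gaussian given the other rows. Putting the row back is a
rank-one change whose effect is proportional to `σ i / √(N ρ) + ⟪g i, z⟫`
(`IsNearRankOne.abs_inner_fixedPoint_le`). A finite iterate is an explicit measurable function of
the rows, and its distance to the fixed point decays geometrically.

The remaining estimates are Chernoff bounds combined with a net
(`ParameterBounds.measureReal_not_isRegularSample_le`). The weights times `⟪q, x⟫ ^ 2` are quartic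
in Gaussians and have no exponential moments, so the weights are truncated at a level that with high
probability no row exceeds. These bounds hold for each fixed sign pattern `σ`; since `v` is discrete
and independent of the Gaussian part, `exists_measurableSet_of_discrete` combines them. -/

noncomputable section

namespace PlantedVector

/-! ### Perturbation theory: fixed points of the projective power iteration. -/

section Deterministic

variable {E : Type*} [NormedAddCommGroup E] [InnerProductSpace ℝ E]

/-- One step of the power iteration of the block operator `(α, β; β, D)` in the affine chart
`z ↦ (1, z)`. -/
def ratioMap (α : ℝ) (β : E) (D : E →L[ℝ] E) (z : E) : E :=
  (α + inner ℝ β z)⁻¹ • (β + D z)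

/-- The block operator `(α, β; β, D)` is close to the projection on the first coordinate. -/
structure IsNearRankOne (ε γ : ℝ) (α : ℝ) (β : E) (D : E →L[ℝ] E) : Prop where
  corner : |α - 1| ≤ ε
  side : ‖β‖ ≤ γ
  block : ‖D‖ ≤ ε

variable {ε γ α : ℝ} {β : E} {D : E →L[ℝ] E}

lemma IsNearRankOne.den_ge (h : IsNearRankOne ε γ α β D) (hε : ε ≤ 1 / 20) (hγ : γ ≤ 1 / 20)
    {z : E} (hz : ‖z‖ ≤ 1) : 9 / 10 ≤ α + inner ℝ β z := by
  have h1 := abs_le.1 h.corner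
  have h2 := abs_le.1 (abs_real_inner_le_norm β z)
  have h3 : ‖β‖ * ‖z‖ ≤ 1 / 20 * 1 :=
    mul_le_mul (h.side.trans hγ) hz (norm_nonneg _) (by norm_num)
  linarith [h1.1, h2.1]

/-- The invariant radius is proportional to `γ`, not merely constant: later `γ` is a multiple of a
scale `μ` that may be much smaller than `1`, and the leave-one-out estimate needs this gain. -/
lemma IsNearRankOne.norm_ratioMap_le (h : IsNearRankOne ε γ α β D) (hε : ε ≤ 1 / 20)
    (hγ : γ ≤ 1 / 20) {z : E} (hz : ‖z‖ ≤ 2 * γ) : ‖ratioMap α β D z‖ ≤ 2 * γ := by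
  have hγ0 : 0 ≤ γ := (norm_nonneg _).trans h.side
  have hd := h.den_ge hε hγ (z := z) (by linarith)
  have h1 : ‖D z‖ ≤ 1 / 20 * (2 * γ) :=
    (D.le_opNorm z).trans (mul_le_mul (h.block.trans hε) hz (norm_nonneg _) (by norm_num))
  have h2 : ‖β + D z‖ ≤ γ + 1 / 20 * (2 * γ) := (norm_add_le _ _).trans (add_le_add h.side h1)
  rw [ratioMap, norm_smul, norm_inv, Real.norm_of_nonneg (by linarith),
    inv_mul_le_iff₀ (by linarith)]
  nlinarith

/-- The numerator and the denominator both vary with slope at most `1/20`, values have norm at most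
`1/5` and denominators are at least `9/10`; `(1/20 + 1/100) / (9/10)` is below `1/2`. -/
lemma IsNearRankOne.norm_ratioMap_sub_le (h : IsNearRankOne ε γ α β D) (hε : ε ≤ 1 / 20)
    (hγ : γ ≤ 1 / 20) {z z' : E} (hz : ‖z‖ ≤ 1) (hz' : ‖z'‖ ≤ 1) :
    ‖ratioMap α β D z - ratioMap α β D z'‖ ≤ 1 / 2 * ‖z - z'‖ := by
  have hd := h.den_ge hε hγ hz
  have hd' := h.den_ge hε hγ hz'
  have hβ : ‖β‖ ≤ 1 / 20 := h.side.trans hγ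
  have hD : ‖D‖ ≤ 1 / 20 := h.block.trans hε
  have hR' : ‖ratioMap α β D z'‖ ≤ 1 / 5 := by
    have h1 : ‖D z'‖ ≤ 1 / 20 * 1 :=
      (D.le_opNorm z').trans (mul_le_mul hD hz' (norm_nonneg _) (by norm_num))
    have h2 : ‖β + D z'‖ ≤ 1 / 10 := (norm_add_le _ _).trans (by linarith)
    rw [ratioMap, norm_smul, norm_inv, Real.norm_of_nonneg (by linarith),
      inv_mul_le_iff₀ (by linarith)]
    nlinarith
  have key : ratioMap α β D z - ratioMap α β D z' =
      (α + inner ℝ β z)⁻¹ • (D (z - z') - (inner ℝ β (z - z')) • ratioMap α β D z') := by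
    have e1 : (α + inner ℝ β z') • ratioMap α β D z' = β + D z' := by
      rw [ratioMap, smul_inv_smul₀ (by linarith)]
    have e2 : ratioMap α β D z' =
        (α + inner ℝ β z)⁻¹ • (α + inner ℝ β z) • ratioMap α β D z' := by
      rw [inv_smul_smul₀ (by linarith)]
    conv_lhs => rw [e2]
    conv_lhs => arg 1; rw [ratioMap]
    rw [← smul_sub]
    congr 1
    have e3 : (α + inner ℝ β z) • ratioMap α β D z' =
        (β + D z') + (inner ℝ β (z - z')) • ratioMap α β D z' := by
      rw [← e1, ← add_smul, inner_sub_right]; congr 1; ring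
    rw [e3, map_sub]; abel
  have h1 : ‖D (z - z')‖ ≤ 1 / 20 * ‖z - z'‖ :=
    (D.le_opNorm _).trans (mul_le_mul_of_nonneg_right hD (norm_nonneg _))
  have h2 : ‖(inner ℝ β (z - z')) • ratioMap α β D z'‖ ≤ (1 / 20 * ‖z - z'‖) * (1 / 5) := by
    rw [norm_smul]
    refine mul_le_mul ?_ hR' (norm_nonneg _) (by positivity)
    exact (abs_real_inner_le_norm _ _).trans (mul_le_mul_of_nonneg_right hβ (norm_nonneg _))
  have h3 := norm_sub_le (D (z - z')) ((inner ℝ β (z - z')) • ratioMap α β D z')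
  rw [key, norm_smul, norm_inv, Real.norm_of_nonneg (by linarith), inv_mul_le_iff₀ (by linarith)]
  nlinarith [norm_nonneg (z - z')]

lemma IsNearRankOne.norm_iterate_le (h : IsNearRankOne ε γ α β D) (hε : ε ≤ 1 / 20)
    (hγ : γ ≤ 1 / 20) (k : ℕ) : ‖(ratioMap α β D)^[k] 0‖ ≤ 2 * γ := by
  induction k with
  | zero => simpa using (norm_nonneg _).trans h.side
  | succ k ih =>
    rw [Function.iterate_succ_apply']
    exact h.norm_ratioMap_le hε hγ ih

lemma IsNearRankOne.norm_iterate_succ_sub_le (h : IsNearRankOne ε γ α β D) (hε : ε ≤ 1 / 20)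
    (hγ : γ ≤ 1 / 20) (k : ℕ) :
    ‖(ratioMap α β D)^[k + 1] 0 - (ratioMap α β D)^[k] 0‖ ≤ (1 / 2) ^ k := by
  have hb : ∀ k, ‖(ratioMap α β D)^[k] 0‖ ≤ 1 := fun k =>
    (h.norm_iterate_le hε hγ k).trans (by linarith)
  induction k with
  | zero => simpa using hb 1
  | succ k ih =>
    rw [Function.iterate_succ_apply' _ (k + 1), Function.iterate_succ_apply' _ k]
    refine (h.norm_ratioMap_sub_le hε hγ ?_ (hb k)).trans ?_
    · rw [← Function.iterate_succ_apply' (ratioMap α β D) k]; exact hb (k + 1)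
    · rw [← Function.iterate_succ_apply' (ratioMap α β D) k, pow_succ]; linarith

/-- Adding `b y yᵀ` with `y = (w, g)` changes the image of `(1, z)` by `b (w + ⟪g, z⟫) y`. The
scalar `w + ⟪g, z⟫` therefore factors out of the whole difference, which is what makes the
leave-one-out comparison close on itself. -/
lemma IsNearRankOne.norm_ratioMap_perturb_le {α' : ℝ} {β' : E} {D' : E →L[ℝ] E} {ε' γ' : ℝ}
    (h : IsNearRankOne ε γ α β D) (h' : IsNearRankOne ε' γ' α' β' D')
    (hε : ε ≤ 1 / 20) (hγ : γ ≤ 1 / 20) (hε' : ε' ≤ 1 / 20) (hγ' : γ' ≤ 1 / 20)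
    {b w R : ℝ} {g z : E} (hw : |w| ≤ R) (hg : ‖g‖ ≤ R) (hz : ‖z‖ ≤ 2 * γ)
    (hα : α' = α + b * w ^ 2) (hβ : β' = β + (b * w) • g)
    (hD : D' z = D z + (b * inner ℝ g z) • g) :
    ‖ratioMap α' β' D' z - ratioMap α β D z‖ ≤ 3 * |b| * R * |w + inner ℝ g z| := by
  have hz1 : ‖z‖ ≤ 1 := by linarith
  have hd := h.den_ge hε hγ hz1
  have hd' := h'.den_ge hε' hγ' hz1
  have hF : ‖ratioMap α β D z‖ ≤ 1 := (h.norm_ratioMap_le hε hγ hz).trans (by linarith)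
  set F := ratioMap α β D z with hFdef
  have e1 : (α + inner ℝ β z) • F = β + D z := by
    rw [hFdef, ratioMap, smul_inv_smul₀ (by linarith)]
  have e0 : α' + inner ℝ β' z = (α + inner ℝ β z) + b * (w + inner ℝ g z) * w := by
    rw [hα, hβ, inner_add_left, inner_smul_left]; simp; ring
  have key : ratioMap α' β' D' z - F = (α' + inner ℝ β' z)⁻¹ •
      ((b * (w + inner ℝ g z)) • (g - w • F)) := by
    have e2 : F = (α' + inner ℝ β' z)⁻¹ • (α' + inner ℝ β' z) • F := by
      rw [inv_smul_smul₀ (by linarith)]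
    conv_lhs => rw [e2]
    rw [ratioMap, ← smul_sub]
    congr 1
    rw [e0, add_smul, e1, hβ, hD]
    module
  have hR : 0 ≤ R := (abs_nonneg _).trans hw
  have h1 : ‖g - w • F‖ ≤ 2 * R := by
    refine (norm_sub_le _ _).trans ?_
    rw [norm_smul, Real.norm_eq_abs]
    nlinarith [mul_le_mul hw hF (norm_nonneg _) hR]
  rw [key, norm_smul, norm_inv, Real.norm_of_nonneg (by linarith),
    inv_mul_le_iff₀ (by linarith), norm_smul, Real.norm_eq_abs, abs_mul]
  have h2 := mul_le_mul_of_nonneg_left h1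
    (mul_nonneg (abs_nonneg b) (abs_nonneg (w + inner ℝ g z)))
  have h3 : 0 ≤ |b| * |w + inner ℝ g z| * R := by positivity
  nlinarith

/-- Comparison of a fixed point with the iterates of a leave-one-out map. -/
lemma IsNearRankOne.abs_inner_fixedPoint_le {α' : ℝ} {β' : E} {D' : E →L[ℝ] E} {ε' γ' : ℝ}
    (h : IsNearRankOne ε γ α β D) (h' : IsNearRankOne ε' γ' α' β' D')
    (hε : ε ≤ 1 / 20) (hγ : γ ≤ 1 / 20) (hε' : ε' ≤ 1 / 20) (hγ' : γ' ≤ 1 / 20)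
    {b w R : ℝ} {g : E} (hw : |w| ≤ R) (hg : ‖g‖ ≤ R) (hb : |b| * R ^ 2 ≤ 1 / 6)
    (hα : α' = α + b * w ^ 2) (hβ : β' = β + (b * w) • g)
    (hD : ∀ z, D' z = D z + (b * inner ℝ g z) • g) {ζ : E} (hζ : ‖ζ‖ ≤ 1)
    (hfix : ratioMap α' β' D' ζ = ζ) (k : ℕ) :
    |inner ℝ g ζ| ≤ 2 * |inner ℝ g ((ratioMap α β D)^[k] 0)| + 6 * (|b| * R ^ 2) * |w|
      + 2 * R * (1 / 2) ^ k := by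
  set z := (ratioMap α β D)^[k] 0 with hz
  have hR : 0 ≤ R := (abs_nonneg _).trans hw
  have hzn : ‖z‖ ≤ 2 * γ := h.norm_iterate_le hε hγ k
  have h1 := h.norm_iterate_succ_sub_le hε hγ k
  rw [Function.iterate_succ_apply', ← hz] at h1
  have h2 := h.norm_ratioMap_perturb_le h' hε hγ hε' hγ' hw hg hzn hα hβ (hD z)
  have h3 := h'.norm_ratioMap_sub_le hε' hγ' hζ (hzn.trans (by linarith))
  rw [hfix] at h3
  -- Telescope through the images of `z` under the full and the reduced map. The first difference is
  -- at most `‖ζ - z‖ / 2` by contraction and is absorbed on the left.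
  have h4 : ‖ζ - z‖ ≤ 2 * (3 * |b| * R * |w + inner ℝ g z| + (1 / 2) ^ k) := by
    have : ζ - z = (ζ - ratioMap α' β' D' z) + (ratioMap α' β' D' z - ratioMap α β D z)
      + (ratioMap α β D z - z) := by abel
    have h5 : ‖(ζ - ratioMap α' β' D' z) + (ratioMap α' β' D' z - ratioMap α β D z)
      + (ratioMap α β D z - z)‖ ≤ _ := norm_add₃_le
    rw [← this] at h5
    linarith
  have h5 : |inner ℝ g ζ| ≤ |inner ℝ g z| + R * ‖ζ - z‖ := by
    have : inner ℝ g ζ = inner ℝ g z + inner ℝ g (ζ - z) := by rw [inner_sub_right]; ring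
    rw [this]
    refine (abs_add_le _ _).trans (add_le_add le_rfl ?_)
    exact (abs_real_inner_le_norm _ _).trans (mul_le_mul_of_nonneg_right hg (norm_nonneg _))
  have h6 := mul_le_mul_of_nonneg_left h4 hR
  have h7 : |w + inner ℝ g z| ≤ |w| + |inner ℝ g z| := abs_add_le _ _
  have h8 : 6 * (|b| * R ^ 2) * |w + inner ℝ g z| ≤
      6 * (|b| * R ^ 2) * (|w| + |inner ℝ g z|) := by gcongr
  have h9 : 6 * (|b| * R ^ 2) * |inner ℝ g z| ≤ 1 * |inner ℝ g z| := by gcongr; linarith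
  nlinarith

/-- The eigenvalue dominates `‖D‖`, so the second block equation bounds the tail by `2 γ |u₀|`.
Hence `u₀` cannot vanish, and after division by `u₀` the first equation identifies the denominator
of `ratioMap` with the eigenvalue. -/
lemma IsNearRankOne.eigenvector_ratio (h : IsNearRankOne ε γ α β D) (hε : ε ≤ 1 / 20)
    (hγ : γ ≤ 1 / 20) {l u₀ : ℝ} {u : E} (hl : 9 / 10 ≤ |l|)
    (hne : u₀ ≠ 0 ∨ u ≠ 0) (h0 : l * u₀ = α * u₀ + inner ℝ β u) (h1 : l • u = u₀ • β + D u) :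
    u₀ ≠ 0 ∧ ‖u₀⁻¹ • u‖ ≤ 2 * γ ∧ ratioMap α β D (u₀⁻¹ • u) = u₀⁻¹ • u := by
  have hβ : ‖β‖ ≤ 1 / 20 := h.side.trans hγ
  have hγ0 : 0 ≤ γ := (norm_nonneg _).trans h.side
  have hu : |l| * ‖u‖ ≤ γ * |u₀| + 1 / 20 * ‖u‖ := by
    rw [← Real.norm_eq_abs l, ← norm_smul, h1]
    refine (norm_add_le _ _).trans (add_le_add ?_ ?_)
    · rw [norm_smul, Real.norm_eq_abs, mul_comm]
      exact mul_le_mul_of_nonneg_right h.side (abs_nonneg _)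
    · exact (D.le_opNorm _).trans (mul_le_mul_of_nonneg_right (h.block.trans hε) (norm_nonneg _))
  have hu' : ‖u‖ ≤ 2 * γ * |u₀| := by
    nlinarith [norm_nonneg u, mul_le_mul_of_nonneg_right hl (norm_nonneg u),
      mul_nonneg hγ0 (abs_nonneg u₀)]
  have hu0 : u₀ ≠ 0 := by
    rintro rfl
    rcases hne with hne | hne
    · exact hne rfl
    · simp at hu'; exact hne hu'
  have hn : ‖u₀⁻¹ • u‖ ≤ 2 * γ := by
    rw [norm_smul, norm_inv, Real.norm_eq_abs, inv_mul_le_iff₀ (abs_pos.2 hu0)]; linarith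
  refine ⟨hu0, hn, ?_⟩
  have hd := h.den_ge hε hγ (z := u₀⁻¹ • u) (by linarith)
  have hl' : α + inner ℝ β (u₀⁻¹ • u) = l := by
    rw [inner_smul_right]; field_simp; linarith
  rw [ratioMap, hl']
  rw [hl'] at hd
  rw [inv_smul_eq_iff₀ (by linarith), smul_comm, h1, map_smul, smul_add, inv_smul_smul₀ hu0]

end Deterministic

/-! ### Exponential moments and the Chernoff bound. -/

section MomentGeneratingFunction

lemma exp_le_one_add_add_sq_mul_exp_abs (x : ℝ) :
    Real.exp x ≤ 1 + x + x ^ 2 * Real.exp |x| := by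
  have h1 : Real.exp x * (1 - x) ≤ 1 := by
    have := mul_le_mul_of_nonneg_left (Real.one_sub_le_exp_neg x) (Real.exp_pos x).le
    rwa [← Real.exp_add, add_neg_cancel, Real.exp_zero] at this
  rcases le_total 0 x with hx | hx
  · rw [abs_of_nonneg hx]; nlinarith
  · have h2 := Real.one_le_exp (abs_nonneg x)
    nlinarith [Real.add_one_le_exp x, sq_nonneg x,
      mul_le_mul_of_nonneg_left h2 (sq_nonneg x),
      mul_le_mul_of_nonneg_left (Real.add_one_le_exp x) (neg_nonneg.2 hx)]

variable {X : Type*} [MeasurableSpace X] {μ : Measure X} [IsProbabilityMeasure μ]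

/-- A Bernstein-type device for unbounded variables: one integrable majorant of `φ ^ 2 * exp |φ|`
yields integrability, and only the mean of `φ` enters to first order. -/
lemma integral_exp_le_of_sq_mul_exp_le {φ W : X → ℝ} (hφ : Measurable φ) (hW : Integrable W μ)
    (h : ∀ x, φ x ^ 2 * Real.exp |φ x| ≤ W x) :
    Integrable φ μ ∧ Integrable (fun x => Real.exp (φ x)) μ ∧
      ∫ x, Real.exp (φ x) ∂μ ≤ Real.exp (∫ x, φ x ∂μ + ∫ x, W x ∂μ) := by
  have hsq : ∀ x, φ x ^ 2 ≤ W x := fun x => by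
    nlinarith [h x, mul_le_mul_of_nonneg_left (Real.one_le_exp (abs_nonneg (φ x)))
      (sq_nonneg (φ x))]
  have hi1 : Integrable φ μ := by
    refine ((integrable_const (1 : ℝ)).add hW).mono' hφ.aestronglyMeasurable (ae_of_all _ ?_)
    intro x
    simp only [Pi.add_apply, Real.norm_eq_abs]
    nlinarith [hsq x, sq_abs (φ x), sq_nonneg (|φ x| - 1), abs_nonneg (φ x)]
  have hle : ∀ x, Real.exp (φ x) ≤ 1 + φ x + W x := fun x =>
    (exp_le_one_add_add_sq_mul_exp_abs _).trans (by linarith [h x])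
  have hi3 : Integrable (fun x => 1 + φ x + W x) μ := ((integrable_const _).add hi1).add hW
  have hi2 : Integrable (fun x => Real.exp (φ x)) μ := by
    refine hi3.mono' (by fun_prop) (ae_of_all _ fun x => ?_)
    rw [Real.norm_of_nonneg (Real.exp_pos _).le]; exact hle x
  refine ⟨hi1, hi2, ?_⟩
  calc ∫ x, Real.exp (φ x) ∂μ ≤ ∫ x, (1 + φ x + W x) ∂μ := integral_mono hi2 hi3 hle
    _ = (∫ x, φ x ∂μ + ∫ x, W x ∂μ) + 1 := by
      have hi4 : Integrable (fun x => 1 + φ x) μ := (integrable_const _).add hi1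
      rw [integral_add hi4 hW, integral_add (integrable_const _) hi1]
      simp; ring
    _ ≤ _ := Real.add_one_le_exp _

/-- The Chernoff bound for a sum of independent functions of the coordinates of a product
measure. -/
lemma pi_real_sum_ge_le {ι : Type*} [Fintype ι] {f : ι → X → ℝ} {c : ι → ℝ} {t : ℝ}
    (hi : ∀ i, Integrable (fun x => Real.exp (f i x)) μ)
    (hc : ∀ i, ∫ x, Real.exp (f i x) ∂μ ≤ Real.exp (c i)) :
    (Measure.pi fun _ : ι => μ).real {x | t ≤ ∑ i, f i (x i)} ≤ Real.exp (∑ i, c i - t) := by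
  have hint : Integrable (fun x : ι → X => ∏ i, Real.exp (f i (x i))) (Measure.pi fun _ => μ) :=
    Integrable.fintype_prod_dep hi
  have h1 := mul_meas_ge_le_integral_of_nonneg (ae_of_all _ fun x : ι → X =>
    Finset.prod_nonneg fun i _ => (Real.exp_pos (f i (x i))).le) hint (Real.exp t)
  rw [integral_fintype_prod_eq_prod (fun i x => Real.exp (f i x))] at h1
  have h2 : {x : ι → X | t ≤ ∑ i, f i (x i)} =
      {x : ι → X | Real.exp t ≤ ∏ i, Real.exp (f i (x i))} := by
    ext x; simp [← Real.exp_sum]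
  have h3 : ∏ i, ∫ x, Real.exp (f i x) ∂μ ≤ Real.exp (∑ i, c i) := by
    rw [Real.exp_sum]
    exact Finset.prod_le_prod (fun i _ => integral_nonneg fun x => (Real.exp_pos _).le)
      fun i _ => hc i
  rw [h2, Real.exp_sub, le_div_iff₀ (Real.exp_pos _), mul_comm]
  exact h1.trans h3

end MomentGeneratingFunction

/-! ### Moments of Gaussian variables and of standard Gaussian vectors. -/

section Gaussian

lemma integral_pow_gaussianReal :
    ∫ x, x ∂(gaussianReal 0 1) = 0 ∧ ∫ x, x ^ 2 ∂(gaussianReal 0 1) = 1 ∧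
      ∫ x, x ^ 4 ∂(gaussianReal 0 1) = 3 := by
  have hint : ∀ t : ℝ, t ∈ interior (integrableExpSet (fun x : ℝ => x) (gaussianReal 0 1)) := by
    intro t; rw [integrableExpSet_fun_id_gaussianReal]; simp
  have step : ∀ (k : ℕ) (t : ℝ), HasDerivAt (fun t => ∫ x, x ^ k * Real.exp (t * x) ∂(gaussianReal 0 1))
      (∫ x, x ^ (k + 1) * Real.exp (t * x) ∂(gaussianReal 0 1)) t := fun k t =>
    hasDerivAt_integral_pow_mul_exp_real (hint t) k
  have hE : ∀ t : ℝ, HasDerivAt (fun t : ℝ => Real.exp (t ^ 2 / 2)) (t * Real.exp (t ^ 2 / 2)) t := by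
    intro t
    have := (((hasDerivAt_id t).pow 2).div_const 2).exp
    refine this.congr_deriv ?_
    simp; ring
  have h0 : (fun t => ∫ x, x ^ 0 * Real.exp (t * x) ∂(gaussianReal 0 1)) =
      fun t => Real.exp (t ^ 2 / 2) := by
    have := mgf_fun_id_gaussianReal (μ := 0) (v := 1)
    funext t
    have h := congrFun this t
    simp [mgf] at h
    simpa using h
  -- The tilted moments are derivatives of the moment generating function `exp (t ^ 2 / 2)`, so they
  -- equal `p k t * exp (t ^ 2 / 2)` with the recursion `p ↦ p' + t p`. The moments are the values
  -- at `t = 0`.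
  have next : ∀ (k : ℕ) (p p' : ℝ → ℝ), (∀ t, HasDerivAt p (p' t) t) →
      (fun t => ∫ x, x ^ k * Real.exp (t * x) ∂(gaussianReal 0 1)) =
        (fun t => p t * Real.exp (t ^ 2 / 2)) →
      (fun t => ∫ x, x ^ (k + 1) * Real.exp (t * x) ∂(gaussianReal 0 1)) =
        (fun t => (p' t + t * p t) * Real.exp (t ^ 2 / 2)) := by
    intro k p p' hp h
    funext t
    have h1 := step k t
    rw [h] at h1
    rw [h1.unique ((hp t).mul (hE t))]; ring
  have h0' : (fun t => ∫ x, x ^ 0 * Real.exp (t * x) ∂(gaussianReal 0 1)) =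
      fun t => 1 * Real.exp (t ^ 2 / 2) := by rw [h0]; simp
  have h1 := next 0 _ (fun _ => 0) (fun t => hasDerivAt_const _ _) h0'
  have h2 := next 1 _ (fun _ => 1) (fun t => by
    simpa using hasDerivAt_id' t) h1
  have h3 := next 2 _ (fun t => 2 * t) (fun t => by
    have := ((hasDerivAt_id t).mul (hasDerivAt_id t)).const_add 1
    refine (this.congr_deriv (by simp; ring)).congr_of_eventuallyEq (.of_forall fun s => ?_)
    simp) h2
  have h4 := next 3 _ (fun t => 3 + 3 * t ^ 2) (fun t => by
    have := (((hasDerivAt_id t).pow 3).add ((hasDerivAt_id t).const_mul 3))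
    refine (this.congr_deriv (by simp; ring)).congr_of_eventuallyEq (.of_forall fun s => ?_)
    simp; ring) h3
  refine ⟨?_, ?_, ?_⟩
  · simp
  · have := congrFun h2 0; simpa using this
  · have := congrFun h4 0; simpa using this

lemma integral_exp_mul_sq_gaussianReal {c : ℝ} (hc : c < 1 / 2) :
    Integrable (fun x => Real.exp (c * x ^ 2)) (gaussianReal 0 1) ∧
    ∫ x, Real.exp (c * x ^ 2) ∂(gaussianReal 0 1) = (√(1 - 2 * c))⁻¹ := by
  have hb : 0 < 1 / 2 - c := by linarith
  have key : ∀ x : ℝ, gaussianPDFReal 0 1 x * Real.exp (c * x ^ 2) =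
      (√(2 * Real.pi))⁻¹ * Real.exp (-(1 / 2 - c) * x ^ 2) := by
    intro x
    simp only [gaussianPDFReal, NNReal.coe_one, mul_one, sub_zero]
    rw [mul_assoc, ← Real.exp_add]; congr 2; ring
  constructor
  · rw [gaussianReal_of_var_ne_zero _ one_ne_zero, gaussianPDF_def,
      integrable_withDensity_iff_integrable_smul₀' (by fun_prop) (by simp)]
    simp only [ENNReal.toReal_ofReal (gaussianPDFReal_nonneg _ _ _), smul_eq_mul, key]
    exact (integrable_exp_neg_mul_sq hb).const_mul _
  · rw [integral_gaussianReal_eq_integral_smul one_ne_zero]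
    simp only [smul_eq_mul, key]
    rw [integral_const_mul, integral_gaussian, ← Real.sqrt_inv, ← Real.sqrt_mul (by positivity),
      ← Real.sqrt_inv]
    congr 1
    have : 1 - 2 * c ≠ 0 := by linarith
    have := Real.pi_ne_zero
    field_simp

/-- The centred chi-square variable with one degree of freedom is sub-Gaussian for small parameters.
For `c ≥ 0` the quadratic lower bound of `exp` is used; for `c ≤ 0` the linear one suffices. -/
lemma exp_neg_div_sqrt_le {c : ℝ} (hc : |c| ≤ 1 / 4) :
    Real.exp (-c) * (√(1 - 2 * c))⁻¹ ≤ Real.exp (2 * c ^ 2) := by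
  have hc' := abs_le.1 hc
  have h1 : 0 < 1 - 2 * c := by linarith [hc'.2]
  have h2 : 1 ≤ (1 - 2 * c) * Real.exp (2 * (c + 2 * c ^ 2)) := by
    rcases le_total 0 c with h | h
    · have := Real.quadratic_le_exp_of_nonneg (x := 2 * (c + 2 * c ^ 2)) (by positivity)
      have h4 := mul_le_mul_of_nonneg_left this h1.le
      refine le_trans ?_ h4
      have : 0 ≤ c ^ 2 * (2 * ((1 - 2 * c) * (1 + 2 * c) ^ 2) - 8 * c) := by
        apply mul_nonneg (sq_nonneg _)
        nlinarith [hc'.2, mul_nonneg h h]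
      nlinarith
    · have := Real.add_one_le_exp (2 * (c + 2 * c ^ 2))
      have h4 := mul_le_mul_of_nonneg_left this h1.le
      refine le_trans ?_ h4
      nlinarith [mul_nonneg (neg_nonneg.2 h) (sq_nonneg c)]
  have h3 : 1 ≤ √(1 - 2 * c) * Real.exp (c + 2 * c ^ 2) := by
    have : Real.exp (c + 2 * c ^ 2) = √(Real.exp (2 * (c + 2 * c ^ 2))) := by
      rw [mul_comm 2 (c + 2 * c ^ 2), Real.exp_mul, Real.rpow_two,
        Real.sqrt_sq (Real.exp_pos _).le]
    rw [this, ← Real.sqrt_mul h1.le]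
    exact Real.one_le_sqrt.2 h2
  rw [← div_eq_mul_inv, div_le_iff₀ (Real.sqrt_pos.2 h1)]
  have h4 := mul_le_mul_of_nonneg_left h3 (Real.exp_pos (-c)).le
  calc Real.exp (-c) = Real.exp (-c) * 1 := by ring
    _ ≤ _ := h4
    _ = _ := by
      rw [show Real.exp (2 * c ^ 2) = Real.exp (-c) * Real.exp (c + 2 * c ^ 2) by
        rw [← Real.exp_add]; congr 1; ring]
      ring

variable {E : Type*} [NormedAddCommGroup E] [InnerProductSpace ℝ E] [FiniteDimensional ℝ E]
  [MeasurableSpace E] [BorelSpace E]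

lemma map_inner_stdGaussian (q : E) :
    (stdGaussian E).map (fun x => inner ℝ q x) = gaussianReal 0 (‖q‖₊ ^ 2) := by
  have h := IsGaussian.map_eq_gaussianReal (μ := stdGaussian E) (innerSL ℝ q)
  rw [integral_strongDual_stdGaussian, variance_dual_stdGaussian, innerSL_apply_norm] at h
  have e : (‖q‖ ^ 2).toNNReal = ‖q‖₊ ^ 2 := by
    rw [Real.toNNReal_pow (norm_nonneg _), norm_toNNReal]
  rw [e] at h
  exact h

lemma integral_exp_inner_stdGaussian (q : E) :
    Integrable (fun x => Real.exp (inner ℝ q x)) (stdGaussian E) ∧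
      ∫ x, Real.exp (inner ℝ q x) ∂(stdGaussian E) = Real.exp (‖q‖ ^ 2 / 2) := by
  have hm : AEMeasurable (fun x : E => inner ℝ q x) (stdGaussian E) := by fun_prop
  constructor
  · have h := integrable_exp_mul_gaussianReal (μ := 0) (v := ‖q‖₊ ^ 2) 1
    rw [← map_inner_stdGaussian, integrable_map_measure (by fun_prop) hm] at h
    simpa [Function.comp_def] using h
  · have h := mgf_gaussianReal (map_inner_stdGaussian q) 1
    simpa [mgf] using h

lemma integral_exp_inner_sq_stdGaussian {q : E} (hq : ‖q‖ ≤ 1) :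
    Integrable (fun x => Real.exp (inner ℝ q x ^ 2 / 4)) (stdGaussian E) ∧
      ∫ x, Real.exp (inner ℝ q x ^ 2 / 4) ∂(stdGaussian E) ≤ 2 := by
  have hm : AEMeasurable (fun x : E => inner ℝ q x) (stdGaussian E) := by fun_prop
  have hmap : (gaussianReal 0 1).map (fun x => ‖q‖ * x) =
      (stdGaussian E).map (fun x => inner ℝ q x) := by
    rw [map_inner_stdGaussian]
    have := gaussianReal_map_const_mul (μ := 0) (v := 1) ‖q‖
    simp only [mul_zero, mul_one] at this
    rw [this]
    congr 1
  have hq2 : ‖q‖ ^ 2 / 4 ≤ 1 / 4 := by nlinarith [norm_nonneg q]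
  have h1 := integral_exp_mul_sq_gaussianReal (c := ‖q‖ ^ 2 / 4) (by linarith)
  have e : ∀ x : ℝ, Real.exp (‖q‖ ^ 2 / 4 * x ^ 2) = Real.exp ((‖q‖ * x) ^ 2 / 4) := by
    intro x; congr 1; ring
  simp only [e] at h1
  constructor
  · have h := (integrable_map_measure (μ := gaussianReal 0 1) (f := fun x => ‖q‖ * x)
      (g := fun y => Real.exp (y ^ 2 / 4)) (by fun_prop) (by fun_prop)).2 h1.1
    rw [hmap] at h
    exact (integrable_map_measure (by fun_prop) hm).1 h
  · have h2 := integral_map (μ := gaussianReal 0 1) (φ := fun x => ‖q‖ * x)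
      (f := fun y => Real.exp (y ^ 2 / 4)) (by fun_prop) (by fun_prop)
    rw [hmap, integral_map hm (by fun_prop), h1.2] at h2
    rw [h2]
    rw [inv_le_comm₀ (Real.sqrt_pos.2 (by linarith)) two_pos]
    exact Real.le_sqrt_of_sq_le (by norm_num; linarith)

lemma integral_inner_sq_stdGaussian (q : E) :
    ∫ x, inner ℝ q x ^ 2 ∂(stdGaussian E) = ‖q‖ ^ 2 := by
  have h := variance_dual_stdGaussian (innerSL ℝ q)
  rw [variance_of_integral_eq_zero (by fun_prop) (integral_strongDual_stdGaussian _)] at h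
  simpa using h

lemma stdGaussian_eq_map_pi (b : OrthonormalBasis (Fin (Module.finrank ℝ E)) ℝ E) :
    AEMeasurable (fun x : Fin (Module.finrank ℝ E) → ℝ => ∑ i, x i • b i)
      (Measure.pi fun _ => gaussianReal 0 1) ∧
    ∀ x : Fin (Module.finrank ℝ E) → ℝ, ‖∑ i, x i • b i‖ ^ 2 - (Module.finrank ℝ E : ℝ) =
      ∑ i, (x i ^ 2 - 1) := by
  refine ⟨Measurable.aemeasurable (by fun_prop), fun x => ?_⟩
  have := b.orthonormal.inner_sum x x Finset.univ
  rw [real_inner_self_eq_norm_sq] at this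
  rw [this]; simp [sq]

lemma integral_exp_norm_sq_stdGaussian {c : ℝ} (hc : |c| ≤ 1 / 4) :
    Integrable (fun x => Real.exp (c * (‖x‖ ^ 2 - (Module.finrank ℝ E : ℝ)))) (stdGaussian E) ∧
      ∫ x, Real.exp (c * (‖x‖ ^ 2 - (Module.finrank ℝ E : ℝ))) ∂(stdGaussian E) ≤
        Real.exp (2 * c ^ 2 * (Module.finrank ℝ E : ℝ)) := by
  set b := stdOrthonormalBasis ℝ E
  obtain ⟨hm, hn⟩ := stdGaussian_eq_map_pi b
  have h1 := integral_exp_mul_sq_gaussianReal (c := c) (by linarith [(abs_le.1 hc).2])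
  have e1 : ∀ x : Fin (Module.finrank ℝ E) → ℝ,
      Real.exp (c * (‖∑ i, x i • b i‖ ^ 2 - (Module.finrank ℝ E : ℝ))) =
        ∏ i, (Real.exp (-c) * Real.exp (c * x i ^ 2)) := by
    intro x
    rw [hn, Finset.mul_sum, Real.exp_sum]
    refine Finset.prod_congr rfl fun i _ => ?_
    rw [← Real.exp_add]; congr 1; ring
  rw [stdGaussian_eq_map_pi_orthonormalBasis b]
  constructor
  · rw [integrable_map_measure (by fun_prop) hm]
    simp only [Function.comp_def, e1]
    exact Integrable.fintype_prod fun _ => h1.1.const_mul _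
  · rw [integral_map hm (by fun_prop)]
    simp only [e1]
    rw [integral_fintype_prod_eq_prod (fun _ y => Real.exp (-c) * Real.exp (c * y ^ 2))]
    rw [integral_const_mul, h1.2, Finset.prod_const, Finset.card_univ, Fintype.card_fin,
      mul_comm _ (Module.finrank ℝ E : ℝ), Real.exp_nat_mul]
    exact pow_le_pow_left₀ (by positivity) (exp_neg_div_sqrt_le hc) _

/-- In an orthonormal basis containing `q / ‖q‖`, every other coordinate of `‖x‖ ^ 2 - dim` is
centred and independent of `⟪q, x⟫`. Only the direction of `q` contributes, with `E (g ^ 4 - g ^ 2)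
= 2`. This `2` is the source of the constant `3` in the spectral matrix. -/
lemma integral_norm_sq_mul_inner_sq_stdGaussian (q : E) :
    ∫ x, (‖x‖ ^ 2 - (Module.finrank ℝ E : ℝ)) * inner ℝ q x ^ 2 ∂(stdGaussian E) =
      2 * ‖q‖ ^ 2 := by
  rcases eq_or_ne q 0 with rfl | hq
  · simp
  have hd : 0 < Module.finrank ℝ E := Module.finrank_pos_iff_exists_ne_zero.2 ⟨q, hq⟩
  set i₀ : Fin (Module.finrank ℝ E) := ⟨0, hd⟩
  obtain ⟨b, hb⟩ := Orthonormal.exists_orthonormalBasis_extension_of_card_eq (𝕜 := ℝ) (E := E)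
    (ι := Fin (Module.finrank ℝ E)) (by simp) (v := fun _ => ‖q‖⁻¹ • q) (s := {i₀}) (by
      refine ⟨fun i => ?_, fun i j hij => ?_⟩
      · simp [norm_smul, hq]
      · exact absurd (Subsingleton.elim i j) hij)
  have hb0 : q = ‖q‖ • b i₀ := by
    rw [hb i₀ rfl, smul_inv_smul₀ (norm_ne_zero_iff.2 hq)]
  obtain ⟨hm, hn⟩ := stdGaussian_eq_map_pi b
  have hin : ∀ x : Fin (Module.finrank ℝ E) → ℝ, inner ℝ q (∑ i, x i • b i) = ‖q‖ * x i₀ := by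
    intro x
    conv_lhs => rw [hb0, inner_smul_left, b.orthonormal.inner_right_fintype]
    simp
  rw [stdGaussian_eq_map_pi_orthonormalBasis b, integral_map hm (by fun_prop)]
  simp only [hn, hin]
  obtain ⟨-, m2, m4⟩ := integral_pow_gaussianReal
  have hpow : ∀ k : ℕ, Integrable (fun x : ℝ => x ^ k) (gaussianReal 0 1) := by
    intro k
    have := (memLp_id_gaussianReal (μ := 0) (v := 1) k).integrable_norm_pow'
    refine this.mono (by fun_prop) (ae_of_all _ fun x => ?_)
    simp
  have hev : ∀ i, MeasurePreserving (fun x : Fin (Module.finrank ℝ E) → ℝ => x i)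
      (Measure.pi fun _ => gaussianReal 0 1) (gaussianReal 0 1) := fun i =>
    measurePreserving_eval _ i
  have i2 : ∀ i, Integrable (fun x : Fin (Module.finrank ℝ E) → ℝ => x i ^ 2)
      (Measure.pi fun _ => gaussianReal 0 1) := fun i => (hev i).integrable_comp_of_integrable (hpow 2)
  have hterm : ∀ j, Integrable (fun x : Fin (Module.finrank ℝ E) → ℝ => (x j ^ 2 - 1) * x i₀ ^ 2)
      (Measure.pi fun _ => gaussianReal 0 1) ∧
      ∫ x : Fin (Module.finrank ℝ E) → ℝ, (x j ^ 2 - 1) * x i₀ ^ 2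
        ∂(Measure.pi fun _ => gaussianReal 0 1) = if j = i₀ then 2 else 0 := by
    intro j
    split_ifs with hj
    · rw [hj]
      have e : ∀ y : ℝ, (y ^ 2 - 1) * y ^ 2 = y ^ 4 - y ^ 2 := fun y => by ring
      simp only [e]
      have hI : Integrable (fun y : ℝ => y ^ 4 - y ^ 2) (gaussianReal 0 1) :=
        (hpow 4).sub (hpow 2)
      refine ⟨(hev i₀).integrable_comp_of_integrable hI, ?_⟩
      have := integral_map (hev i₀).aemeasurable
        (f := fun y : ℝ => y ^ 4 - y ^ 2) (by fun_prop)
      rw [(hev i₀).map_eq] at this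
      rw [← this, integral_sub (hpow 4) (hpow 2), m4, m2]; norm_num
    · have hind : IndepFun (fun x : Fin (Module.finrank ℝ E) → ℝ => x j ^ 2 - 1)
          (fun x => x i₀ ^ 2) (Measure.pi fun _ => gaussianReal 0 1) :=
        (iIndepFun_pi (μ := fun _ : Fin (Module.finrank ℝ E) => gaussianReal 0 1)
          (X := fun _ => id) (fun _ => aemeasurable_id)).indepFun hj |>.comp
          (φ := fun y : ℝ => y ^ 2 - 1) (ψ := fun y : ℝ => y ^ 2) (by fun_prop) (by fun_prop)
      have i1 : Integrable (fun x : Fin (Module.finrank ℝ E) → ℝ => x j ^ 2 - 1)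
        (Measure.pi fun _ => gaussianReal 0 1) := (i2 j).sub (integrable_const _)
      refine ⟨hind.integrable_mul i1 (i2 i₀), ?_⟩
      rw [hind.integral_fun_mul_eq_mul_integral i1.aestronglyMeasurable
        (i2 i₀).aestronglyMeasurable]
      have := integral_map (hev j).aemeasurable (f := fun y : ℝ => y ^ 2) (by fun_prop)
      rw [(hev j).map_eq] at this
      rw [integral_sub (i2 j) (integrable_const _), ← this, m2]; simp
  have e2 : ∀ x : Fin (Module.finrank ℝ E) → ℝ, (∑ i, (x i ^ 2 - 1)) * (‖q‖ * x i₀) ^ 2 =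
      ‖q‖ ^ 2 * ∑ j, (x j ^ 2 - 1) * x i₀ ^ 2 := by
    intro x; rw [← Finset.sum_mul]; ring
  simp only [e2]
  rw [integral_const_mul, integral_finsetSum _ fun j _ => (hterm j).1]
  simp only [(hterm _).2]
  simp [mul_comm]

end Gaussian

/-! ### Truncated row weights and their exponential moments. -/

section Weights

variable {E : Type*} [NormedAddCommGroup E] [InnerProductSpace ℝ E]

/-- The deviation of `‖x‖ ^ 2` from its mean under the standard Gaussian measure. -/
def normDev (x : E) : ℝ := ‖x‖ ^ 2 - (Module.finrank ℝ E : ℝ)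

/-- `normDev` replaced by `0` where it exceeds `T` in absolute value. -/
def truncDev (T : ℝ) (x : E) : ℝ := if |normDev x| ≤ T then normDev x else 0

lemma truncDev_neg (T : ℝ) (x : E) : truncDev T (-x) = truncDev T x := by
  unfold truncDev normDev; rw [norm_neg]

lemma abs_truncDev_le {T : ℝ} (hT : 0 ≤ T) (x : E) : |truncDev T x| ≤ T := by
  unfold truncDev; split_ifs with h
  · exact h
  · simpa using hT

lemma sq_truncDev_le (T : ℝ) (x : E) : truncDev T x ^ 2 ≤ normDev x ^ 2 := by
  unfold truncDev; split_ifs with h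
  · exact le_rfl
  · simpa using sq_nonneg (normDev x)

lemma sq_le_two_mul_exp {y : ℝ} (hy : 0 ≤ y) : y ^ 2 ≤ 2 * Real.exp y := by
  linarith [Real.quadratic_le_exp_of_nonneg hy]

/-- The common majorant of the exponential moments used below. -/
def expMajorant (n : ℝ) (q x : E) : ℝ :=
  Real.exp (|normDev x| / (4 * √n)) + Real.exp (inner ℝ q x ^ 2 / 4)

/-- The arithmetic-geometric mean inequality separates the dependent factors `normDev x` and `⟪q,
x⟫`, so that no joint exponential moment has to be computed. -/
lemma exp_mul_exp_le_expMajorant (n : ℝ) (q x : E) :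
    2 * (Real.exp (|normDev x| / (8 * √n)) * Real.exp (inner ℝ q x ^ 2 / 8)) ≤
      expMajorant n q x := by
  have h1 : Real.exp (|normDev x| / (4 * √n)) = Real.exp (|normDev x| / (8 * √n)) ^ 2 := by
    rw [← Real.exp_nat_mul]; congr 1; push_cast
    rw [show (8 : ℝ) * √n = 2 * (4 * √n) by ring, ← div_div, ← div_div, ← div_div]; ring
  have h2 : Real.exp (inner ℝ q x ^ 2 / 4) = Real.exp (inner ℝ q x ^ 2 / 8) ^ 2 := by
    rw [← Real.exp_nat_mul]; congr 1; push_cast; ring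
  rw [expMajorant, h1, h2]
  nlinarith [sq_nonneg (Real.exp (|normDev x| / (8 * √n)) - Real.exp (inner ℝ q x ^ 2 / 8))]

lemma sq_normDev_le {n : ℝ} (hn : 1 ≤ n) (x : E) :
    normDev x ^ 2 ≤ 128 * n * Real.exp (|normDev x| / (8 * √n)) := by
  have hs : 0 < √n := Real.sqrt_pos.2 (by linarith)
  have h := sq_le_two_mul_exp (y := |normDev x| / (8 * √n)) (by positivity)
  rw [div_pow, sq_abs, mul_pow, Real.sq_sqrt (by linarith), div_le_iff₀ (by positivity)] at h
  linarith

lemma pow_four_mul_exp_le (y : ℝ) :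
    y ^ 4 * Real.exp (y ^ 2 / 16) ≤ 512 * Real.exp (y ^ 2 / 8) := by
  have h := sq_le_two_mul_exp (y := y ^ 2 / 16) (by positivity)
  have e : Real.exp (y ^ 2 / 8) = Real.exp (y ^ 2 / 16) * Real.exp (y ^ 2 / 16) := by
    rw [← Real.exp_add]; congr 1; ring
  rw [e]
  nlinarith [Real.exp_pos (y ^ 2 / 16)]

lemma sq_mul_exp_abs_le (y : ℝ) :
    y ^ 2 * Real.exp (|y| / 16) ≤ 32 * Real.exp (y ^ 2 / 8) := by
  have h1 : y ^ 2 ≤ 16 * Real.exp (y ^ 2 / 16) := by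
    linarith [Real.add_one_le_exp (y ^ 2 / 16)]
  have h2 : Real.exp (|y| / 16) ≤ 2 * Real.exp (y ^ 2 / 16) := by
    have : |y| / 16 ≤ Real.log 2 + y ^ 2 / 16 := by
      nlinarith [Real.log_two_gt_d9, sq_abs y, sq_nonneg (|y| - 1)]
    refine (Real.exp_le_exp.2 this).trans ?_
    rw [Real.exp_add, Real.exp_log two_pos]
  have e : Real.exp (y ^ 2 / 8) = Real.exp (y ^ 2 / 16) * Real.exp (y ^ 2 / 16) := by
    rw [← Real.exp_add]; congr 1; ring
  rw [e]
  have := mul_le_mul h1 h2 (Real.exp_pos _).le (by positivity)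
  linarith

variable [MeasurableSpace E] [BorelSpace E]

@[fun_prop]
lemma measurable_normDev : Measurable (normDev : E → ℝ) := by unfold normDev; fun_prop

@[fun_prop]
lemma measurable_truncDev (T : ℝ) : Measurable (truncDev T : E → ℝ) :=
  Measurable.ite (measurableSet_le (by fun_prop) measurable_const) (by fun_prop) (by fun_prop)

variable [FiniteDimensional ℝ E] {n : ℝ}

/-- `normDev` fluctuates on the scale `√dim`; with `c = 1 / (4 √n)` the exponent `2 c ^ 2 dim` is at
most `1/8`, and `2 exp (1/8) ≤ 3`. A real `n ≥ 1` bounding the dimension keeps the scale positive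
even when the space is trivial. -/
lemma integral_exp_abs_normDev (hn : 1 ≤ n) (hd : (Module.finrank ℝ E : ℝ) ≤ n) :
    Integrable (fun x : E => Real.exp (|normDev x| / (4 * √n))) (stdGaussian E) ∧
      ∫ x : E, Real.exp (|normDev x| / (4 * √n)) ∂(stdGaussian E) ≤ 3 := by
  have hs : 1 ≤ √n := Real.one_le_sqrt.2 hn
  set c := (4 * √n)⁻¹ with hc
  have hc0 : 0 < c := by positivity
  have hc1 : |c| ≤ 1 / 4 := by
    rw [abs_of_pos hc0, hc, inv_le_comm₀ (by positivity) (by norm_num)]; norm_num; linarith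
  have hexp : 2 * c ^ 2 * (Module.finrank ℝ E : ℝ) ≤ 1 / 8 := by
    have : c ^ 2 * n = 1 / 16 := by
      rw [hc, inv_pow, mul_pow, Real.sq_sqrt (by linarith)]; field_simp; norm_num
    nlinarith [sq_nonneg c]
  have h8 : Real.exp (1 / 8) ≤ 3 / 2 := by
    have h := Real.exp_bound_div_one_sub_of_interval (x := 1 / 8) (by norm_num) (by norm_num)
    norm_num at h ⊢; linarith
  have h1 := integral_exp_norm_sq_stdGaussian (E := E) hc1
  have h2 := integral_exp_norm_sq_stdGaussian (E := E) (c := -c) (by rwa [abs_neg])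
  have hle : ∀ x : E, Real.exp (|normDev x| / (4 * √n)) ≤
      Real.exp (c * (‖x‖ ^ 2 - (Module.finrank ℝ E : ℝ))) +
      Real.exp (-c * (‖x‖ ^ 2 - (Module.finrank ℝ E : ℝ))) := by
    intro x
    have e : |normDev x| / (4 * √n) = |c * (‖x‖ ^ 2 - (Module.finrank ℝ E : ℝ))| := by
      rw [abs_mul, abs_of_pos hc0, div_eq_inv_mul]; rfl
    rw [e, neg_mul]
    exact Real.exp_abs_le _
  have hI : Integrable (fun x : E => Real.exp (|normDev x| / (4 * √n))) (stdGaussian E) := by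
    refine (h1.1.add h2.1).mono' (by fun_prop) (ae_of_all _ fun x => ?_)
    rw [Real.norm_of_nonneg (Real.exp_pos _).le]; exact hle x
  refine ⟨hI, (integral_mono hI (h1.1.add h2.1) hle).trans ?_⟩
  simp only [Pi.add_apply]
  rw [integral_add h1.1 h2.1]
  have h3 := h2.2
  rw [neg_sq] at h3
  have h4 := Real.exp_le_exp.2 hexp
  linarith [h1.2]

lemma integral_expMajorant (hn : 1 ≤ n) (hd : (Module.finrank ℝ E : ℝ) ≤ n) {q : E}
    (hq : ‖q‖ ≤ 1) :
    Integrable (expMajorant n q) (stdGaussian E) ∧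
      ∫ x, expMajorant n q x ∂(stdGaussian E) ≤ 5 := by
  have h1 := integral_exp_abs_normDev hn hd
  have h2 := integral_exp_inner_sq_stdGaussian hq
  refine ⟨h1.1.add h2.1, ?_⟩
  simp only [expMajorant]
  rw [integral_add h1.1 h2.1]; linarith [h1.2, h2.2]

lemma measureReal_normDev_gt (hn : 1 ≤ n) (hd : (Module.finrank ℝ E : ℝ) ≤ n) (T : ℝ) :
    (stdGaussian E).real {x : E | T < |normDev x|} ≤ 3 * Real.exp (-(T / (4 * √n))) := by
  have hs : 0 < √n := Real.sqrt_pos.2 (by linarith)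
  have h1 := integral_exp_abs_normDev (E := E) hn hd
  have h2 := mul_meas_ge_le_integral_of_nonneg (ae_of_all _ fun x : E =>
    (Real.exp_pos (|normDev x| / (4 * √n))).le) h1.1 (Real.exp (T / (4 * √n)))
  rw [Real.exp_neg, ← div_eq_mul_inv, le_div_iff₀ (Real.exp_pos _), mul_comm]
  refine le_trans (mul_le_mul_of_nonneg_left (measureReal_mono ?_) (Real.exp_pos _).le)
    (h2.trans h1.2)
  intro x hx
  simp only [Set.mem_ofPred_eq, Real.exp_le_exp] at hx ⊢
  gcongr

/-- Truncation only matters where `|normDev x| > T`, and there `exp ((|normDev x| - T) / (16 √n)) ≥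
1` can be inserted, which produces the exponentially small bias. -/
lemma abs_integral_truncDev_sub_le (hn : 1 ≤ n) (hd : (Module.finrank ℝ E : ℝ) ≤ n) {q : E}
    (hq : ‖q‖ ≤ 1) (T : ℝ) :
    Integrable (fun x : E => truncDev T x * inner ℝ q x ^ 2) (stdGaussian E) ∧
    |∫ x : E, truncDev T x * inner ℝ q x ^ 2 ∂(stdGaussian E) - 2 * ‖q‖ ^ 2| ≤
      320 * √n * Real.exp (-(T / (16 * √n))) := by
  have hs : 0 < √n := Real.sqrt_pos.2 (by linarith)
  obtain ⟨hWi, hW⟩ := integral_expMajorant (E := E) hn hd hq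
  have hy : ∀ x : E, inner ℝ q x ^ 2 ≤ 8 * Real.exp (inner ℝ q x ^ 2 / 8) := fun x => by
    linarith [Real.add_one_le_exp (inner ℝ q x ^ 2 / 8)]
  have ha : ∀ x : E, |normDev x| ≤ 16 * √n * Real.exp (|normDev x| / (16 * √n)) := fun x => by
    have := Real.add_one_le_exp (|normDev x| / (16 * √n))
    have h2 : |normDev x| / (16 * √n) ≤ Real.exp (|normDev x| / (16 * √n)) := by linarith
    rw [div_le_iff₀ (by positivity)] at h2; linarith
  have hee : ∀ x : E, Real.exp (|normDev x| / (8 * √n)) =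
      Real.exp (|normDev x| / (16 * √n)) * Real.exp (|normDev x| / (16 * √n)) := fun x => by
    rw [← Real.exp_add]; congr 1
    rw [show (16 : ℝ) * √n = 2 * (8 * √n) by ring, ← div_div, ← div_div, ← div_div]; ring
  have hprod : ∀ x : E, |normDev x| * inner ℝ q x ^ 2 ≤ Real.exp (|normDev x| / (16 * √n)) *
      (128 * √n * Real.exp (inner ℝ q x ^ 2 / 8)) := fun x => by
    have := mul_le_mul (ha x) (hy x) (sq_nonneg _) (by positivity)
    linarith
  have hI : ∀ f : E → ℝ, Measurable f → (∀ x, |f x| ≤ |normDev x|) →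
      Integrable (fun x : E => f x * inner ℝ q x ^ 2) (stdGaussian E) := by
    intro f hf hle
    refine (hWi.const_mul (64 * √n)).mono' (by fun_prop) (ae_of_all _ fun x => ?_)
    rw [norm_mul, Real.norm_eq_abs, Real.norm_of_nonneg (sq_nonneg _)]
    have h1 := mul_le_mul_of_nonneg_right (hle x) (sq_nonneg (inner ℝ q x))
    have h2 := exp_mul_exp_le_expMajorant n q x
    rw [hee] at h2
    have h3 : 1 ≤ Real.exp (|normDev x| / (16 * √n)) := Real.one_le_exp (by positivity)
    have h4 : Real.exp (|normDev x| / (16 * √n)) * Real.exp (inner ℝ q x ^ 2 / 8) ≤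
        Real.exp (|normDev x| / (16 * √n)) * Real.exp (|normDev x| / (16 * √n)) *
          Real.exp (inner ℝ q x ^ 2 / 8) := by
      gcongr; exact le_mul_of_one_le_left (Real.exp_pos _).le h3
    have h5 := mul_le_mul_of_nonneg_left (h4.trans ((le_div_iff₀' two_pos).2 h2))
      (by positivity : 0 ≤ 128 * √n)
    linarith [hprod x]
  have htr : ∀ x : E, |truncDev T x| ≤ |normDev x| := fun x => sq_le_sq.1 (sq_truncDev_le T x)
  have i1 := hI _ (measurable_truncDev T) htr
  have i2 := hI _ measurable_normDev fun x => le_rfl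
  refine ⟨i1, ?_⟩
  rw [← integral_norm_sq_mul_inner_sq_stdGaussian q]
  change |_ - ∫ x : E, normDev x * inner ℝ q x ^ 2 ∂(stdGaussian E)| ≤ _
  rw [← integral_sub i1 i2]
  refine (abs_integral_le_integral_abs).trans ?_
  have hb : ∀ x : E, |truncDev T x * inner ℝ q x ^ 2 - normDev x * inner ℝ q x ^ 2| ≤
      64 * √n * Real.exp (-(T / (16 * √n))) * expMajorant n q x := by
    intro x
    have hM := exp_mul_exp_le_expMajorant n q x
    unfold truncDev
    split_ifs with h
    · rw [sub_self, abs_zero]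
      have : 0 ≤ expMajorant n q x := le_trans (by positivity) hM
      positivity
    · rw [zero_mul, zero_sub, abs_neg, abs_mul, abs_of_nonneg (sq_nonneg (inner ℝ q x))]
      push Not at h
      have h1 : 1 ≤ Real.exp (-(T / (16 * √n))) * Real.exp (|normDev x| / (16 * √n)) := by
        rw [← Real.exp_add]
        apply Real.one_le_exp
        rw [neg_add_eq_sub, ← sub_div]
        have : 0 ≤ |normDev x| - T := by linarith
        positivity
      rw [hee] at hM
      have h2 := mul_le_mul h1 (hprod x) (by positivity) (by positivity)
      have h3 := mul_le_mul_of_nonneg_left hM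
        (by positivity : 0 ≤ 64 * √n * Real.exp (-(T / (16 * √n))))
      linarith
  refine (integral_mono ((i1.sub i2).abs) (hWi.const_mul _) hb).trans ?_
  rw [integral_const_mul]
  have := mul_le_mul_of_nonneg_left hW
    (by positivity : 0 ≤ 64 * √n * Real.exp (-(T / (16 * √n))))
  linarith

/-- Truncation makes `s` times the weight at most `1/16`, so the exponential costs at most `exp (⟪q,
x⟫ ^ 2 / 16)`. The second moment of the weight is nevertheless bounded through `normDev`, which
gives the variance `e + ρ ^ 2 n`; the crude bound `(1 + ρ T) ^ 2` would be larger. -/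
lemma integral_exp_quadratic_le (hn : 1 ≤ n) (hd : (Module.finrank ℝ E : ℝ) ≤ n) {q : E}
    (hq : ‖q‖ ≤ 1) {T ρ e s : ℝ} (hT : 0 ≤ T) (hρ : 0 ≤ ρ) (he : 0 ≤ e) (he1 : e ≤ 1)
    (hs : |s| * (1 + ρ * T) ≤ 1 / 16) :
    Integrable (fun x : E => Real.exp (s * ((e + ρ * truncDev T x) * inner ℝ q x ^ 2)))
      (stdGaussian E) ∧
    ∫ x : E, Real.exp (s * ((e + ρ * truncDev T x) * inner ℝ q x ^ 2)) ∂(stdGaussian E) ≤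
      Real.exp (s * ((e + 2 * ρ) * ‖q‖ ^ 2) + |s| * ρ * (320 * √n * Real.exp (-(T / (16 * √n))))
        + 327680 * s ^ 2 * (e + ρ ^ 2 * n)) := by
  obtain ⟨hWi, hW⟩ := integral_expMajorant (E := E) hn hd hq
  obtain ⟨hti, ht⟩ := abs_integral_truncDev_sub_le (E := E) hn hd hq T
  have hdom : ∀ x : E, (s * ((e + ρ * truncDev T x) * inner ℝ q x ^ 2)) ^ 2 *
      Real.exp |s * ((e + ρ * truncDev T x) * inner ℝ q x ^ 2)| ≤
      65536 * s ^ 2 * (e + ρ ^ 2 * n) * expMajorant n q x := by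
    intro x
    set y := inner ℝ q x
    set a := truncDev T x with ha
    have haT : |a| ≤ T := abs_truncDev_le hT x
    have hw : |e + ρ * a| ≤ 1 + ρ * T := by
      refine (abs_add_le _ _).trans (add_le_add ?_ ?_)
      · rwa [abs_of_nonneg he]
      · rw [abs_mul, abs_of_nonneg hρ]; gcongr
    have h1 : |s * ((e + ρ * a) * y ^ 2)| ≤ y ^ 2 / 16 := by
      rw [abs_mul, abs_mul, abs_of_nonneg (sq_nonneg y)]
      have := mul_le_mul_of_nonneg_left hw (abs_nonneg s)
      have := mul_le_mul_of_nonneg_right (this.trans hs) (sq_nonneg y)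
      linarith
    have h2 : (e + ρ * a) ^ 2 ≤ 2 * (e + ρ ^ 2 * normDev x ^ 2) := by
      have := sq_truncDev_le T x
      rw [← ha] at this
      nlinarith [sq_nonneg (e - ρ * a), mul_le_mul_of_nonneg_left this (sq_nonneg ρ)]
    have h3 := sq_normDev_le hn x
    have h4 := pow_four_mul_exp_le y
    have h5 := exp_mul_exp_le_expMajorant n q x
    set A := Real.exp (|normDev x| / (8 * √n)) with hA
    set B := Real.exp (y ^ 2 / 8) with hB
    have hA1 : 1 ≤ A := Real.one_le_exp (by positivity)
    have hB0 : 0 < B := Real.exp_pos _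
    calc (s * ((e + ρ * a) * y ^ 2)) ^ 2 * Real.exp |s * ((e + ρ * a) * y ^ 2)|
        ≤ (s * ((e + ρ * a) * y ^ 2)) ^ 2 * Real.exp (y ^ 2 / 16) := by gcongr
      _ = s ^ 2 * (e + ρ * a) ^ 2 * (y ^ 4 * Real.exp (y ^ 2 / 16)) := by ring
      _ ≤ s ^ 2 * (2 * (e + ρ ^ 2 * (128 * n * A))) * (512 * B) := by
          have : (e + ρ * a) ^ 2 ≤ 2 * (e + ρ ^ 2 * (128 * n * A)) := by
            nlinarith [mul_le_mul_of_nonneg_left h3 (sq_nonneg ρ)]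
          gcongr
      _ ≤ s ^ 2 * (2 * (128 * (e * A) + ρ ^ 2 * (128 * n * A))) * (512 * B) := by
          have : e ≤ 128 * (e * A) := by nlinarith
          gcongr
      _ = 65536 * s ^ 2 * (e + ρ ^ 2 * n) * (2 * (A * B)) := by ring
      _ ≤ _ := by gcongr
  obtain ⟨hi1, hi2, hle⟩ := integral_exp_le_of_sq_mul_exp_le (μ := stdGaussian E)
    (φ := fun x => s * ((e + ρ * truncDev T x) * inner ℝ q x ^ 2)) (by fun_prop)
    (hWi.const_mul (65536 * s ^ 2 * (e + ρ ^ 2 * n))) hdom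
  refine ⟨hi2, hle.trans (Real.exp_le_exp.2 ?_)⟩
  have hsq : Integrable (fun x : E => inner ℝ q x ^ 2) (stdGaussian E) := by
    refine (hWi.const_mul 4).mono' (by fun_prop) (ae_of_all _ fun x => ?_)
    rw [Real.norm_of_nonneg (sq_nonneg _), expMajorant]
    linarith [Real.add_one_le_exp (inner ℝ q x ^ 2 / 4), Real.exp_pos (|normDev x| / (4 * √n))]
  have e1 : ∀ x : E, s * ((e + ρ * truncDev T x) * inner ℝ q x ^ 2) =
      s * e * inner ℝ q x ^ 2 + s * ρ * (truncDev T x * inner ℝ q x ^ 2) := fun x => by ring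
  rw [integral_const_mul _ (expMajorant n q)]
  simp only [e1]
  rw [integral_add (hsq.const_mul _) (hti.const_mul _), integral_const_mul, integral_const_mul,
    integral_inner_sq_stdGaussian]
  have h1 : s * ρ * (∫ x : E, truncDev T x * inner ℝ q x ^ 2 ∂(stdGaussian E) - 2 * ‖q‖ ^ 2) ≤
      |s| * ρ * (320 * √n * Real.exp (-(T / (16 * √n)))) := by
    refine (le_abs_self _).trans ?_
    rw [abs_mul, abs_mul, abs_of_nonneg hρ]
    gcongr
  have h2 := mul_le_mul_of_nonneg_left hW
    (by positivity : 0 ≤ 65536 * s ^ 2 * (e + ρ ^ 2 * n))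
  linarith

lemma integral_comp_neg_stdGaussian (f : E → ℝ) :
    ∫ x, f (-x) ∂(stdGaussian E) = ∫ x, f x ∂(stdGaussian E) := by
  have h := stdGaussian_map (E := E) (LinearIsometryEquiv.neg ℝ)
  have h2 := (MeasurableEquiv.neg E).measurableEmbedding.integral_map (μ := stdGaussian E) f
  have e : ⇑(MeasurableEquiv.neg E) = ⇑(LinearIsometryEquiv.neg ℝ : E ≃ₗᵢ[ℝ] E) := by
    ext x; simp
  rw [e, h] at h2
  simpa using h2.symm

/-- For an even factor `b` the exponential may be replaced by `cosh`, which is monotone in the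
absolute value of its argument, so `b` can be replaced by its bound `B`. Nothing requires the
parameter to be small. -/
lemma integral_exp_linear_le_of_bounded {q : E} (hq : ‖q‖ ≤ 1) {b : E → ℝ} (hb : Measurable b)
    (hsymm : ∀ x, b (-x) = b x) {B : ℝ} (hB : ∀ x, |b x| ≤ B) :
    Integrable (fun x => Real.exp (b x * inner ℝ q x)) (stdGaussian E) ∧
      ∫ x, Real.exp (b x * inner ℝ q x) ∂(stdGaussian E) ≤ Real.exp (B ^ 2 / 2) := by
  have hB0 : 0 ≤ B := (abs_nonneg _).trans (hB 0)
  have hp := integral_exp_inner_stdGaussian (B • q)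
  have hm := integral_exp_inner_stdGaussian ((-B) • q)
  simp only [inner_smul_left, norm_smul, map_neg, norm_neg, conj_trivial] at hp hm
  have hcosh : ∀ x, Real.cosh (b x * inner ℝ q x) ≤ Real.cosh (B * inner ℝ q x) := fun x => by
    rw [Real.cosh_le_cosh, abs_mul, abs_mul, abs_of_nonneg hB0]
    exact mul_le_mul_of_nonneg_right (hB x) (abs_nonneg _)
  simp only [Real.cosh_eq] at hcosh
  have hdom : Integrable (fun x : E => Real.exp (B * inner ℝ q x) + Real.exp (-B * inner ℝ q x))
    (stdGaussian E) := hp.1.add hm.1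
  have i1 : Integrable (fun x => Real.exp (b x * inner ℝ q x)) (stdGaussian E) := by
    refine hdom.mono' (by fun_prop) (ae_of_all _ fun x => ?_)
    rw [Real.norm_of_nonneg (Real.exp_pos _).le, neg_mul]
    linarith [hcosh x, Real.exp_pos (-(b x * inner ℝ q x))]
  have i2 : Integrable (fun x => Real.exp (-(b x * inner ℝ q x))) (stdGaussian E) := by
    refine hdom.mono' (by fun_prop) (ae_of_all _ fun x => ?_)
    rw [Real.norm_of_nonneg (Real.exp_pos _).le, neg_mul]
    linarith [hcosh x, Real.exp_pos (b x * inner ℝ q x)]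
  refine ⟨i1, ?_⟩
  have hs := integral_comp_neg_stdGaussian (E := E) fun x => Real.exp (b x * inner ℝ q x)
  simp only [hsymm, inner_neg_right, mul_neg] at hs
  have h2 : ∫ x, (Real.exp (b x * inner ℝ q x) + Real.exp (-(b x * inner ℝ q x)))
      ∂(stdGaussian E) ≤
      ∫ x, (Real.exp (B * inner ℝ q x) + Real.exp (-B * inner ℝ q x)) ∂(stdGaussian E) := by
    refine integral_mono (i1.add i2) hdom fun x => ?_
    have := hcosh x
    simp only [neg_mul]; linarith
  rw [integral_add i1 i2, integral_add hp.1 hm.1, hp.2, hm.2, hs] at h2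
  have h3 : Real.exp ((‖B‖ * ‖q‖) ^ 2 / 2) ≤ Real.exp (B ^ 2 / 2) := by
    rw [Real.exp_le_exp, Real.norm_eq_abs, mul_pow, sq_abs]
    have : ‖q‖ ^ 2 ≤ 1 := by nlinarith [norm_nonneg q]
    nlinarith [sq_nonneg B]
  linarith

/-- The counterpart of `integral_exp_linear_le_of_bounded` with the true variance `1 + ρ ^ 2 n` in
place of a squared supremum, at the price of a restriction on `s`. -/
lemma integral_exp_linear_le (hn : 1 ≤ n) (hd : (Module.finrank ℝ E : ℝ) ≤ n) {q : E}
    (hq : ‖q‖ ≤ 1) {T ρ s : ℝ} (hT : 0 ≤ T) (hρ : 0 ≤ ρ)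
    (hs : |s| * (1 + ρ * T) ≤ 1 / 16) :
    Integrable (fun x : E => Real.exp (s * (1 + ρ * truncDev T x) * inner ℝ q x))
      (stdGaussian E) ∧
    ∫ x : E, Real.exp (s * (1 + ρ * truncDev T x) * inner ℝ q x) ∂(stdGaussian E) ≤
      Real.exp (40960 * s ^ 2 * (1 + ρ ^ 2 * n)) := by
  obtain ⟨hWi, hW⟩ := integral_expMajorant (E := E) hn hd hq
  have hdom : ∀ x : E, (s * (1 + ρ * truncDev T x) * inner ℝ q x) ^ 2 *
      Real.exp |s * (1 + ρ * truncDev T x) * inner ℝ q x| ≤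
      8192 * s ^ 2 * (1 + ρ ^ 2 * n) * expMajorant n q x := by
    intro x
    set y := inner ℝ q x
    set a := truncDev T x with ha
    have haT : |a| ≤ T := abs_truncDev_le hT x
    have hw : |1 + ρ * a| ≤ 1 + ρ * T := by
      refine (abs_add_le _ _).trans (add_le_add (by simp) ?_)
      rw [abs_mul, abs_of_nonneg hρ]; gcongr
    have h1 : |s * (1 + ρ * a) * y| ≤ |y| / 16 := by
      rw [abs_mul, abs_mul]
      have := mul_le_mul_of_nonneg_left hw (abs_nonneg s)
      have := mul_le_mul_of_nonneg_right (this.trans hs) (abs_nonneg y)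
      linarith
    have h2 : (1 + ρ * a) ^ 2 ≤ 2 * (1 + ρ ^ 2 * normDev x ^ 2) := by
      have := sq_truncDev_le T x
      rw [← ha] at this
      nlinarith [sq_nonneg (1 - ρ * a), mul_le_mul_of_nonneg_left this (sq_nonneg ρ)]
    have h3 := sq_normDev_le hn x
    have h4 := sq_mul_exp_abs_le y
    have h5 := exp_mul_exp_le_expMajorant n q x
    set A := Real.exp (|normDev x| / (8 * √n)) with hA
    set B := Real.exp (y ^ 2 / 8) with hB
    have hA1 : 1 ≤ A := Real.one_le_exp (by positivity)
    have hB0 : 0 < B := Real.exp_pos _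
    calc (s * (1 + ρ * a) * y) ^ 2 * Real.exp |s * (1 + ρ * a) * y|
        ≤ (s * (1 + ρ * a) * y) ^ 2 * Real.exp (|y| / 16) := by gcongr
      _ = s ^ 2 * (1 + ρ * a) ^ 2 * (y ^ 2 * Real.exp (|y| / 16)) := by ring
      _ ≤ s ^ 2 * (2 * (1 + ρ ^ 2 * (128 * n * A))) * (32 * B) := by
          have : (1 + ρ * a) ^ 2 ≤ 2 * (1 + ρ ^ 2 * (128 * n * A)) := by
            nlinarith [mul_le_mul_of_nonneg_left h3 (sq_nonneg ρ)]
          gcongr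
      _ ≤ s ^ 2 * (2 * (128 * A + ρ ^ 2 * (128 * n * A))) * (32 * B) := by
          have : 1 ≤ 128 * A := by linarith
          gcongr
      _ = 4096 * s ^ 2 * (1 + ρ ^ 2 * n) * (2 * (A * B)) := by ring
      _ ≤ 4096 * s ^ 2 * (1 + ρ ^ 2 * n) * expMajorant n q x := by gcongr
      _ ≤ _ := by
          have : 0 ≤ s ^ 2 * (1 + ρ ^ 2 * n) * expMajorant n q x := by
            have : 0 ≤ expMajorant n q x := le_trans (by positivity) h5
            positivity
          linarith
  obtain ⟨hi1, hi2, hle⟩ := integral_exp_le_of_sq_mul_exp_le (μ := stdGaussian E)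
    (φ := fun x => s * (1 + ρ * truncDev T x) * inner ℝ q x) (by fun_prop)
    (hWi.const_mul (8192 * s ^ 2 * (1 + ρ ^ 2 * n))) hdom
  refine ⟨hi2, hle.trans (Real.exp_le_exp.2 ?_)⟩
  -- The integrand is odd, so the first-order term vanishes.
  have hz := integral_comp_neg_stdGaussian (E := E) fun x =>
    s * (1 + ρ * truncDev T x) * inner ℝ q x
  simp only [truncDev_neg, inner_neg_right, mul_neg] at hz
  rw [integral_neg] at hz
  rw [integral_const_mul]
  have h2 := mul_le_mul_of_nonneg_left hW
    (by positivity : 0 ≤ 8192 * s ^ 2 * (1 + ρ ^ 2 * n))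
  linarith

end Weights

/-! ### Tail bounds for sums over independent rows. -/

section Tails

lemma pi_real_abs_sum_ge_le {X : Type*} [MeasurableSpace X] {μ : Measure X}
    [IsProbabilityMeasure μ] {ι : Type*} [Fintype ι] {f : ι → X → ℝ} {c : ι → ℝ} {s t : ℝ}
    (hs : 0 < s)
    (h : ∀ s', |s'| = s → ∀ i, Integrable (fun x => Real.exp (s' * f i x)) μ ∧
      ∫ x, Real.exp (s' * f i x) ∂μ ≤ Real.exp (c i)) :
    (Measure.pi fun _ : ι => μ).real {x | t ≤ |∑ i, f i (x i)|} ≤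
      2 * Real.exp (∑ i, c i - s * t) := by
  have h1 := h s (abs_of_pos hs)
  have h2 := h (-s) (by rw [abs_neg, abs_of_pos hs])
  have p1 := pi_real_sum_ge_le (μ := μ) (t := s * t) (fun i => (h1 i).1) (fun i => (h1 i).2)
  have p2 := pi_real_sum_ge_le (μ := μ) (t := s * t) (fun i => (h2 i).1) (fun i => (h2 i).2)
  have hsub : {x : ι → X | t ≤ |∑ i, f i (x i)|} ⊆
      {x | s * t ≤ ∑ i, s * f i (x i)} ∪ {x | s * t ≤ ∑ i, -s * f i (x i)} := by
    intro x hx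
    simp only [Set.mem_union, Set.mem_ofPred_eq, ← Finset.mul_sum] at hx ⊢
    rcases le_abs.1 hx with hx | hx
    · left; gcongr
    · right; nlinarith
  have := (measureReal_mono (μ := Measure.pi fun _ : ι => μ) hsub).trans
    (measureReal_union_le _ _)
  linarith

variable {E : Type*} [NormedAddCommGroup E] [InnerProductSpace ℝ E]
  [MeasurableSpace E] [BorelSpace E] [FiniteDimensional ℝ E] {ι : Type*} [Fintype ι] {n : ℝ}

/-- The truncation bias and the variance may each use a quarter of `s t`; half of the Chernoff gain
remains. -/
lemma pi_real_quadratic_ge_le (hn : 1 ≤ n) (hd : (Module.finrank ℝ E : ℝ) ≤ n) {q : E}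
    (hq : ‖q‖ ≤ 1) {T ρ s t : ℝ} (hT : 0 ≤ T) (hρ : 0 ≤ ρ) {σ : ι → ℝ} (hσ : ∀ i, |σ i| ≤ 1)
    (hs : 0 < s) (hsT : s * (1 + ρ * T) ≤ 1 / 16)
    (hbias : (Fintype.card ι : ℝ) * (ρ * (320 * √n * Real.exp (-(T / (16 * √n))))) ≤ t / 4)
    (hvar : 327680 * s * (∑ i, σ i ^ 2 + Fintype.card ι * (ρ ^ 2 * n)) ≤ t / 4) :
    (Measure.pi fun _ : ι => stdGaussian E).real
      {x | t ≤ |∑ i, ((σ i ^ 2 + ρ * truncDev T (x i)) * inner ℝ q (x i) ^ 2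
        - (σ i ^ 2 + 2 * ρ) * ‖q‖ ^ 2)|} ≤ 2 * Real.exp (-(s * t / 2)) := by
  have hσ2 : ∀ i, σ i ^ 2 ≤ 1 := fun i => by
    rw [← sq_abs]; exact pow_le_one₀ (abs_nonneg _) (hσ i)
  refine (pi_real_abs_sum_ge_le (μ := stdGaussian E) (s := s) (t := t)
    (f := fun i x => (σ i ^ 2 + ρ * truncDev T x) * inner ℝ q x ^ 2
        - (σ i ^ 2 + 2 * ρ) * ‖q‖ ^ 2)
    (c := fun i => s * ρ * (320 * √n * Real.exp (-(T / (16 * √n))))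
        + 327680 * s ^ 2 * (σ i ^ 2 + ρ ^ 2 * n)) hs ?_).trans ?_
  · intro s' hs' i
    obtain ⟨h1, h2⟩ := integral_exp_quadratic_le (E := E) hn hd hq (e := σ i ^ 2) (s := s') hT hρ
      (sq_nonneg _) (hσ2 i) (by rwa [hs'])
    have e : ∀ x : E, Real.exp (s' * ((σ i ^ 2 + ρ * truncDev T x) * inner ℝ q x ^ 2
        - (σ i ^ 2 + 2 * ρ) * ‖q‖ ^ 2)) =
        Real.exp (-(s' * ((σ i ^ 2 + 2 * ρ) * ‖q‖ ^ 2))) *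
        Real.exp (s' * ((σ i ^ 2 + ρ * truncDev T x) * inner ℝ q x ^ 2)) := by
      intro x; rw [← Real.exp_add]; congr 1; ring
    simp only [e]
    refine ⟨h1.const_mul _, ?_⟩
    rw [integral_const_mul]
    refine (mul_le_mul_of_nonneg_left h2 (Real.exp_pos _).le).trans ?_
    rw [← Real.exp_add, hs', ← sq_abs s', hs', Real.exp_le_exp]
    linarith
  · rw [Finset.sum_add_distrib, Finset.sum_const, Finset.card_univ, ← Finset.mul_sum,
      Finset.sum_add_distrib, Finset.sum_const, Finset.card_univ, nsmul_eq_mul, nsmul_eq_mul]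
    have := mul_le_mul_of_nonneg_left hbias hs.le
    have := mul_le_mul_of_nonneg_left hvar hs.le
    have : Real.exp ((Fintype.card ι : ℝ) * (s * ρ * (320 * √n * Real.exp (-(T / (16 * √n)))))
        + 327680 * s ^ 2 * (∑ i, σ i ^ 2 + Fintype.card ι * (ρ ^ 2 * n)) - s * t) ≤
        Real.exp (-(s * t / 2)) := by
      rw [Real.exp_le_exp]; linarith
    linarith

lemma pi_real_linear_ge_le_of_bounded {q : E} (hq : ‖q‖ ≤ 1) {T ρ s t : ℝ} (hT : 0 ≤ T)
    (hρ : 0 ≤ ρ) {σ : ι → ℝ} (hs : 0 < s) :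
    (Measure.pi fun _ : ι => stdGaussian E).real
      {x | t ≤ |∑ i, σ i * (1 + ρ * truncDev T (x i)) * inner ℝ q (x i)|} ≤
      2 * Real.exp (s ^ 2 * (1 + ρ * T) ^ 2 / 2 * ∑ i, σ i ^ 2 - s * t) := by
  rw [Finset.mul_sum]
  refine pi_real_abs_sum_ge_le (μ := stdGaussian E) (s := s) (t := t)
    (f := fun i x => σ i * (1 + ρ * truncDev T x) * inner ℝ q x) hs ?_
  intro s' hs' i
  have h := integral_exp_linear_le_of_bounded (E := E) hq
    (b := fun x => s' * (σ i * (1 + ρ * truncDev T x))) (by fun_prop)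
    (fun x => by rw [truncDev_neg]) (B := s * (|σ i| * (1 + ρ * T))) (fun x => by
      rw [abs_mul, abs_mul, hs']
      gcongr
      refine (abs_add_le _ _).trans (add_le_add (by simp) ?_)
      rw [abs_mul, abs_of_nonneg hρ]
      gcongr
      exact abs_truncDev_le hT x)
  have e : ∀ x : E, s' * (σ i * (1 + ρ * truncDev T x)) * inner ℝ q x =
      s' * (σ i * (1 + ρ * truncDev T x) * inner ℝ q x) := fun x => by ring
  simp only [e] at h
  refine ⟨h.1, h.2.trans (Real.exp_le_exp.2 (le_of_eq ?_))⟩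
  rw [mul_pow, mul_pow, sq_abs]; ring

lemma pi_real_linear_ge_le (hn : 1 ≤ n) (hd : (Module.finrank ℝ E : ℝ) ≤ n) {q : E}
    (hq : ‖q‖ ≤ 1) {T ρ s t : ℝ} (hT : 0 ≤ T) (hρ : 0 ≤ ρ) {σ : ι → ℝ} (hσ : ∀ i, |σ i| ≤ 1)
    (hs : 0 < s) (hsT : s * (1 + ρ * T) ≤ 1 / 16) :
    (Measure.pi fun _ : ι => stdGaussian E).real
      {x | t ≤ |∑ i, σ i * (1 + ρ * truncDev T (x i)) * inner ℝ q (x i)|} ≤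
      2 * Real.exp (40960 * s ^ 2 * (1 + ρ ^ 2 * n) * ∑ i, σ i ^ 2 - s * t) := by
  rw [Finset.mul_sum]
  refine pi_real_abs_sum_ge_le (μ := stdGaussian E) (s := s) (t := t)
    (f := fun i x => σ i * (1 + ρ * truncDev T x) * inner ℝ q x) hs ?_
  intro s' hs' i
  have h := integral_exp_linear_le (E := E) hn hd hq (s := s' * σ i) hT hρ (by
    rw [abs_mul, hs']
    refine le_trans ?_ hsT
    have : s * |σ i| ≤ s * 1 := by gcongr; exact hσ i
    rw [mul_one] at this
    gcongr)
  have e : ∀ x : E, s' * σ i * (1 + ρ * truncDev T x) * inner ℝ q x =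
      s' * (σ i * (1 + ρ * truncDev T x) * inner ℝ q x) := fun x => by ring
  simp only [e] at h
  refine ⟨h.1, h.2.trans (Real.exp_le_exp.2 (le_of_eq ?_))⟩
  rw [mul_pow, ← sq_abs s', hs']; ring

lemma pi_real_normDev_ge_le {s t : ℝ} {σ : ι → ℝ} (hσ : ∀ i, |σ i| ≤ 1)
    (hs : 0 < s) (hs4 : s ≤ 1 / 4) :
    (Measure.pi fun _ : ι => stdGaussian E).real {x | t ≤ |∑ i, σ i ^ 2 * normDev (x i)|} ≤
      2 * Real.exp (2 * s ^ 2 * Module.finrank ℝ E * ∑ i, σ i ^ 2 - s * t) := by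
  rw [Finset.mul_sum]
  refine pi_real_abs_sum_ge_le (μ := stdGaussian E) (s := s) (t := t)
    (f := fun i x => σ i ^ 2 * normDev x) hs ?_
  intro s' hs' i
  have hσ2 : σ i ^ 2 ≤ 1 := by
    rw [← sq_abs]; exact pow_le_one₀ (abs_nonneg _) (hσ i)
  have h := integral_exp_norm_sq_stdGaussian (E := E) (c := s' * σ i ^ 2) (by
    rw [abs_mul, hs', abs_of_nonneg (sq_nonneg _)]
    nlinarith [sq_nonneg (σ i)])
  have e : ∀ x : E, s' * σ i ^ 2 * (‖x‖ ^ 2 - (Module.finrank ℝ E : ℝ)) =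
      s' * (σ i ^ 2 * normDev x) := fun x => by unfold normDev; ring
  simp only [e] at h
  refine ⟨h.1, h.2.trans (Real.exp_le_exp.2 ?_)⟩
  rw [mul_pow, ← sq_abs s', hs']
  have : (σ i ^ 2) ^ 2 ≤ σ i ^ 2 := by nlinarith [sq_nonneg (σ i)]
  have : s ^ 2 * (Module.finrank ℝ E : ℝ) * (σ i ^ 2) ^ 2 ≤
    s ^ 2 * (Module.finrank ℝ E : ℝ) * σ i ^ 2 := by gcongr
  linarith

lemma pi_real_exists_normDev_gt_le (hn : 1 ≤ n) (hd : (Module.finrank ℝ E : ℝ) ≤ n) (T : ℝ) :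
    (Measure.pi fun _ : ι => stdGaussian E).real {x | ∃ i, T < |normDev (x i)|} ≤
      Fintype.card ι * (3 * Real.exp (-(T / (4 * √n)))) := by
  have e : {x : ι → E | ∃ i, T < |normDev (x i)|} = ⋃ i, {x | T < |normDev (x i)|} := by
    ext x; simp
  rw [e]
  refine (measureReal_iUnion_fintype_le _).trans ?_
  rw [← nsmul_eq_mul, ← Finset.card_univ, ← Finset.sum_const]
  refine Finset.sum_le_sum fun i _ => ?_
  have hm : MeasurableSet {x : E | T < |normDev x|} :=
    measurableSet_lt measurable_const (by fun_prop)
  have := (measurePreserving_eval (fun _ : ι => stdGaussian E) i).measureReal_preimage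
    hm.nullMeasurableSet
  exact this.le.trans (measureReal_normDev_gt hn hd T)

/-- A coordinate of a product of standard Gaussian measures against a vector that does not depend
on that coordinate. -/
lemma pi_real_inner_ge_le [DecidableEq ι] (i : ι) {z : (ι → E) → E} (hz : Measurable z)
    (hzi : ∀ x y, z (Function.update x i y) = z x) {r s t : ℝ} (hs : 0 < s) :
    (Measure.pi fun _ : ι => stdGaussian E).real
      {x | ‖z x‖ ≤ r ∧ t ≤ |inner ℝ (x i) (z x)|} ≤
      2 * Real.exp (s ^ 2 * r ^ 2 / 2 - s * t) := by
  have hset1 : MeasurableSet {x : ι → E | ‖z x‖ ≤ r} :=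
    measurableSet_le (by fun_prop) measurable_const
  have hset2 : MeasurableSet {x : ι → E | t ≤ |inner ℝ (x i) (z x)|} :=
    measurableSet_le measurable_const (by fun_prop)
  have hset : MeasurableSet {x : ι → E | ‖z x‖ ≤ r ∧ t ≤ |inner ℝ (x i) (z x)|} :=
    hset1.inter hset2
  have key : ∀ w : E, ‖w‖ ≤ r → (stdGaussian E) {y | t ≤ |inner ℝ y w|} ≤
      ENNReal.ofReal (2 * Real.exp (s ^ 2 * r ^ 2 / 2 - s * t)) := by
    intro w hw
    rw [← ofReal_measureReal]
    refine ENNReal.ofReal_le_ofReal ?_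
    have hbd : ∀ w' : E, ‖w'‖ ≤ r → (stdGaussian E).real {y | t ≤ inner ℝ w' y} ≤
        Real.exp (s ^ 2 * r ^ 2 / 2 - s * t) := by
      intro w' hw'
      have h1 := integral_exp_inner_stdGaussian (s • w')
      have h2 := mul_meas_ge_le_integral_of_nonneg (ae_of_all _ fun y : E =>
        (Real.exp_pos (inner ℝ (s • w') y)).le) h1.1 (Real.exp (s * t))
      rw [h1.2] at h2
      rw [Real.exp_sub, le_div_iff₀ (Real.exp_pos _), mul_comm]
      refine le_trans (mul_le_mul_of_nonneg_left (measureReal_mono ?_) (Real.exp_pos _).le)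
        (h2.trans (Real.exp_le_exp.2 ?_))
      · intro y hy
        simp only [Set.mem_ofPred_eq, Real.exp_le_exp, inner_smul_left, conj_trivial] at hy ⊢
        gcongr
      · rw [norm_smul, Real.norm_of_nonneg hs.le, mul_pow]; gcongr
    have hsub : {y : E | t ≤ |inner ℝ y w|} ⊆ {y | t ≤ inner ℝ w y} ∪ {y | t ≤ inner ℝ (-w) y} := by
      intro y hy
      simp only [Set.mem_union, Set.mem_ofPred_eq, inner_neg_left] at hy ⊢
      rw [real_inner_comm] at hy
      exact le_abs.1 hy
    have := (measureReal_mono (μ := stdGaussian E) hsub).trans (measureReal_union_le _ _)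
    linarith [hbd w hw, hbd (-w) (by rwa [norm_neg])]
  -- Integrate out coordinate `i` alone: `z` does not see it, so with the other coordinates frozen
  -- `key` applies to the constant vector `z x`, and the event is empty when `‖z x‖ > r`.
  have hle := lintegral_le_of_lmarginal_le (μ := fun _ : ι => stdGaussian E) {i}
    (f := Set.indicator {x | ‖z x‖ ≤ r ∧ t ≤ |inner ℝ (x i) (z x)|} 1)
    (g := fun _ => ENNReal.ofReal (2 * Real.exp (s ^ 2 * r ^ 2 / 2 - s * t)))
    (measurable_const.indicator hset) measurable_const (by
      intro x
      rw [lmarginal_singleton, lmarginal_singleton]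
      simp only [lintegral_const, measure_univ, mul_one]
      by_cases hr : ‖z x‖ ≤ r
      · refine le_trans (le_of_eq ?_) (key (z x) hr)
        have hm : MeasurableSet {y : E | t ≤ |inner ℝ y (z x)|} :=
          measurableSet_le measurable_const (by fun_prop)
        rw [← lintegral_indicator_one hm]
        congr 1
        ext y
        simp [Set.indicator_apply, hzi, hr]
      · refine le_trans (le_of_eq ?_) zero_le
        rw [lintegral_eq_zero_iff' (by
          refine Measurable.aemeasurable ?_
          exact (measurable_const.indicator hset).comp (measurable_update x))]
        refine ae_of_all _ fun y => ?_
        simp [hzi, hr])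
  rw [lintegral_indicator_one hset] at hle
  simp only [lintegral_const, measure_univ, mul_one] at hle
  exact ENNReal.toReal_le_of_le_ofReal (by positivity) hle

end Tails

/-! ### A half-net of the unit ball. -/

section Net

variable {E : Type*} [NormedAddCommGroup E] [InnerProductSpace ℝ E]

variable (E) in
-- A 1-separated subset of the ball of radius `2` has at most `5 ^ dim` points. One of maximal
-- cardinality is also 1-dense there, since a point farther than `1` from all of it could be added;
-- scaling by `1/2` gives the net.
lemma exists_half_net [FiniteDimensional ℝ E] : ∃ 𝒩 : Finset E, 𝒩.card ≤ 5 ^ Module.finrank ℝ E ∧ (∀ q ∈ 𝒩, ‖q‖ ≤ 1) ∧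
    ∀ x : E, ‖x‖ ≤ 1 → ∃ q ∈ 𝒩, ‖x - q‖ ≤ 1 / 2 := by
  classical
  set P : Finset E → Prop := fun s => (∀ c ∈ s, ‖c‖ ≤ 2) ∧
    ∀ c ∈ s, ∀ d ∈ s, c ≠ d → 1 ≤ ‖c - d‖ with hP
  have hcard : ∀ s, P s → s.card ≤ 5 ^ Module.finrank ℝ E := fun s hs =>
    Besicovitch.card_le_of_separated s hs.1 hs.2
  obtain ⟨s, hs, hmax⟩ : ∃ s, P s ∧ ∀ s', P s' → s'.card ≤ s.card := by
    have hne : ∃ k, ∃ s, P s ∧ s.card = k := ⟨0, ∅, by simp [hP], rfl⟩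
    obtain ⟨s, hs, hk⟩ := Nat.findGreatest_spec (P := fun k => ∃ s, P s ∧ s.card = k)
      (Nat.zero_le (5 ^ Module.finrank ℝ E)) ⟨∅, by simp [hP], rfl⟩
    refine ⟨s, hs, fun s' hs' => ?_⟩
    rw [hk]
    exact Nat.le_findGreatest (hcard s' hs') ⟨s', hs', rfl⟩
  have hinj : Function.Injective (fun c : E => (1 / 2 : ℝ) • c) :=
    smul_right_injective E (by norm_num)
  refine ⟨s.image fun c => (1 / 2 : ℝ) • c, ?_, ?_, ?_⟩
  · rw [Finset.card_image_of_injective _ hinj]; exact hcard s hs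
  · intro q hq
    obtain ⟨c, hc, rfl⟩ := Finset.mem_image.1 hq
    rw [norm_smul]; norm_num; linarith [hs.1 c hc]
  · intro x hx
    by_contra! hcon
    have hfar : ∀ c ∈ s, 1 < ‖(2 : ℝ) • x - c‖ := by
      intro c hc
      have h1 := hcon _ (Finset.mem_image_of_mem _ hc)
      have : (2 : ℝ) • x - c = (2 : ℝ) • (x - (1 / 2 : ℝ) • c) := by
        rw [smul_sub, smul_smul]; norm_num
      rw [this, norm_smul]; norm_num; linarith
    have hx2 : ‖(2 : ℝ) • x‖ ≤ 2 := by rw [norm_smul]; norm_num; linarith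
    have hnot : (2 : ℝ) • x ∉ s := fun h => by
      have := hfar _ h; simp at this; linarith
    have := hmax (insert ((2 : ℝ) • x) s) ⟨fun c hc => ?_, fun c hc d hd hcd => ?_⟩
    · rw [Finset.card_insert_of_notMem hnot] at this; omega
    · rcases Finset.mem_insert.1 hc with rfl | hc
      · exact hx2
      · exact hs.1 c hc
    · rcases Finset.mem_insert.1 hc with rfl | hc <;> rcases Finset.mem_insert.1 hd with rfl | hd
      · exact absurd rfl hcd
      · exact (hfar d hd).le
      · rw [norm_sub_rev]; exact (hfar c hc).le
      · exact hs.2 c hc d hd hcd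

lemma norm_le_of_half_net {𝒩 : Finset E}
    (hnet : ∀ x : E, ‖x‖ ≤ 1 → ∃ q ∈ 𝒩, ‖x - q‖ ≤ 1 / 2) {w : E} {t : ℝ}
    (h : ∀ q ∈ 𝒩, |inner ℝ q w| ≤ t) : ‖w‖ ≤ 2 * t := by
  rcases eq_or_ne w 0 with rfl | hw
  · obtain ⟨q, hq, -⟩ := hnet 0 (by simp)
    have := (abs_nonneg _).trans (h q hq)
    simpa using this
  · have hw' : ‖w‖ ≠ 0 := norm_ne_zero_iff.2 hw
    obtain ⟨q, hq, hq2⟩ := hnet (‖w‖⁻¹ • w) (by rw [norm_smul, norm_inv, norm_norm]; field_simp; rfl)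
    have h1 : inner ℝ (‖w‖⁻¹ • w) w = ‖w‖ := by
      rw [inner_smul_left, real_inner_self_eq_norm_sq]; simp; field_simp
    have h2 : inner ℝ (‖w‖⁻¹ • w - q) w ≤ 1 / 2 * ‖w‖ :=
      (real_inner_le_norm _ _).trans (mul_le_mul_of_nonneg_right hq2 (norm_nonneg _))
    rw [inner_sub_left, h1] at h2
    linarith [(abs_le.1 (h q hq)).2]

/-- Each argument of the bilinear form `⟪p, D q⟫` costs a factor `2`; symmetry of `D` is not needed.
-/
lemma opNorm_le_of_half_net {𝒩 : Finset E}
    (hnet : ∀ x : E, ‖x‖ ≤ 1 → ∃ q ∈ 𝒩, ‖x - q‖ ≤ 1 / 2) {D : E →L[ℝ] E} {t : ℝ} (ht : 0 ≤ t)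
    (h : ∀ p ∈ 𝒩, ∀ q ∈ 𝒩, |inner ℝ p (D q)| ≤ t) : ‖D‖ ≤ 4 * t := by
  have h1 : ∀ q ∈ 𝒩, ‖D q‖ ≤ 2 * t := fun q hq =>
    norm_le_of_half_net hnet fun p hp => h p hp q hq
  have h2 : ‖D‖ ≤ 2 * t + 1 / 2 * ‖D‖ := by
    refine D.opNorm_le_of_unit_norm (by positivity) fun x hx => ?_
    obtain ⟨q, hq, hq2⟩ := hnet x hx.le
    have e : D x = D q + D (x - q) := by rw [map_sub]; abel
    rw [e]
    refine (norm_add_le _ _).trans (add_le_add (h1 q hq) ?_)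
    refine (D.le_opNorm _).trans ?_
    rw [mul_comm]; gcongr
  linarith

end Net

/-! ### Rotation equivariance and leading eigenvalues. -/

section Matrices

variable {N n : ℕ}

lemma spectralMatrix_mul_orthogonal (Y : Matrix (Fin N) (Fin n) ℝ) {Q : Matrix (Fin n) (Fin n) ℝ}
    (hQ : Q ∈ Matrix.orthogonalGroup (Fin n) ℝ) :
    spectralMatrix (Y * Q) = Qᵀ * spectralMatrix Y * Q := by
  have hQ1 : Qᵀ * Q = 1 := (Matrix.mem_orthogonalGroup_iff' (Fin n) ℝ).1 hQ
  have hQ2 : Q * Qᵀ = 1 := (Matrix.mem_orthogonalGroup_iff (Fin n) ℝ).1 hQ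
  have hrow : ∀ i, (Y * Q) i = Y i ᵥ* Q := fun i => rfl
  have hdot : ∀ i, (Y * Q) i ⬝ᵥ (Y * Q) i = Y i ⬝ᵥ Y i := by
    intro i
    rw [hrow, ← Matrix.dotProduct_mulVec, ← Matrix.vecMul_transpose, Matrix.vecMul_vecMul, hQ2,
      Matrix.vecMul_one]
  have hvec : ∀ i, Matrix.vecMulVec ((Y * Q) i) ((Y * Q) i) =
      Qᵀ * Matrix.vecMulVec (Y i) (Y i) * Q := by
    intro i
    rw [hrow, Matrix.mul_vecMulVec, Matrix.vecMulVec_mul, Matrix.mulVec_transpose]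
  simp only [spectralMatrix, hdot, hvec]
  rw [Matrix.mul_sub, Matrix.sub_mul, Matrix.mul_sum, Matrix.sum_mul]
  simp only [Matrix.mul_smul, Matrix.smul_mul, Matrix.mul_one, hQ1]

lemma IsLeadingEigenvector.orthogonal_mulVec {M Q : Matrix (Fin n) (Fin n) ℝ}
    (hQ : Q ∈ Matrix.orthogonalGroup (Fin n) ℝ) {u : Fin n → ℝ}
    (h : IsLeadingEigenvector (Qᵀ * M * Q) u) : IsLeadingEigenvector M (Q *ᵥ u) := by
  have hQ1 : Qᵀ * Q = 1 := (Matrix.mem_orthogonalGroup_iff' (Fin n) ℝ).1 hQ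
  have hQ2 : Q * Qᵀ = 1 := (Matrix.mem_orthogonalGroup_iff (Fin n) ℝ).1 hQ
  obtain ⟨hu, l, hl, hmax⟩ := h
  refine ⟨?_, l, ?_, fun μ hμ => hmax μ ?_⟩
  · rw [Matrix.dotProduct_mulVec, ← Matrix.mulVec_transpose, Matrix.mulVec_mulVec, hQ1,
      Matrix.one_mulVec, hu]
  · have := congrArg (fun w => Q *ᵥ w) hl
    simp only [Matrix.mulVec_mulVec, Matrix.mulVec_smul] at this
    rw [Matrix.mulVec_mulVec, ← this]
    congr 1
    rw [← Matrix.mul_assoc, ← Matrix.mul_assoc, hQ2, Matrix.one_mul]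
  · obtain ⟨w, hw⟩ := hμ.exists_hasEigenvector
    have hw1 := hw.apply_eq_smul
    rw [Matrix.toLin'_apply] at hw1
    refine Module.End.hasEigenvalue_of_hasEigenvector (x := Qᵀ *ᵥ w)
      (Module.End.hasEigenvector_iff.2 ⟨Module.End.mem_eigenspace_iff.2 ?_, fun h0 => hw.2 ?_⟩)
    · rw [Matrix.toLin'_apply, Matrix.mulVec_mulVec, Matrix.mul_assoc, Matrix.mul_assoc, hQ2,
        Matrix.mul_one, ← Matrix.mulVec_mulVec, hw1, Matrix.mulVec_smul]
    · have := congrArg (fun w => Q *ᵥ w) h0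
      simpa [Matrix.mulVec_mulVec, hQ2] using this

/-- A diagonal entry of a symmetric matrix is at most its spectral radius. Applied to the corner,
this bounds the leading eigenvalue from below without locating the rest of the spectrum. -/
lemma IsLeadingEigenvector.abs_diag_le {M : Matrix (Fin n) (Fin n) ℝ} (hM : M.IsHermitian)
    {l : ℝ} (hmax : ∀ μ : ℝ, Module.End.HasEigenvalue (Matrix.toLin' M) μ → |μ| ≤ |l|)
    (i : Fin n) : |M i i| ≤ |l| := by
  set b := hM.eigenvectorBasis
  have hev : ∀ k, |hM.eigenvalues k| ≤ |l| := fun k => by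
    refine hmax _ (Module.End.hasEigenvalue_of_hasEigenvector (x := WithLp.ofLp (b k))
      (Module.End.hasEigenvector_iff.2 ⟨Module.End.mem_eigenspace_iff.2 ?_, fun h0 => ?_⟩))
    · rw [Matrix.toLin'_apply]; exact hM.mulVec_eigenvectorBasis k
    · have h1 := b.orthonormal.1 k
      have : b k = 0 := by ext j; exact congrFun h0 j
      rw [this] at h1; simp at h1
  set e : EuclideanSpace ℝ (Fin n) := EuclideanSpace.single i 1 with he
  set w : EuclideanSpace ℝ (Fin n) := WithLp.toLp 2 (M *ᵥ WithLp.ofLp e) with hw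
  have hwi : w i = M i i := by
    simp [hw, he]
  have hin : ∀ k, inner ℝ (b k) w = hM.eigenvalues k * inner ℝ (b k) e := by
    intro k
    have h1 : inner ℝ (b k) w = (WithLp.ofLp (b k)) ⬝ᵥ (M *ᵥ WithLp.ofLp e) := by
      simp [EuclideanSpace.inner_eq_star_dotProduct, hw, dotProduct_comm]
    have h2 : inner ℝ (b k) e = (WithLp.ofLp (b k)) ⬝ᵥ (WithLp.ofLp e) := by
      rw [EuclideanSpace.inner_eq_star_dotProduct, dotProduct_comm]; simp
    have hMT : Mᵀ = M := by simpa using hM.eq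
    rw [h1, h2, Matrix.dotProduct_mulVec, ← Matrix.mulVec_transpose, hMT,
      hM.mulVec_eigenvectorBasis, smul_dotProduct, smul_eq_mul]
  have hnorm : ‖w‖ ^ 2 ≤ |l| ^ 2 := by
    rw [← b.sum_sq_inner_right w]
    have h1 : ∑ k, inner ℝ (b k) e ^ 2 = 1 := by
      rw [b.sum_sq_inner_right]; simp [he]
    calc ∑ k, inner ℝ (b k) w ^ 2 ≤ ∑ k, |l| ^ 2 * inner ℝ (b k) e ^ 2 := by
          refine Finset.sum_le_sum fun k _ => ?_
          rw [hin, mul_pow, ← sq_abs (hM.eigenvalues k)]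
          have := hev k
          gcongr
      _ = |l| ^ 2 := by rw [← Finset.mul_sum, h1, mul_one]
  rw [← hwi]
  have h3 : |w i| ≤ ‖w‖ := by
    have := PiLp.norm_apply_le w i
    simpa using this
  exact h3.trans (pow_le_pow_iff_left₀ (norm_nonneg _) (abs_nonneg _) two_ne_zero |>.1 hnorm)

lemma isHermitian_spectralMatrix (Y : Matrix (Fin N) (Fin n) ℝ) :
    (spectralMatrix Y).IsHermitian := by
  have : (spectralMatrix Y)ᵀ = spectralMatrix Y := by
    simp [spectralMatrix, Matrix.transpose_sum, Matrix.transpose_vecMulVec]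
  simpa [Matrix.IsHermitian] using this

end Matrices

/-! ### Block form of the rescaled operator and removal of a row. -/

section Blocks

variable {E : Type*} [NormedAddCommGroup E] [InnerProductSpace ℝ E] {ι : Type*}
  (κ c : ℝ) (b w : ι → ℝ) (g : ι → E) (s : Finset ι)

/-- The corner of the block operator `κ⁻¹ (∑ i ∈ s, b i y i (y i)ᵀ - c I)`, `y i = (w i, g i)`. -/
def cornerPart : ℝ := κ⁻¹ * (∑ i ∈ s, b i * w i ^ 2 - c)

/-- The off-diagonal part of the block operator `κ⁻¹ (∑ i ∈ s, b i y i (y i)ᵀ - c I)`. -/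
def sidePart : E := κ⁻¹ • ∑ i ∈ s, (b i * w i) • g i

/-- The large diagonal block of the block operator `κ⁻¹ (∑ i ∈ s, b i y i (y i)ᵀ - c I)`. -/
def blockPart : E →L[ℝ] E :=
  κ⁻¹ • (∑ i ∈ s, b i • (innerSL ℝ (g i)).smulRight (g i) - c • ContinuousLinearMap.id ℝ E)

lemma blockPart_apply (z : E) :
    blockPart κ c b g s z = κ⁻¹ • (∑ i ∈ s, (b i * inner ℝ (g i) z) • g i - c • z) := by
  simp [blockPart, smul_smul]

/-- The power iteration that uses the rows in `s` only. -/
def rowIterate (k : ℕ) : E :=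
  (ratioMap (cornerPart κ c b w s) (sidePart κ b w g s) (blockPart κ c b g s))^[k] 0

variable {κ c b w g s}

lemma cornerPart_erase [DecidableEq ι] {i : ι} (hi : i ∈ s) :
    cornerPart κ c b w s = cornerPart κ c b w (s.erase i) + (κ⁻¹ * b i) * w i ^ 2 := by
  rw [cornerPart, cornerPart, ← Finset.add_sum_erase s _ hi]; ring

lemma sidePart_erase [DecidableEq ι] {i : ι} (hi : i ∈ s) :
    sidePart κ b w g s = sidePart κ b w g (s.erase i) + (κ⁻¹ * b i * w i) • g i := by
  rw [sidePart, sidePart, ← Finset.add_sum_erase s _ hi, smul_add, smul_smul, add_comm, mul_assoc]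

lemma blockPart_erase [DecidableEq ι] {i : ι} (hi : i ∈ s) (z : E) :
    blockPart κ c b g s z =
      blockPart κ c b g (s.erase i) z + (κ⁻¹ * b i * inner ℝ (g i) z) • g i := by
  rw [blockPart_apply, blockPart_apply, ← Finset.add_sum_erase s _ hi]
  module

lemma rowIterate_congr {b' w' : ι → ℝ} {g' : ι → E} (hb : ∀ i ∈ s, b i = b' i)
    (hw : ∀ i ∈ s, w i = w' i) (hg : ∀ i ∈ s, g i = g' i) (k : ℕ) :
    rowIterate κ c b w g s k = rowIterate κ c b' w' g' s k := by
  have h1 : cornerPart κ c b w s = cornerPart κ c b' w' s := by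
    unfold cornerPart
    rw [Finset.sum_congr rfl fun i hi => by rw [hb i hi, hw i hi]]
  have h2 : sidePart κ b w g s = sidePart κ b' w' g' s := by
    unfold sidePart
    rw [Finset.sum_congr rfl fun i hi => by rw [hb i hi, hw i hi, hg i hi]]
  have h3 : blockPart κ c b g s = blockPart κ c b' g' s := by
    unfold blockPart
    rw [Finset.sum_congr rfl fun i hi => by rw [hb i hi, hg i hi]]
  unfold rowIterate
  rw [h1, h2, h3]

lemma measurable_rowIterate [MeasurableSpace E] [BorelSpace E] [FiniteDimensional ℝ E]
    {X : Type*} [MeasurableSpace X] {b w : ι → X → ℝ} {g : ι → X → E}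
    (hb : ∀ i, Measurable (b i)) (hw : ∀ i, Measurable (w i)) (hg : ∀ i, Measurable (g i)) (k : ℕ) :
    Measurable fun x => rowIterate κ c (fun i => b i x) (fun i => w i x) (fun i => g i x) s k := by
  induction k with
  | zero => simp [rowIterate]
  | succ k ih =>
    -- With the operators written out as finite sums, each iterate is an explicit measurable
    -- expression in the rows and the previous iterate.
    have e : (fun x => rowIterate κ c (fun i => b i x) (fun i => w i x) (fun i => g i x) s (k + 1)) =
        fun x => (κ⁻¹ * (∑ i ∈ s, b i x * w i x ^ 2 - c) +
          inner ℝ (κ⁻¹ • ∑ i ∈ s, (b i x * w i x) • g i x)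
            (rowIterate κ c (fun i => b i x) (fun i => w i x) (fun i => g i x) s k))⁻¹ •
          (κ⁻¹ • ∑ i ∈ s, (b i x * w i x) • g i x +
            κ⁻¹ • (∑ i ∈ s, (b i x * inner ℝ (g i x) (rowIterate κ c (fun i => b i x)
              (fun i => w i x) (fun i => g i x) s k)) • g i x
              - c • rowIterate κ c (fun i => b i x) (fun i => w i x) (fun i => g i x) s k)) := by
      funext x
      conv_lhs => rw [rowIterate, Function.iterate_succ_apply']
      rw [ratioMap, blockPart_apply]
      rfl
    rw [e]
    fun_prop

end Blocks

/-! ### Deterministic consequences of a regular sample. -/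

section Regular

variable {E : Type*} [NormedAddCommGroup E] [InnerProductSpace ℝ E] {N : ℕ}

/-- The weight of a row in the rescaled spectral matrix. -/
def rowWeight (ρ : ℝ) (σ : Fin N → ℝ) (x : Fin N → E) (i : Fin N) : ℝ :=
  σ i ^ 2 + ρ * normDev (x i)

/-- The planted entry `σ i / √(N ρ)` of a row. -/
def plantedEntry (ρ : ℝ) (σ : Fin N → ℝ) (i : Fin N) : ℝ := σ i / √((N : ℝ) * ρ)

/-- The Gaussian part of a row. -/
def gaussianRow (x : Fin N → E) (i : Fin N) : E := (√(N : ℝ))⁻¹ • x i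

/-- The power iteration without the row `i`. -/
def leaveOneOut (ρ : ℝ) (k : ℕ) (σ : Fin N → ℝ) (i : Fin N) (x : Fin N → E) : E :=
  rowIterate (1 - 3 * ρ) (3 * ρ) (rowWeight ρ σ x) (plantedEntry ρ σ) (gaussianRow x)
    (Finset.univ.erase i) k

/-- The properties of a sample that imply exact recovery. -/
structure IsRegularSample (ρ T μ : ℝ) (k : ℕ) (𝒩 : Finset E) (σ : Fin N → ℝ)
    (x : Fin N → E) : Prop where
  normDev_le : ∀ i, |normDev (x i)| ≤ T
  corner : |∑ i, σ i ^ 2 * normDev (x i)| ≤ |1 - 3 * ρ| / 1000 * N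
  side : ∀ q ∈ 𝒩, |∑ i, σ i * (1 + ρ * normDev (x i)) * inner ℝ q (x i)| ≤
    |1 - 3 * ρ| / 2000 * μ * (N * √ρ)
  block_add : ∀ p ∈ 𝒩, ∀ q ∈ 𝒩, |∑ i, ((σ i ^ 2 + ρ * normDev (x i)) *
    inner ℝ ((1 / 2 : ℝ) • (p + q)) (x i) ^ 2 - (σ i ^ 2 + 2 * ρ) * ‖(1 / 2 : ℝ) • (p + q)‖ ^ 2)| ≤
      |1 - 3 * ρ| / 1000 * N
  block_sub : ∀ p ∈ 𝒩, ∀ q ∈ 𝒩, |∑ i, ((σ i ^ 2 + ρ * normDev (x i)) *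
    inner ℝ ((1 / 2 : ℝ) • (p - q)) (x i) ^ 2 - (σ i ^ 2 + 2 * ρ) * ‖(1 / 2 : ℝ) • (p - q)‖ ^ 2)| ≤
      |1 - 3 * ρ| / 1000 * N
  leaveOneOut : ∀ i, ‖leaveOneOut ρ k σ i x‖ ≤ μ / 250 →
    |inner ℝ (x i) (leaveOneOut ρ k σ i x)| ≤ 1 / 50 / √ρ

variable {ρ T μ : ℝ} {k : ℕ} {𝒩 : Finset E} {σ : Fin N → ℝ} {x : Fin N → E}

lemma sq_sq_of_sign (hσ : ∀ i, σ i = -1 ∨ σ i = 0 ∨ σ i = 1) (i : Fin N) :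
    σ i ^ 4 = σ i ^ 2 ∧ σ i ^ 3 = σ i ∧ |σ i| ≤ 1 := by
  rcases hσ i with h | h | h <;> rw [h] <;> norm_num

/-- The corner collects two errors of size `1/1000`, the side gains a factor `2` from the net, and
the block has three errors of size `1/1000` multiplied by the factor `4` of the net. The means `ρ`
of `σ i ^ 2` and `2 ρ` of the Gaussian weight cancel against `3 ρ`. -/
lemma IsRegularSample.isNearRankOne (h : IsRegularSample ρ T μ k 𝒩 σ x)
    (hnet : ∀ x : E, ‖x‖ ≤ 1 → ∃ q ∈ 𝒩, ‖x - q‖ ≤ 1 / 2) (hnorm : ∀ q ∈ 𝒩, ‖q‖ ≤ 1)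
    (hN : 0 < N) (hρ : 0 < ρ) (hρ1 : ρ ≤ 1) (hκ : 1 - 3 * ρ ≠ 0)
    (hσ : ∀ i, σ i = -1 ∨ σ i = 0 ∨ σ i = 1)
    (hm : |∑ i, σ i ^ 2 - N * ρ| ≤ |1 - 3 * ρ| / 1000 * (N * ρ)) :
    IsNearRankOne (12 / 1000) (μ / 1000)
      (cornerPart (1 - 3 * ρ) (3 * ρ) (rowWeight ρ σ x) (plantedEntry ρ σ) Finset.univ)
      (sidePart (1 - 3 * ρ) (rowWeight ρ σ x) (plantedEntry ρ σ) (gaussianRow x) Finset.univ)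
      (blockPart (1 - 3 * ρ) (3 * ρ) (rowWeight ρ σ x) (gaussianRow x) Finset.univ) := by
  have hN' : (0 : ℝ) < N := by exact_mod_cast hN
  have hNρ : 0 < (N : ℝ) * ρ := by positivity
  have hκ' : 0 < |1 - 3 * ρ| := abs_pos.2 hκ
  set κ := 1 - 3 * ρ with hκdef
  refine ⟨?_, ?_, ?_⟩
  · have e : cornerPart κ (3 * ρ) (rowWeight ρ σ x) (plantedEntry ρ σ) Finset.univ - 1 =
        κ⁻¹ * ((∑ i, σ i ^ 2 - N * ρ) / (N * ρ) + (∑ i, σ i ^ 2 * normDev (x i)) / N) := by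
      have e1 : ∑ i, rowWeight ρ σ x i * plantedEntry ρ σ i ^ 2 =
          (∑ i, σ i ^ 2) / (N * ρ) + (∑ i, σ i ^ 2 * normDev (x i)) / N := by
        rw [Finset.sum_div, Finset.sum_div, ← Finset.sum_add_distrib]
        refine Finset.sum_congr rfl fun i _ => ?_
        rw [rowWeight, plantedEntry, div_pow, Real.sq_sqrt hNρ.le]
        field_simp
        have := (sq_sq_of_sign hσ i).1
        linear_combination this
      rw [cornerPart, e1, eq_comm, ← sub_eq_zero]
      field_simp
      rw [hκdef]; ring
    rw [e, abs_mul, abs_inv, inv_mul_le_iff₀ hκ']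
    refine (abs_add_le _ _).trans ?_
    rw [abs_div, abs_div, abs_of_pos hNρ, abs_of_pos hN']
    have h1 : |∑ i, σ i ^ 2 - N * ρ| / (N * ρ) ≤ |κ| / 1000 := by rwa [div_le_iff₀ hNρ]
    have h2 : |∑ i, σ i ^ 2 * normDev (x i)| / N ≤ |κ| / 1000 := by
      rw [div_le_iff₀ hN']; exact h.corner
    linarith
  · have e : sidePart κ (rowWeight ρ σ x) (plantedEntry ρ σ) (gaussianRow x) Finset.univ =
        (κ⁻¹ * (N * √ρ)⁻¹) • ∑ i, (σ i * (1 + ρ * normDev (x i))) • x i := by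
      rw [sidePart, mul_smul, Finset.smul_sum (r := ((N : ℝ) * √ρ)⁻¹)]
      congr 1
      refine Finset.sum_congr rfl fun i _ => ?_
      rw [gaussianRow, smul_smul, smul_smul]
      congr 1
      rw [rowWeight, plantedEntry, Real.sqrt_mul hN'.le]
      have h1 : (N : ℝ)⁻¹ = (√(N : ℝ))⁻¹ * (√(N : ℝ))⁻¹ := by
        rw [← mul_inv, Real.mul_self_sqrt hN'.le]
      have h2 : 0 < √(N : ℝ) := Real.sqrt_pos.2 hN'
      have h3 : 0 < √ρ := Real.sqrt_pos.2 hρ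
      have h4 := (sq_sq_of_sign hσ i).2.1
      rw [mul_inv (N : ℝ), h1]
      field_simp
      linear_combination h4
    have hs : ‖∑ i, (σ i * (1 + ρ * normDev (x i))) • x i‖ ≤
        2 * (|κ| / 2000 * μ * (N * √ρ)) := by
      refine norm_le_of_half_net hnet fun q hq => ?_
      rw [inner_sum]
      simp only [inner_smul_right]
      exact h.side q hq
    rw [e, norm_smul, norm_mul, norm_inv, norm_inv, Real.norm_eq_abs,
      Real.norm_of_nonneg (by positivity)]
    have h3 : 0 < (N : ℝ) * √ρ := mul_pos hN' (Real.sqrt_pos.2 hρ)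
    rw [mul_assoc, inv_mul_le_iff₀ hκ', inv_mul_le_iff₀ h3]
    linarith
  · have hb : ∀ p ∈ 𝒩, ∀ q ∈ 𝒩,
        |inner ℝ p (blockPart κ (3 * ρ) (rowWeight ρ σ x) (gaussianRow x) Finset.univ q)| ≤
          3 / 1000 := by
      intro p hp q hq
      -- Polarization: `⟪p, D q⟫` is the difference of the quadratic forms at `(p + q) / 2` and `(p
      -- - q) / 2`, which again lie in the unit ball.
      set r := (1 / 2 : ℝ) • (p + q) with hr
      set r' := (1 / 2 : ℝ) • (p - q) with hr'
      have hsq : ‖r‖ ^ 2 - ‖r'‖ ^ 2 = inner ℝ p q := by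
        rw [hr, hr', norm_smul, norm_smul, mul_pow, mul_pow, norm_add_sq_real, norm_sub_sq_real]
        norm_num; ring
      have hin : ∀ y : E, inner ℝ r y ^ 2 - inner ℝ r' y ^ 2 = inner ℝ p y * inner ℝ q y := by
        intro y
        simp only [hr, hr', inner_smul_left, inner_add_left, inner_sub_left, conj_trivial]
        ring
      have e : inner ℝ p (blockPart κ (3 * ρ) (rowWeight ρ σ x) (gaussianRow x) Finset.univ q) =
          κ⁻¹ * ((N : ℝ)⁻¹ * ((∑ i, ((σ i ^ 2 + ρ * normDev (x i)) * inner ℝ r (x i) ^ 2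
            - (σ i ^ 2 + 2 * ρ) * ‖r‖ ^ 2)) -
            (∑ i, ((σ i ^ 2 + ρ * normDev (x i)) * inner ℝ r' (x i) ^ 2
            - (σ i ^ 2 + 2 * ρ) * ‖r'‖ ^ 2)) + (∑ i, σ i ^ 2 - N * ρ) * inner ℝ p q)) := by
        rw [blockPart_apply, inner_smul_right, inner_sub_right, inner_smul_right, inner_sum]
        congr 1
        have e1 : ∀ i, (rowWeight ρ σ x i * inner ℝ (gaussianRow x i) q) • gaussianRow x i =
            ((N : ℝ)⁻¹ * (rowWeight ρ σ x i * inner ℝ (x i) q)) • x i := by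
          intro i
          rw [gaussianRow, inner_smul_left, smul_smul]
          congr 1
          have h1 : (√(N : ℝ))⁻¹ * (√(N : ℝ))⁻¹ = (N : ℝ)⁻¹ := by
            rw [← mul_inv, Real.mul_self_sqrt hN'.le]
          rw [conj_trivial, ← h1]; ring
        simp only [e1, inner_smul_right]
        rw [← Finset.sum_sub_distrib]
        have e2 : ∀ i, ((σ i ^ 2 + ρ * normDev (x i)) * inner ℝ r (x i) ^ 2
            - (σ i ^ 2 + 2 * ρ) * ‖r‖ ^ 2) - ((σ i ^ 2 + ρ * normDev (x i)) * inner ℝ r' (x i) ^ 2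
            - (σ i ^ 2 + 2 * ρ) * ‖r'‖ ^ 2) = rowWeight ρ σ x i * inner ℝ (x i) q *
            inner ℝ p (x i) - σ i ^ 2 * inner ℝ p q - 2 * ρ * inner ℝ p q := by
          intro i
          rw [rowWeight, ← hsq, real_inner_comm q (x i)]
          linear_combination (σ i ^ 2 + ρ * normDev (x i)) * hin (x i)
        rw [Finset.sum_congr rfl fun i _ => e2 i]
        simp only [Finset.sum_sub_distrib, ← Finset.sum_mul, Finset.sum_const, Finset.card_univ,
          Fintype.card_fin, nsmul_eq_mul, mul_assoc, ← Finset.mul_sum]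
        field_simp
        ring
      have hpq : |inner ℝ p q| ≤ 1 := (abs_real_inner_le_norm _ _).trans
        (mul_le_one₀ (hnorm p hp) (norm_nonneg _) (hnorm q hq))
      rw [e, abs_mul, abs_inv, inv_mul_le_iff₀ hκ', abs_mul, abs_of_pos (inv_pos.2 hN'),
        inv_mul_le_iff₀ hN']
      refine (abs_add_le _ _).trans ?_
      have h1 := h.block_add p hp q hq
      have h2 := h.block_sub p hp q hq
      have h3 := abs_sub (∑ i, ((σ i ^ 2 + ρ * normDev (x i)) * inner ℝ r (x i) ^ 2
            - (σ i ^ 2 + 2 * ρ) * ‖r‖ ^ 2))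
            (∑ i, ((σ i ^ 2 + ρ * normDev (x i)) * inner ℝ r' (x i) ^ 2
            - (σ i ^ 2 + 2 * ρ) * ‖r'‖ ^ 2))
      have h4 : |(∑ i, σ i ^ 2 - N * ρ) * inner ℝ p q| ≤ |κ| / 1000 * N := by
        rw [abs_mul]
        have : |κ| / 1000 * (N * ρ) ≤ |κ| / 1000 * (N * 1) := by gcongr
        have := mul_le_mul hm hpq (abs_nonneg _) (by positivity)
        linarith
      linarith
    have := opNorm_le_of_half_net hnet (by norm_num) hb
    linarith

lemma IsRegularSample.rowWeight_le (h : IsRegularSample ρ T μ k 𝒩 σ x) (hρ : 0 < ρ)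
    (hσ : ∀ i, σ i = -1 ∨ σ i = 0 ∨ σ i = 1) (i : Fin N) :
    |rowWeight ρ σ x i| ≤ 1 + ρ * T := by
  have h1 : σ i ^ 2 ≤ 1 := by
    rw [← sq_abs]; exact pow_le_one₀ (abs_nonneg _) (sq_sq_of_sign hσ i).2.2
  refine (abs_add_le _ _).trans (add_le_add ?_ ?_)
  · rwa [abs_of_nonneg (sq_nonneg _)]
  · rw [abs_mul, abs_of_pos hρ]; gcongr; exact h.normDev_le i

lemma plantedEntry_le (hN : 0 < N) (hρ : 0 < ρ)
    (hσ : ∀ i, σ i = -1 ∨ σ i = 0 ∨ σ i = 1) (i : Fin N) :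
    |plantedEntry ρ σ i| ≤ 1 / √(N * ρ) := by
  rw [plantedEntry, abs_div, abs_of_nonneg (Real.sqrt_nonneg _)]
  have := (sq_sq_of_sign hσ i).2.2
  gcongr

lemma IsRegularSample.norm_gaussianRow_le (h : IsRegularSample ρ T μ k 𝒩 σ x) {n : ℝ}
    (hd : (Module.finrank ℝ E : ℝ) ≤ n) (hN : 0 < N) (i : Fin N) :
    ‖gaussianRow x i‖ ≤ √((n + T) / N) := by
  have hN' : (0 : ℝ) < N := by exact_mod_cast hN
  apply Real.le_sqrt_of_sq_le
  rw [gaussianRow, norm_smul, mul_pow, norm_inv, Real.norm_of_nonneg (Real.sqrt_nonneg _),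
    inv_pow, Real.sq_sqrt hN'.le, inv_mul_eq_div]
  have := (abs_le.1 (h.normDev_le i)).2
  unfold normDev at this
  gcongr
  linarith

/-- A single row contributes at most `1/1000` to the corner and to the block, and at most `μ / 1000`
to the side, so closeness to rank one survives its removal with slightly larger constants. The side
needs its own hypothesis `hRμ`, since there the bound must scale with `μ`. -/
lemma IsRegularSample.isNearRankOne_erase (h : IsRegularSample ρ T μ k 𝒩 σ x)
    (hnear : IsNearRankOne (12 / 1000) (μ / 1000)
      (cornerPart (1 - 3 * ρ) (3 * ρ) (rowWeight ρ σ x) (plantedEntry ρ σ) Finset.univ)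
      (sidePart (1 - 3 * ρ) (rowWeight ρ σ x) (plantedEntry ρ σ) (gaussianRow x) Finset.univ)
      (blockPart (1 - 3 * ρ) (3 * ρ) (rowWeight ρ σ x) (gaussianRow x) Finset.univ))
    (hN : 0 < N) (hρ : 0 < ρ) (hκ : 1 - 3 * ρ ≠ 0)
    (hσ : ∀ i, σ i = -1 ∨ σ i = 0 ∨ σ i = 1) {n : ℝ}
    (hd : (Module.finrank ℝ E : ℝ) ≤ n) (hT : 0 ≤ T)
    (hR : (1 + ρ * T) * (1 / (N * ρ) + (n + T) / N) ≤ |1 - 3 * ρ| / 1000)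
    (hRμ : (1 + ρ * T) * (1 / √(N * ρ) * √((n + T) / N)) ≤ |1 - 3 * ρ| / 1000 * μ)
    (i : Fin N) :
    |plantedEntry ρ σ i| ≤ √(1 / (N * ρ) + (n + T) / N) ∧
    ‖gaussianRow x i‖ ≤ √(1 / (N * ρ) + (n + T) / N) ∧
    |(1 - 3 * ρ)⁻¹ * rowWeight ρ σ x i| * √(1 / (N * ρ) + (n + T) / N) ^ 2 ≤ 1 / 1000 ∧
    IsNearRankOne (13 / 1000) (μ / 500)
      (cornerPart (1 - 3 * ρ) (3 * ρ) (rowWeight ρ σ x) (plantedEntry ρ σ) (Finset.univ.erase i))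
      (sidePart (1 - 3 * ρ) (rowWeight ρ σ x) (plantedEntry ρ σ) (gaussianRow x)
        (Finset.univ.erase i))
      (blockPart (1 - 3 * ρ) (3 * ρ) (rowWeight ρ σ x) (gaussianRow x)
        (Finset.univ.erase i)) := by
  have hN' : (0 : ℝ) < N := by exact_mod_cast hN
  have hNρ : 0 < (N : ℝ) * ρ := by positivity
  have hκ' : 0 < |1 - 3 * ρ| := abs_pos.2 hκ
  have hn0 : 0 ≤ n := le_trans (Nat.cast_nonneg _) hd
  have hw := plantedEntry_le hN hρ hσ i
  have hg := h.norm_gaussianRow_le hd hN i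
  have hb := h.rowWeight_le hρ hσ i
  have hcE := cornerPart_erase (κ := 1 - 3 * ρ) (c := 3 * ρ) (b := rowWeight ρ σ x)
    (w := plantedEntry ρ σ) (Finset.mem_univ i)
  have hsE := sidePart_erase (κ := 1 - 3 * ρ) (b := rowWeight ρ σ x)
    (w := plantedEntry ρ σ) (g := gaussianRow x) (Finset.mem_univ i)
  have hbE := blockPart_erase (κ := 1 - 3 * ρ) (c := 3 * ρ) (b := rowWeight ρ σ x)
    (g := gaussianRow x) (Finset.mem_univ i)
  set κ := 1 - 3 * ρ with hκdef
  set b := κ⁻¹ * rowWeight ρ σ x i with hbdef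
  set R := √(1 / (N * ρ) + (n + T) / N) with hRdef
  have hR2 : R ^ 2 = 1 / (N * ρ) + (n + T) / N := Real.sq_sqrt (by positivity)
  have hwR : |plantedEntry ρ σ i| ≤ R := by
    refine hw.trans ?_
    rw [← Real.sqrt_one, ← Real.sqrt_div zero_le_one]
    exact Real.sqrt_le_sqrt (by
      have : 0 ≤ (n + T) / N := by positivity
      linarith)
  have hgR : ‖gaussianRow x i‖ ≤ R := hg.trans (Real.sqrt_le_sqrt (by
      have : 0 ≤ 1 / (N * ρ) := by positivity
      linarith))
  have hR0 : 0 ≤ R := Real.sqrt_nonneg _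
  have hbabs : |b| = |κ|⁻¹ * |rowWeight ρ σ x i| := by rw [hbdef, abs_mul, abs_inv]
  have hbR : |b| * R ^ 2 ≤ 1 / 1000 := by
    rw [hbabs, mul_assoc, inv_mul_le_iff₀ hκ', hR2]
    refine le_trans (mul_le_mul_of_nonneg_right hb (by positivity)) ?_
    linarith
  have hbμ : |b| * (|plantedEntry ρ σ i| * ‖gaussianRow x i‖) ≤ μ / 1000 := by
    rw [hbabs, mul_assoc, inv_mul_le_iff₀ hκ']
    have h1 : |plantedEntry ρ σ i| * ‖gaussianRow x i‖ ≤ 1 / √(N * ρ) * √((n + T) / N) :=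
      mul_le_mul hw hg (norm_nonneg _) (by positivity)
    have := mul_le_mul hb h1 (by positivity) (by positivity)
    linarith
  refine ⟨hwR, hgR, hbR, ?_, ?_, ?_⟩
  · have h1 := hnear.corner
    rw [hcE] at h1
    have h2 : |b * plantedEntry ρ σ i ^ 2| ≤ 1 / 1000 := by
      rw [abs_mul, abs_pow]
      refine le_trans ?_ hbR
      gcongr
    rw [abs_le] at h1 h2 ⊢
    constructor <;> linarith [h1.1, h1.2, h2.1, h2.2]
  · have h1 := hnear.side
    rw [eq_sub_of_add_eq hsE.symm]
    refine (norm_sub_le _ _).trans ?_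
    rw [norm_smul, norm_mul, Real.norm_eq_abs, Real.norm_eq_abs]
    linarith
  · refine ContinuousLinearMap.opNorm_le_bound _ (by norm_num) fun z => ?_
    rw [eq_sub_of_add_eq (hbE z).symm]
    refine (norm_sub_le _ _).trans ?_
    rw [norm_smul, norm_mul, Real.norm_eq_abs, Real.norm_eq_abs]
    have h1 := ContinuousLinearMap.le_of_opNorm_le _ hnear.block z
    have h2 : |inner ℝ (gaussianRow x i) z| ≤ R * ‖z‖ :=
      (abs_real_inner_le_norm _ _).trans (by gcongr)
    have h3 : |b| * |inner ℝ (gaussianRow x i) z| * ‖gaussianRow x i‖ ≤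
        |b| * (R * ‖z‖) * R := by gcongr
    have h4 := mul_le_mul_of_nonneg_right hbR (norm_nonneg z)
    linarith

/-- The entrywise bound behind exact recovery. In units of `1 / √(N ρ)` the three error terms are at
most `2/50` (Gaussian inner product), `6/1000` (reinstated row) and `1/50` (iteration error), which
sum to less than `1/10`. -/
lemma IsRegularSample.abs_inner_fixedPoint_le (h : IsRegularSample ρ T μ k 𝒩 σ x)
    (hnear : IsNearRankOne (12 / 1000) (μ / 1000)
      (cornerPart (1 - 3 * ρ) (3 * ρ) (rowWeight ρ σ x) (plantedEntry ρ σ) Finset.univ)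
      (sidePart (1 - 3 * ρ) (rowWeight ρ σ x) (plantedEntry ρ σ) (gaussianRow x) Finset.univ)
      (blockPart (1 - 3 * ρ) (3 * ρ) (rowWeight ρ σ x) (gaussianRow x) Finset.univ))
    (hN : 0 < N) (hρ : 0 < ρ) (hρ1 : ρ ≤ 1) (hκ : 1 - 3 * ρ ≠ 0)
    (hσ : ∀ i, σ i = -1 ∨ σ i = 0 ∨ σ i = 1) {n : ℝ}
    (hd : (Module.finrank ℝ E : ℝ) ≤ n) (hT : 0 ≤ T) (hμ1 : μ ≤ 1)
    (hR : (1 + ρ * T) * (1 / (N * ρ) + (n + T) / N) ≤ |1 - 3 * ρ| / 1000)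
    (hRμ : (1 + ρ * T) * (1 / √(N * ρ) * √((n + T) / N)) ≤ |1 - 3 * ρ| / 1000 * μ)
    (hk : (1 / 2) ^ k ≤ 1 / 100 / √(N : ℝ)) {ζ : E} (hζ : ‖ζ‖ ≤ 1)
    (hfix : ratioMap
      (cornerPart (1 - 3 * ρ) (3 * ρ) (rowWeight ρ σ x) (plantedEntry ρ σ) Finset.univ)
      (sidePart (1 - 3 * ρ) (rowWeight ρ σ x) (plantedEntry ρ σ) (gaussianRow x) Finset.univ)
      (blockPart (1 - 3 * ρ) (3 * ρ) (rowWeight ρ σ x) (gaussianRow x) Finset.univ) ζ = ζ)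
    (i : Fin N) : |inner ℝ (gaussianRow x i) ζ| ≤ 1 / 10 / √(N * ρ) := by
  have hN' : (0 : ℝ) < N := by exact_mod_cast hN
  have hn0 : 0 ≤ n := le_trans (Nat.cast_nonneg _) hd
  obtain ⟨hwR, hgR, hbR, hnear0⟩ := h.isNearRankOne_erase hnear hN hρ hκ hσ hd hT hR hRμ i
  have key := hnear0.abs_inner_fixedPoint_le hnear (by norm_num) (by linarith) (by norm_num)
    (by linarith) hwR hgR (by linarith) (cornerPart_erase (Finset.mem_univ i))
    (sidePart_erase (Finset.mem_univ i)) (blockPart_erase (Finset.mem_univ i)) hζ hfix k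
  have hz := hnear0.norm_iterate_le (by norm_num) (by linarith) k
  have h1 := h.leaveOneOut i (hz.trans (by linarith))
  change _ ≤ 2 * |inner ℝ (gaussianRow x i) (PlantedVector.leaveOneOut ρ k σ i x)| + _ + _ at key
  have hw := plantedEntry_le hN hρ hσ i
  generalize PlantedVector.leaveOneOut ρ k σ i x = z at key h1
  generalize |(1 - 3 * ρ)⁻¹ * rowWeight ρ σ x i| = b at key hbR
  have hR2 : √(1 / (N * ρ) + (n + T) / N) ^ 2 = 1 / (N * ρ) + (n + T) / N :=
    Real.sq_sqrt (by positivity)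
  have hR0 := Real.sqrt_nonneg (1 / (N * ρ) + (n + T) / N)
  generalize √(1 / (N * ρ) + (n + T) / N) = R at *
  have hsN : √((N : ℝ) * ρ) = √(N : ℝ) * √ρ := Real.sqrt_mul hN'.le _
  have hs1 : 0 < √(N : ℝ) := Real.sqrt_pos.2 hN'
  have hs2 : 0 < √ρ := Real.sqrt_pos.2 hρ
  have h2 : |inner ℝ (gaussianRow x i) z| ≤ 1 / 50 * (1 / √(N * ρ)) := by
    rw [gaussianRow, inner_smul_left, conj_trivial, abs_mul, abs_of_pos (inv_pos.2 hs1),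
      inv_mul_le_iff₀ hs1]
    refine h1.trans (le_of_eq ?_)
    rw [hsN]; field_simp
  have h3 : 6 * (b * R ^ 2) * |plantedEntry ρ σ i| ≤ 6 * (1 / 1000) * (1 / √(N * ρ)) := by
    gcongr
  have hR1 : R ≤ 1 := by
    have hκ2 : |1 - 3 * ρ| ≤ 2 := by rw [abs_le]; constructor <;> linarith
    have h5 : 0 ≤ R ^ 2 * (ρ * T) := by positivity
    have : R ^ 2 ≤ 1 := by
      rw [← hR2] at hR
      linarith
    nlinarith
  have h4 : 2 * R * (1 / 2) ^ k ≤ 1 / 50 * (1 / √(N * ρ)) := by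
    have h5 : 1 / 100 / √(N : ℝ) ≤ 1 / 100 * (1 / √(N * ρ)) := by
      rw [hsN, div_eq_mul_one_div]
      have : √(N : ℝ) * √ρ ≤ √(N : ℝ) := mul_le_of_le_one_right hs1.le (Real.sqrt_le_one.2 hρ1)
      gcongr
    have h6 : 2 * R * (1 / 2) ^ k ≤ 2 * 1 * (1 / 100 / √(N : ℝ)) := by gcongr
    linarith
  have h7 : 1 / 10 / √(N * ρ) = 1 / 10 * (1 / √(N * ρ)) := by ring
  have h8 : 0 ≤ 1 / √(N * ρ) := by positivity
  rw [h7]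
  linarith

end Regular

/-! ### From the fixed point to exact recovery by thresholding. -/

section Recovery

variable {N n : ℕ} [NeZero n]

/-- In units of `1 / a`, a nonzero entry has size at least `0.9 * 0.9` and a zero entry at most
`0.1`; the threshold `0.5` separates them. -/
lemma sign_mul_div_threshold {a s u h : ℝ} (ha : 0 < a) (hs : s = -1 ∨ s = 0 ∨ s = 1)
    (hu : 9 / 10 ≤ u) (hu1 : u ≤ 1) (hh : |h| ≤ 1 / 10 / a) :
    Real.sign (u * (s / a + h)) / a * (if 0.5 / a ≤ |u * (s / a + h)| then 1 else 0) = s / a := by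
  have e1 : 1 / 10 / a = 1 / 10 * (1 / a) := by ring
  have e2 : (0.5 : ℝ) / a = 1 / 2 * (1 / a) := by ring
  have hp : 0 < 1 / a := by positivity
  rw [e1, abs_le] at hh
  rw [e2]
  rcases hs with rfl | rfl | rfl
  · have e3 : (-1 : ℝ) / a = -(1 / a) := by ring
    have h1 : u * (-1 / a + h) ≤ -(1 / 2 * (1 / a)) := by rw [e3]; nlinarith [hh.2]
    rw [if_pos (by rw [abs_of_neg (by linarith)]; linarith), Real.sign_of_neg (by linarith)]
    ring
  · rw [zero_div, zero_add, if_neg, mul_zero]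
    rw [not_le, abs_lt]; constructor <;> nlinarith [hh.1, hh.2]
  · have h1 : 1 / 2 * (1 / a) ≤ u * (1 / a + h) := by nlinarith [hh.1]
    rw [if_pos (by rw [abs_of_pos (by linarith)]; linarith), Real.sign_of_pos (by linarith)]
    ring

/-- The part of a vector that is orthogonal to the first coordinate direction. -/
def tailPart (u : Fin n → ℝ) : EuclideanSpace ℝ {j : Fin n // j ≠ 0} :=
  WithLp.toLp 2 fun j => u j

lemma dotProduct_eq_add_inner_tailPart (u w : Fin n → ℝ) :
    u ⬝ᵥ w = u 0 * w 0 + inner ℝ (tailPart u) (tailPart w) := by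
  have h1 : u ⬝ᵥ w = ∑ j, u j * w j := rfl
  rw [h1, ← Finset.add_sum_erase _ _ (Finset.mem_univ (0 : Fin n))]
  congr 1
  simp only [tailPart, PiLp.inner_apply]
  rw [← Finset.sum_subtype (p := fun j : Fin n => j ≠ 0) (Finset.univ.erase 0) (by simp)
    (fun j => u j * w j) |>.symm]
  refine Finset.sum_congr rfl fun j _ => ?_
  simp [mul_comm]

lemma finrank_tail (n : ℕ) [NeZero n] :
    (Module.finrank ℝ (EuclideanSpace ℝ {j : Fin n // j ≠ 0}) : ℝ) = (n : ℝ) - 1 := by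
  rw [finrank_euclideanSpace, Fintype.card_subtype_compl]
  simp only [Fintype.card_fin, Fintype.card_unique]
  rw [Nat.cast_sub NeZero.one_le, Nat.cast_one]

variable {ρ T μ : ℝ} {k : ℕ} {σ : Fin N → ℝ}
  {x : Fin N → EuclideanSpace ℝ {j : Fin n // j ≠ 0}}

/-- Multiplication by `N ρ` turns the weight of row `i` into `rowWeight` and the shift `3 / N` into
`3 ρ`. The dimension of the tail space is `n - 1`, which matches the centring `(n - 1) / N`. -/
lemma mul_spectralMatrix_mulVec (hN : 0 < N) (hρ : 0 < ρ) {Y : Matrix (Fin N) (Fin n) ℝ}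
    (hY0 : ∀ i, Y i 0 = plantedEntry ρ σ i) (hY : ∀ i, tailPart (Y i) = gaussianRow x i)
    (u : Fin n → ℝ) (j : Fin n) :
    N * ρ * (spectralMatrix Y *ᵥ u) j =
      ∑ i, rowWeight ρ σ x i * (plantedEntry ρ σ i * u 0 +
        inner ℝ (gaussianRow x i) (tailPart u)) * Y i j - 3 * ρ * u j := by
  have hN' : (0 : ℝ) < N := by exact_mod_cast hN
  have hNρ : 0 < (N : ℝ) * ρ := by positivity
  have hwt : ∀ i, N * ρ * (Y i ⬝ᵥ Y i - ((n : ℝ) - 1) / N) = rowWeight ρ σ x i := by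
    intro i
    rw [dotProduct_eq_add_inner_tailPart, hY0, hY, real_inner_self_eq_norm_sq, rowWeight, normDev,
      finrank_tail, gaussianRow, norm_smul, mul_pow, norm_inv, inv_pow,
      Real.norm_of_nonneg (Real.sqrt_nonneg _), Real.sq_sqrt hN'.le, plantedEntry,
      div_mul_div_comm, Real.mul_self_sqrt hNρ.le]
    field_simp
    ring
  rw [spectralMatrix, Matrix.sub_mulVec, Matrix.sum_mulVec, Pi.sub_apply, Finset.sum_apply,
    mul_sub, Finset.mul_sum]
  congr 1
  · refine Finset.sum_congr rfl fun i _ => ?_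
    rw [Matrix.smul_mulVec, Pi.smul_apply, smul_eq_mul, ← mul_assoc, hwt,
      Matrix.vecMulVec_mulVec, Pi.smul_apply, dotProduct_eq_add_inner_tailPart (Y i) u, hY0, hY]
    simp only [MulOpposite.smul_eq_mul_unop, MulOpposite.unop_op]
    ring
  · rw [Matrix.smul_mulVec, Matrix.one_mulVec, Pi.smul_apply, smul_eq_mul]
    field_simp

lemma IsRegularSample.signThreshold_eq {𝒩 : Finset (EuclideanSpace ℝ {j : Fin n // j ≠ 0})}
    (h : IsRegularSample ρ T μ k 𝒩 σ x)
    (hnet : ∀ x : EuclideanSpace ℝ {j : Fin n // j ≠ 0}, ‖x‖ ≤ 1 → ∃ q ∈ 𝒩, ‖x - q‖ ≤ 1 / 2)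
    (hnorm : ∀ q ∈ 𝒩, ‖q‖ ≤ 1)
    (hN : 0 < N) (hρ : 0 < ρ) (hρ1 : ρ ≤ 1) (hκ : 1 - 3 * ρ ≠ 0)
    (hσ : ∀ i, σ i = -1 ∨ σ i = 0 ∨ σ i = 1)
    (hm : |∑ i, σ i ^ 2 - N * ρ| ≤ |1 - 3 * ρ| / 1000 * (N * ρ))
    (hT : 0 ≤ T) (hμ1 : μ ≤ 1)
    (hR : (1 + ρ * T) * (1 / (N * ρ) + (n + T) / N) ≤ |1 - 3 * ρ| / 1000)
    (hRμ : (1 + ρ * T) * (1 / √(N * ρ) * √((n + T) / N)) ≤ |1 - 3 * ρ| / 1000 * μ)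
    (hk : (1 / 2) ^ k ≤ 1 / 100 / √(N : ℝ)) {Y : Matrix (Fin N) (Fin n) ℝ}
    (hY0 : ∀ i, Y i 0 = plantedEntry ρ σ i) (hY : ∀ i, tailPart (Y i) = gaussianRow x i)
    {u : Fin n → ℝ} (hu : IsLeadingEigenvector (spectralMatrix Y) u) :
    signThreshold ρ (Y *ᵥ u) = plantedEntry ρ σ ∨
      signThreshold ρ (Y *ᵥ (-u)) = plantedEntry ρ σ := by
  have hN' : (0 : ℝ) < N := by exact_mod_cast hN
  have hNρ : 0 < (N : ℝ) * ρ := by positivity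
  have hnear := h.isNearRankOne hnet hnorm hN hρ hρ1 hκ hσ hm
  have hd : (Module.finrank ℝ (EuclideanSpace ℝ {j : Fin n // j ≠ 0}) : ℝ) ≤ n := by
    rw [finrank_tail]; linarith
  obtain ⟨hu1, l, hl, hmax⟩ := hu
  have hdiag := IsLeadingEigenvector.abs_diag_le (isHermitian_spectralMatrix Y) hmax 0
  have hfixall := fun ζ => h.abs_inner_fixedPoint_le hnear hN hρ hρ1 hκ hσ hd hT hμ1 hR hRμ hk
    (ζ := ζ)
  set α := cornerPart (1 - 3 * ρ) (3 * ρ) (rowWeight ρ σ x) (plantedEntry ρ σ) Finset.univ with hα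
  set β := sidePart (1 - 3 * ρ) (rowWeight ρ σ x) (plantedEntry ρ σ) (gaussianRow x) Finset.univ
    with hβ
  set D := blockPart (1 - 3 * ρ) (3 * ρ) (rowWeight ρ σ x) (gaussianRow x) Finset.univ with hD
  set κ := 1 - 3 * ρ with hκdef
  have h00 : spectralMatrix Y 0 0 = κ / (N * ρ) * α := by
    have h1 := mul_spectralMatrix_mulVec hN hρ hY0 hY (Pi.single 0 1) 0
    have h2 : tailPart (Pi.single (0 : Fin n) (1 : ℝ)) = 0 := by
      ext j; simp [tailPart, j.2]
    rw [Matrix.mulVec_single_one, Matrix.col_apply, h2] at h1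
    simp only [inner_zero_right, Pi.single_eq_same, mul_one, add_zero, hY0] at h1
    have h3 : ∑ i, rowWeight ρ σ x i * plantedEntry ρ σ i * plantedEntry ρ σ i =
        ∑ i, rowWeight ρ σ x i * plantedEntry ρ σ i ^ 2 :=
      Finset.sum_congr rfl fun i _ => by ring
    rw [hα, cornerPart, ← h3, ← h1]
    field_simp
  have hrow : ∀ j, N * ρ * (l * u j) =
      ∑ i, rowWeight ρ σ x i * (plantedEntry ρ σ i * u 0 +
        inner ℝ (gaussianRow x i) (tailPart u)) * Y i j - 3 * ρ * u j := by
    intro j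
    rw [← mul_spectralMatrix_mulVec hN hρ hY0 hY u j, hl]; rfl
  -- The eigenvalue in the normalization where the corner is close to `1`. The factor may be
  -- negative when `ρ > 1/3`, so only its absolute value is compared with the corner.
  set l' := N * ρ / κ * l with hl'
  have hl9 : 9 / 10 ≤ |l'| := by
    have h1 : |α| ≤ |l'| := by
      have : α = N * ρ / κ * spectralMatrix Y 0 0 := by rw [h00]; field_simp
      rw [this, hl', abs_mul, abs_mul]
      gcongr
    have h2 := abs_le.1 hnear.corner
    have h3 := le_abs_self α
    linarith [h2.1]
  have heq0 : l' * u 0 = α * u 0 + inner ℝ β (tailPart u) := by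
    have h1 := hrow 0
    simp only [hY0] at h1
    rw [hα, hβ, cornerPart, sidePart, inner_smul_left, sum_inner, conj_trivial]
    simp only [inner_smul_left, conj_trivial]
    have h2 : l' * u 0 = κ⁻¹ * (N * ρ * (l * u 0)) := by rw [hl']; field_simp
    have h3 : ∑ i, rowWeight ρ σ x i * (plantedEntry ρ σ i * u 0 +
        inner ℝ (gaussianRow x i) (tailPart u)) * plantedEntry ρ σ i =
        (∑ i, rowWeight ρ σ x i * plantedEntry ρ σ i ^ 2) * u 0 +
        ∑ i, rowWeight ρ σ x i * plantedEntry ρ σ i * inner ℝ (gaussianRow x i) (tailPart u) := by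
      rw [Finset.sum_mul, ← Finset.sum_add_distrib]
      exact Finset.sum_congr rfl fun i _ => by ring
    rw [h2, h1, h3]
    ring
  have heq1 : l' • tailPart u = u 0 • β + D (tailPart u) := by
    have h2 : l' • tailPart u = κ⁻¹ • ((N * ρ * l) • tailPart u) := by
      rw [smul_smul, hl']; congr 1; field_simp
    rw [h2, hβ, hD, sidePart, blockPart_apply, smul_comm (u 0), ← smul_add]
    congr 1
    ext j
    have h1 := hrow j
    have hg : ∀ i, gaussianRow x i j = Y i j := fun i => by rw [← hY i]; rfl
    have ht : tailPart u j = u j := rfl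
    simp only [PiLp.smul_apply, PiLp.add_apply, PiLp.sub_apply, WithLp.ofLp_sum, Finset.sum_apply,
      WithLp.ofLp_smul, Pi.smul_apply, smul_eq_mul, hg, ht]
    rw [mul_assoc, mul_assoc, ← mul_assoc (N : ℝ), h1, Finset.mul_sum, ← add_sub_assoc,
      ← Finset.sum_add_distrib]
    congr 1
    exact Finset.sum_congr rfl fun i _ => by ring
  have hne : u 0 ≠ 0 ∨ tailPart u ≠ 0 := by
    by_contra! hcon
    rw [dotProduct_eq_add_inner_tailPart, hcon.1, hcon.2] at hu1
    simp at hu1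
  obtain ⟨hu0, hζ, hfix⟩ := hnear.eigenvector_ratio (by norm_num) (by linarith) hl9 hne heq0 heq1
  have hg := hfixall _ (hζ.trans (by linarith)) hfix
  set ζ := (u 0)⁻¹ • tailPart u with hζdef
  have htail : tailPart u = u 0 • ζ := by rw [hζdef, smul_inv_smul₀ hu0]
  have hsq : u 0 ^ 2 * (1 + ‖ζ‖ ^ 2) = 1 := by
    rw [dotProduct_eq_add_inner_tailPart, htail, inner_smul_left, inner_smul_right,
      real_inner_self_eq_norm_sq, conj_trivial] at hu1
    linarith
  have hζ2 : ‖ζ‖ ≤ 2 / 1000 := by linarith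
  have habs1 : |u 0| ≤ 1 := by
    rw [← sq_le_one_iff_abs_le_one]; nlinarith [sq_nonneg (u 0), sq_nonneg ‖ζ‖]
  have habs9 : 9 / 10 ≤ |u 0| := by
    have h1 : ‖ζ‖ ^ 2 ≤ (2 / 1000) ^ 2 := by gcongr
    have h2 : (9 / 10) ^ 2 ≤ |u 0| ^ 2 := by rw [sq_abs]; nlinarith [sq_nonneg (u 0)]
    exact (pow_le_pow_iff_left₀ (by norm_num) (abs_nonneg _) two_ne_zero).1 h2
  have hYu : ∀ i, (Y *ᵥ u) i = u 0 * (σ i / √(N * ρ) + inner ℝ (gaussianRow x i) ζ) := by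
    intro i
    have : (Y *ᵥ u) i = Y i ⬝ᵥ u := rfl
    rw [this, dotProduct_eq_add_inner_tailPart, hY, hY0, htail, inner_smul_right, plantedEntry]
    ring
  rcases lt_or_gt_of_ne hu0 with hneg | hpos
  · right
    funext i
    rw [signThreshold, Matrix.mulVec_neg, Pi.neg_apply, hYu, ← neg_mul]
    rw [abs_of_neg hneg] at habs1 habs9
    exact sign_mul_div_threshold (Real.sqrt_pos.2 hNρ) (hσ i) habs9 habs1 (hg i)
  · left
    funext i
    rw [signThreshold, hYu]
    rw [abs_of_pos hpos] at habs1 habs9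
    exact sign_mul_div_threshold (Real.sqrt_pos.2 hNρ) (hσ i) habs9 habs1 (hg i)

end Recovery

/-! ### A Gaussian sample is regular with high probability. -/

section RegularProbability

/-- The parameter inequalities under which a Gaussian sample is regular with high probability. -/
structure ParameterBounds (N : ℕ) (n ρ L T η : ℝ) : Prop where
  one_le_n : 1 ≤ n
  one_le_L : 1 ≤ L
  T_eq : T = 32 * (√n * L)
  eta_pos : 0 < η
  corner_step : 40 * L ≤ η * N
  corner_var : 80 * (L * n * ρ) ≤ η ^ 2 * N
  side_bounded : 80 * ((n + L) * (1 + ρ * T) ^ 2) ≤ η ^ 2 * N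
  side_step : 320 * ((n + L) * √L * (1 + ρ * T)) ≤ η * N
  side_var : 6553600 * ((n + L) * L * ρ * (1 + ρ ^ 2 * n)) ≤ η ^ 2 * N
  block_bias : 1280 * (ρ * √n * Real.exp (-(2 * L))) ≤ η
  block_var : 13107200 * ((n + L) * (2 * ρ + ρ ^ 2 * n)) ≤ η ^ 2 * N

lemma leaveOneOut_update {E : Type*} [NormedAddCommGroup E] [InnerProductSpace ℝ E] {N : ℕ}
    {ρ : ℝ} {k : ℕ} {σ : Fin N → ℝ} (i : Fin N) (x : Fin N → E) (y : E) :
    leaveOneOut ρ k σ i (Function.update x i y) = leaveOneOut ρ k σ i x := by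
  refine rowIterate_congr (fun j hj => ?_) (fun j _ => rfl) (fun j hj => ?_) k
  · rw [rowWeight, rowWeight, Function.update_of_ne (Finset.ne_of_mem_erase hj)]
  · rw [gaussianRow, gaussianRow, Function.update_of_ne (Finset.ne_of_mem_erase hj)]

variable {E : Type*} [NormedAddCommGroup E] [InnerProductSpace ℝ E]
  [MeasurableSpace E] [BorelSpace E] [FiniteDimensional ℝ E] {N : ℕ} {n ρ L T μ η : ℝ} {k : ℕ}
  {σ : Fin N → ℝ} {𝒩 : Finset E}

lemma ParameterBounds.corner_prob (hp : ParameterBounds N n ρ L T η)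
    (hd : (Module.finrank ℝ E : ℝ) ≤ n) (hN : 0 < N)
    (hσ : ∀ i, |σ i| ≤ 1) (hm : ∑ i, σ i ^ 2 ≤ 2 * (N * ρ)) :
    (Measure.pi fun _ : Fin N => stdGaussian E).real
      {x | η * N ≤ |∑ i, σ i ^ 2 * normDev (x i)|} ≤ 2 * Real.exp (-(5 * L)) := by
  have hN' : (0 : ℝ) < N := by exact_mod_cast hN
  have hη := hp.eta_pos
  have hL := hp.one_le_L
  have hn := hp.one_le_n
  have hηN : 0 < η * N := by positivity
  set s := 10 * L / (η * N) with hs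
  have hst : s * (η * N) = 10 * L := by rw [hs]; field_simp
  have hs0 : 0 < s := by positivity
  have hs4 : s ≤ 1 / 4 := by rw [hs, div_le_iff₀ hηN]; linarith [hp.corner_step]
  refine (pi_real_normDev_ge_le (t := η * N) hσ hs0 hs4).trans ?_
  have h1 : 2 * s ^ 2 * Module.finrank ℝ E * ∑ i, σ i ^ 2 ≤ 5 * L := by
    calc 2 * s ^ 2 * Module.finrank ℝ E * ∑ i, σ i ^ 2
        ≤ 2 * s ^ 2 * n * (2 * (N * ρ)) := by gcongr
      _ = s * (4 * 10 * L * n * ρ / η) := by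
        rw [sq, mul_comm 2 (s * s), mul_assoc s s]; conv_lhs => enter [1, 1, 2, 1]; rw [hs]
        field_simp; ring
      _ ≤ s * (1 / 2 * (η * N)) := by
        gcongr
        rw [div_le_iff₀ hη]
        linarith [hp.corner_var]
      _ = 5 * L := by linarith
  have : Real.exp (2 * s ^ 2 * Module.finrank ℝ E * ∑ i, σ i ^ 2 - s * (η * N)) ≤
      Real.exp (-(5 * L)) := by rw [Real.exp_le_exp]; linarith
  linarith

/-- The two scales need different tail bounds. For `μ = 1` the optimal `s` has order `η / √ρ` up to
the squared weight bound and may be large when `ρ` is small, so the bound valid for all `s` is used.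
For `μ = 1 / √(ρ L)` the target is smaller by `√(ρ L)` and the sharper variance `1 + ρ ^ 2 n` is
used. In both cases `s t ≥ 10 (n + L)`, of which at most half is lost to the variance. -/
lemma ParameterBounds.side_prob (hp : ParameterBounds N n ρ L T η)
    (hd : (Module.finrank ℝ E : ℝ) ≤ n) (hN : 0 < N) (hρ : 0 < ρ)
    (hσ : ∀ i, |σ i| ≤ 1) (hm : ∑ i, σ i ^ 2 ≤ 2 * (N * ρ))
    (hμ : μ = 1 ∨ μ = 1 / √(ρ * L)) {q : E} (hq : ‖q‖ ≤ 1) :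
    (Measure.pi fun _ : Fin N => stdGaussian E).real
      {x | η / 2 * μ * (N * √ρ) ≤ |∑ i, σ i * (1 + ρ * truncDev T (x i)) * inner ℝ q (x i)|} ≤
      2 * Real.exp (-(5 * (n + L))) := by
  have hN' : (0 : ℝ) < N := by exact_mod_cast hN
  have hη := hp.eta_pos
  have hL := hp.one_le_L
  have hn := hp.one_le_n
  have hT : 0 ≤ T := by rw [hp.T_eq]; positivity
  have hB : 0 < 1 + ρ * T := by positivity
  have hρs : √ρ * √ρ = ρ := Real.mul_self_sqrt hρ.le
  have hρ0 : 0 < √ρ := Real.sqrt_pos.2 hρ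
  rcases hμ with rfl | rfl
  · set t := η / 2 * 1 * (N * √ρ) with ht
    set s := t / (2 * (1 + ρ * T) ^ 2 * (N * ρ)) with hs
    have ht0 : 0 < t := by positivity
    have hs0 : 0 < s := by positivity
    refine (pi_real_linear_ge_le_of_bounded (t := t) hq hT hρ.le hs0).trans ?_
    have h1 : s ^ 2 * (1 + ρ * T) ^ 2 / 2 * ∑ i, σ i ^ 2 ≤
        s ^ 2 * (1 + ρ * T) ^ 2 / 2 * (2 * (N * ρ)) := by gcongr
    have h2 : s * (2 * (1 + ρ * T) ^ 2 * (N * ρ)) = t := by rw [hs]; field_simp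
    have h3 : s ^ 2 * (1 + ρ * T) ^ 2 / 2 * (2 * (N * ρ)) = s * t / 2 := by
      rw [← h2]; ring
    have h4 : 10 * (n + L) ≤ s * t := by
      rw [hs, div_mul_eq_mul_div, le_div_iff₀ (by positivity)]
      have h5 : t * t = η ^ 2 * N * (N * ρ) / 4 := by
        rw [ht]; linear_combination (η ^ 2 * N ^ 2 / 4) * hρs
      rw [h5]
      have := mul_le_mul_of_nonneg_right hp.side_bounded (by positivity : 0 ≤ (N : ℝ) * ρ)
      linarith
    have : Real.exp (s ^ 2 * (1 + ρ * T) ^ 2 / 2 * ∑ i, σ i ^ 2 - s * t) ≤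
        Real.exp (-(5 * (n + L))) := by rw [Real.exp_le_exp]; linarith
    linarith
  · have hLs : √L * √L = L := Real.mul_self_sqrt (by linarith)
    have hL0 : 0 < √L := Real.sqrt_pos.2 (by linarith)
    have ht : η / 2 * (1 / √(ρ * L)) * (N * √ρ) = η * N / (2 * √L) := by
      rw [Real.sqrt_mul hρ.le]; field_simp
    rw [ht]
    set t := η * N / (2 * √L) with htdef
    set s := 20 * (n + L) * √L / (η * N) with hs
    have hs0 : 0 < s := by positivity
    have hst : s * t = 10 * (n + L) := by rw [hs, htdef]; field_simp; ring
    have hsT : s * (1 + ρ * T) ≤ 1 / 16 := by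
      rw [hs, div_mul_eq_mul_div, div_le_iff₀ (by positivity)]
      linarith [hp.side_step]
    refine (pi_real_linear_ge_le (t := t) hn hd hq hT hρ.le hσ hs0 hsT).trans ?_
    have h1 : 40960 * s ^ 2 * (1 + ρ ^ 2 * n) * ∑ i, σ i ^ 2 ≤
        40960 * s ^ 2 * (1 + ρ ^ 2 * n) * (2 * (N * ρ)) := by gcongr
    have h2 : 40960 * s * (1 + ρ ^ 2 * n) * (2 * (N * ρ)) ≤ t / 2 := by
      have e : 40960 * s * (1 + ρ ^ 2 * n) * (2 * (N * ρ)) =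
          1638400 * ((n + L) * √L * ρ * (1 + ρ ^ 2 * n)) / η := by
        rw [hs]; field_simp; ring
      rw [e, htdef, div_le_iff₀ hη, div_div, div_mul_eq_mul_div, le_div_iff₀ (by positivity)]
      have := hp.side_var
      have e2 : 1638400 * ((n + L) * √L * ρ * (1 + ρ ^ 2 * n)) * (2 * √L * 2) =
          6553600 * ((n + L) * (√L * √L) * ρ * (1 + ρ ^ 2 * n)) := by ring
      rw [e2, hLs]
      linarith
    have h3 := mul_le_mul_of_nonneg_left h2 hs0.le
    have : Real.exp (40960 * s ^ 2 * (1 + ρ ^ 2 * n) * ∑ i, σ i ^ 2 - s * t) ≤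
        Real.exp (-(5 * (n + L))) := by rw [Real.exp_le_exp]; linarith
    linarith

lemma ParameterBounds.block_prob (hp : ParameterBounds N n ρ L T η)
    (hd : (Module.finrank ℝ E : ℝ) ≤ n) (hN : 0 < N) (hρ : 0 < ρ)
    (hσ : ∀ i, |σ i| ≤ 1) (hm : ∑ i, σ i ^ 2 ≤ 2 * (N * ρ)) {q : E} (hq : ‖q‖ ≤ 1) :
    (Measure.pi fun _ : Fin N => stdGaussian E).real
      {x | η * N ≤ |∑ i, ((σ i ^ 2 + ρ * truncDev T (x i)) * inner ℝ q (x i) ^ 2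
        - (σ i ^ 2 + 2 * ρ) * ‖q‖ ^ 2)|} ≤ 2 * Real.exp (-(5 * (n + L))) := by
  have hN' : (0 : ℝ) < N := by exact_mod_cast hN
  have hη := hp.eta_pos
  have hL := hp.one_le_L
  have hn := hp.one_le_n
  have hn0 : 0 < √n := Real.sqrt_pos.2 (by linarith)
  have hT : 0 ≤ T := by rw [hp.T_eq]; positivity
  have hB : 0 < 1 + ρ * T := by positivity
  set s := 10 * (n + L) / (η * N) with hs
  have hs0 : 0 < s := by positivity
  have hst : s * (η * N) = 10 * (n + L) := by rw [hs]; field_simp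
  have hsL : 1 ≤ √L := Real.one_le_sqrt.2 hL
  refine (pi_real_quadratic_ge_le (t := η * N) (s := s) hn hd hq hT hρ.le hσ hs0 ?_ ?_ ?_).trans ?_
  · rw [hs, div_mul_eq_mul_div, div_le_iff₀ (by positivity)]
    have h1 := hp.side_step
    have h2 : (n + L) * (1 + ρ * T) ≤ (n + L) * √L * (1 + ρ * T) := by
      have : (n + L) * 1 ≤ (n + L) * √L := by gcongr
      rw [mul_one] at this
      gcongr
    have h3 : 0 ≤ (n + L) * √L * (1 + ρ * T) := by positivity
    linarith
  · have e : T / (16 * √n) = 2 * L := by rw [hp.T_eq]; field_simp; ring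
    rw [e, Fintype.card_fin]
    have := mul_le_mul_of_nonneg_left hp.block_bias hN'.le
    linarith
  · rw [Fintype.card_fin]
    have h1 : 327680 * s * (∑ i, σ i ^ 2 + N * (ρ ^ 2 * n)) ≤
        327680 * s * (2 * (N * ρ) + N * (ρ ^ 2 * n)) := by gcongr
    have e : 327680 * s * (2 * (N * ρ) + N * (ρ ^ 2 * n)) =
        3276800 * ((n + L) * (2 * ρ + ρ ^ 2 * n)) / η := by
      rw [hs]; field_simp; ring
    refine h1.trans ?_
    rw [e, div_le_iff₀ hη]
    linarith [hp.block_var]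
  · have : Real.exp (-(s * (η * N) / 2)) = Real.exp (-(5 * (n + L))) := by
      rw [hst]; congr 1; ring
    rw [this]

lemma measurable_leaveOneOut (i : Fin N) :
    Measurable (fun x : Fin N → E => leaveOneOut ρ k σ i x) := by
  refine measurable_rowIterate (b := fun i x => rowWeight ρ σ x i)
    (w := fun i _ => plantedEntry ρ σ i) (g := fun i x => gaussianRow x i)
    (fun j => ?_) (fun j => measurable_const) (fun j => ?_) k
  · unfold rowWeight; fun_prop
  · unfold gaussianRow; fun_prop

/-- The choice `s = t / r ^ 2` gives the Gaussian exponent `t ^ 2 / (2 r ^ 2) = 12.5 / (ρ μ ^ 2)`,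
which is at least `5 L` by `hμL`. The norm bound is included in the event because it depends only on
the other rows, whereas its proof for a regular sample uses all of them. -/
lemma leaveOneOut_prob (hρ : 0 < ρ) (hμ0 : 0 < μ) (hμL : ρ * L * μ ^ 2 ≤ 1) (i : Fin N) :
    (Measure.pi fun _ : Fin N => stdGaussian E).real
      {x | ‖leaveOneOut ρ k σ i x‖ ≤ μ / 250 ∧
        1 / 50 / √ρ ≤ |inner ℝ (x i) (leaveOneOut ρ k σ i x)|} ≤ 2 * Real.exp (-(5 * L)) := by
  have hρ0 : 0 < √ρ := Real.sqrt_pos.2 hρ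
  have hρs : √ρ ^ 2 = ρ := Real.sq_sqrt hρ.le
  set s := (1 / 50 / √ρ) / (μ / 250) ^ 2 with hs
  have hs0 : 0 < s := by positivity
  refine (pi_real_inner_ge_le i (measurable_leaveOneOut i) (leaveOneOut_update i)
    (r := μ / 250) (t := 1 / 50 / √ρ) hs0).trans ?_
  have e : s ^ 2 * (μ / 250) ^ 2 / 2 - s * (1 / 50 / √ρ) = -(25 / 2 / (ρ * μ ^ 2)) := by
    rw [hs, ← hρs]; field_simp; norm_num; ring
  rw [e]
  have h1 : L ≤ 1 / (ρ * μ ^ 2) := by rw [le_div_iff₀ (by positivity)]; linarith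
  have h2 : 25 / 2 / (ρ * μ ^ 2) = 25 / 2 * (1 / (ρ * μ ^ 2)) := by ring
  have h3 : 0 < 1 / (ρ * μ ^ 2) := by positivity
  have : Real.exp (-(25 / 2 / (ρ * μ ^ 2))) ≤ Real.exp (-(5 * L)) := by
    rw [Real.exp_le_exp, h2]; linarith
  linarith

lemma ParameterBounds.measureReal_not_isRegularSample_le
    (hp : ParameterBounds N n ρ L T (|1 - 3 * ρ| / 1000))
    (hd : (Module.finrank ℝ E : ℝ) ≤ n) (hN : 0 < N) (hρ : 0 < ρ)
    (hσ : ∀ i, |σ i| ≤ 1) (hm : ∑ i, σ i ^ 2 ≤ 2 * (N * ρ))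
    (hμ : μ = 1 ∨ μ = 1 / √(ρ * L)) (hμL : ρ * L * μ ^ 2 ≤ 1)
    (hcard : 𝒩.card ≤ 5 ^ Module.finrank ℝ E) (hnorm : ∀ q ∈ 𝒩, ‖q‖ ≤ 1) :
    (Measure.pi fun _ : Fin N => stdGaussian E).real {x | ¬ IsRegularSample ρ T μ k 𝒩 σ x} ≤
      13 * N * Real.exp (-(5 * L)) := by
  have hN' : (1 : ℝ) ≤ N := by exact_mod_cast hN
  have hL := hp.one_le_L
  have hn := hp.one_le_n
  have hn0 : 0 < √n := Real.sqrt_pos.2 (by linarith)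
  have hμ0 : 0 < μ := by rcases hμ with rfl | rfl <;> positivity
  set η := |1 - 3 * ρ| / 1000 with hη
  set ν := Measure.pi fun _ : Fin N => stdGaussian E with hν
  set B1 : Set (Fin N → E) := {x | ∃ i, T < |normDev (x i)|}
  set B2 : Set (Fin N → E) := {x | η * N ≤ |∑ i, σ i ^ 2 * normDev (x i)|}
  set B3 : E → Set (Fin N → E) := fun q => {x | η / 2 * μ * (N * √ρ) ≤
    |∑ i, σ i * (1 + ρ * truncDev T (x i)) * inner ℝ q (x i)|} with hB3
  set B4 : E → Set (Fin N → E) := fun q => {x | η * N ≤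
    |∑ i, ((σ i ^ 2 + ρ * truncDev T (x i)) * inner ℝ q (x i) ^ 2
        - (σ i ^ 2 + 2 * ρ) * ‖q‖ ^ 2)|} with hB4
  set B5 : Fin N → Set (Fin N → E) := fun i => {x | ‖leaveOneOut ρ k σ i x‖ ≤ μ / 250 ∧
        1 / 50 / √ρ ≤ |inner ℝ (x i) (leaveOneOut ρ k σ i x)|} with hB5
  have hsub : {x | ¬ IsRegularSample ρ T μ k 𝒩 σ x} ⊆ B1 ∪ B2 ∪ (⋃ q ∈ 𝒩, B3 q) ∪
      (⋃ r ∈ 𝒩 ×ˢ 𝒩, B4 ((1 / 2 : ℝ) • (r.1 + r.2))) ∪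
      (⋃ r ∈ 𝒩 ×ˢ 𝒩, B4 ((1 / 2 : ℝ) • (r.1 - r.2))) ∪ (⋃ i ∈ (Finset.univ : Finset (Fin N)), B5 i) := by
    intro x hx
    by_contra hcon
    simp only [Set.mem_union, Set.mem_iUnion, not_or, not_exists, Finset.mem_product] at hcon
    obtain ⟨⟨⟨⟨⟨h1, h2⟩, h3⟩, h4⟩, h5⟩, h6⟩ := hcon
    have h1' : ∀ i, |normDev (x i)| ≤ T := by
      intro i; by_contra hc; exact h1 ⟨i, not_le.1 hc⟩
    -- Outside the first bad event no weight is truncated, so tail bounds for truncated sums apply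
    -- to the actual ones.
    have htr : ∀ i, truncDev T (x i) = normDev (x i) := fun i => by rw [truncDev, if_pos (h1' i)]
    refine hx ⟨h1', (not_le.1 h2).le, fun q hq => ?_, fun p hp q hq => ?_, fun p hp q hq => ?_,
      fun i hi => ?_⟩
    · have := h3 q hq
      simp only [hB3, Set.mem_ofPred_eq, not_le, htr] at this
      refine this.le.trans (le_of_eq ?_)
      rw [hη]; ring
    · have := h4 (p, q) ⟨hp, hq⟩
      simp only [hB4, Set.mem_ofPred_eq, not_le, htr] at this
      exact this.le
    · have := h5 (p, q) ⟨hp, hq⟩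
      simp only [hB4, Set.mem_ofPred_eq, not_le, htr] at this
      exact this.le
    · by_contra hc
      exact h6 i (Finset.mem_univ i) ⟨hi, (not_le.1 hc).le⟩
  have p1 : ν.real B1 ≤ 3 * N * Real.exp (-(5 * L)) := by
    refine (pi_real_exists_normDev_gt_le hn hd T).trans ?_
    have e : T / (4 * √n) = 8 * L := by rw [hp.T_eq]; field_simp; ring
    rw [e, Fintype.card_fin]
    have : Real.exp (-(8 * L)) ≤ Real.exp (-(5 * L)) := by rw [Real.exp_le_exp]; linarith
    have := mul_le_mul_of_nonneg_left this (by positivity : 0 ≤ 3 * (N : ℝ))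
    linarith
  have p2 : ν.real B2 ≤ 2 * Real.exp (-(5 * L)) := hp.corner_prob hd hN hσ hm
  -- Pairs of net points number at most `25 ^ dim ≤ exp (4 n)`, which the exponent `5 (n + L)`
  -- absorbs.
  have hexp : (5 : ℝ) ^ Module.finrank ℝ E * 5 ^ Module.finrank ℝ E *
      Real.exp (-(5 * (n + L))) ≤ Real.exp (-(5 * L)) := by
    have h1 : (5 : ℝ) ^ Module.finrank ℝ E ≤ Real.exp (2 * n) := by
      have h2 : (5 : ℝ) ≤ Real.exp 2 := by
        have := Real.quadratic_le_exp_of_nonneg (x := 2) (by norm_num); linarith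
      calc (5 : ℝ) ^ Module.finrank ℝ E ≤ Real.exp 2 ^ Module.finrank ℝ E := by gcongr
        _ = Real.exp (2 * Module.finrank ℝ E) := by rw [← Real.exp_nat_mul, mul_comm]
        _ ≤ _ := by rw [Real.exp_le_exp]; linarith
    calc (5 : ℝ) ^ Module.finrank ℝ E * 5 ^ Module.finrank ℝ E * Real.exp (-(5 * (n + L)))
        ≤ Real.exp (2 * n) * Real.exp (2 * n) * Real.exp (-(5 * (n + L))) := by gcongr
      _ = Real.exp (2 * n + 2 * n + -(5 * (n + L))) := by rw [Real.exp_add, Real.exp_add]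
      _ ≤ _ := by rw [Real.exp_le_exp]; linarith
  have hcardR : (𝒩.card : ℝ) ≤ 5 ^ Module.finrank ℝ E := by exact_mod_cast hcard
  have hone : (1 : ℝ) ≤ 5 ^ Module.finrank ℝ E := one_le_pow₀ (by norm_num)
  have p3 : ν.real (⋃ q ∈ 𝒩, B3 q) ≤ 2 * Real.exp (-(5 * L)) := by
    refine (measureReal_biUnion_finset_le 𝒩 B3).trans ?_
    refine (Finset.sum_le_card_nsmul 𝒩 _ _ fun q hq =>
      hp.side_prob hd hN hρ hσ hm hμ (hnorm q hq)).trans ?_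
    rw [nsmul_eq_mul]
    calc (𝒩.card : ℝ) * (2 * Real.exp (-(5 * (n + L))))
        ≤ (5 ^ Module.finrank ℝ E * 5 ^ Module.finrank ℝ E) *
          (2 * Real.exp (-(5 * (n + L)))) := by
          gcongr; exact hcardR.trans (le_mul_of_one_le_left (by positivity) hone)
      _ ≤ _ := by linarith
  have p4 : ∀ f : E × E → E, (∀ r ∈ 𝒩 ×ˢ 𝒩, ‖f r‖ ≤ 1) →
      ν.real (⋃ r ∈ 𝒩 ×ˢ 𝒩, B4 (f r)) ≤ 2 * Real.exp (-(5 * L)) := by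
    intro f hf
    refine (measureReal_biUnion_finset_le (𝒩 ×ˢ 𝒩) fun r => B4 (f r)).trans ?_
    refine (Finset.sum_le_card_nsmul (𝒩 ×ˢ 𝒩) _ _ fun r hr =>
      hp.block_prob hd hN hρ hσ hm (hf r hr)).trans ?_
    rw [nsmul_eq_mul, Finset.card_product, Nat.cast_mul]
    calc (𝒩.card : ℝ) * 𝒩.card * (2 * Real.exp (-(5 * (n + L))))
        ≤ (5 ^ Module.finrank ℝ E * 5 ^ Module.finrank ℝ E) *
          (2 * Real.exp (-(5 * (n + L)))) := by gcongr
      _ ≤ _ := by linarith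
  have p4a := p4 (fun r => (1 / 2 : ℝ) • (r.1 + r.2)) (fun r hr => by
    obtain ⟨h1, h2⟩ := Finset.mem_product.1 hr
    rw [norm_smul]; norm_num
    linarith [norm_add_le r.1 r.2, hnorm _ h1, hnorm _ h2])
  have p4b := p4 (fun r => (1 / 2 : ℝ) • (r.1 - r.2)) (fun r hr => by
    obtain ⟨h1, h2⟩ := Finset.mem_product.1 hr
    rw [norm_smul]; norm_num
    linarith [norm_sub_le r.1 r.2, hnorm _ h1, hnorm _ h2])
  have p5 : ν.real (⋃ i ∈ (Finset.univ : Finset (Fin N)), B5 i) ≤ N * (2 * Real.exp (-(5 * L))) := by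
    refine (measureReal_biUnion_finset_le Finset.univ B5).trans ?_
    refine (Finset.sum_le_card_nsmul Finset.univ _ _ fun i _ =>
      leaveOneOut_prob hρ hμ0 hμL i).trans ?_
    rw [nsmul_eq_mul, Finset.card_univ, Fintype.card_fin]
  refine (measureReal_mono (μ := ν) hsub).trans ?_
  refine (measureReal_union_le _ _).trans ?_
  refine (add_le_add (measureReal_union_le _ _) le_rfl).trans ?_
  refine (add_le_add (add_le_add (measureReal_union_le _ _) le_rfl) le_rfl).trans ?_
  refine (add_le_add (add_le_add (add_le_add (measureReal_union_le _ _) le_rfl) le_rfl)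
    le_rfl).trans ?_
  refine (add_le_add (add_le_add (add_le_add (add_le_add (measureReal_union_le _ _) le_rfl) le_rfl)
    le_rfl) le_rfl).trans ?_
  -- The six bounds add up to `(5 N + 8) exp (-5 L)`, and `8 ≤ 8 N`.
  have h8 : Real.exp (-(5 * L)) ≤ N * Real.exp (-(5 * L)) :=
    le_mul_of_one_le_left (Real.exp_pos _).le hN'
  linarith

end RegularProbability

/-! ### Arithmetic of the parameters. -/

section Parameters

/-- All parameter inequalities, in terms of `a = √N` and `r = √n`. -/
lemma parameter_inequalities {a r ρ L c : ℝ} (hr : 1 ≤ r) (hρ : 0 < ρ) (hρ1 : ρ ≤ 1)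
    (hL : 1 ≤ L) (hc : 0 < c) (hc1 : c ≤ 1) (ha : 1 ≤ a) (h1 : r ^ 2 * ρ * L ≤ c * a)
    (h2 : r * L ≤ c * a) (h3 : L ^ 3 ≤ a) :
    L ≤ c * a ^ 2 ∧ L * r ^ 2 * ρ ≤ c * a ^ 2 ∧
    (r ^ 2 + L) * (1 + ρ * (32 * (r * L))) ^ 2 ≤ 4100 * c * a ^ 2 ∧
    (r ^ 2 + L) * L * (1 + ρ * (32 * (r * L))) ≤ 66 * c * a ^ 2 ∧
    (r ^ 2 + L) * L * ρ * (1 + ρ ^ 2 * r ^ 2) ≤ 4 * c * a ^ 2 ∧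
    (r ^ 2 + L) * (2 * ρ + ρ ^ 2 * r ^ 2) ≤ 6 * c * a ^ 2 ∧
    (1 + ρ * (32 * (r * L))) * (r ^ 2 + 32 * (r * L)) ≤ 1089 * c * a ^ 2 ∧
    (1 + ρ * (32 * (r * L))) * (6 * (r * L)) ≤ 198 * c * a ^ 2 := by
  have hcc : c ^ 2 ≤ c := by nlinarith
  have haa : a ≤ a ^ 2 := by nlinarith
  have hr0 : 0 ≤ r := by linarith
  have hL0 : 0 ≤ L := by linarith
  have ha0 : 0 ≤ a := by linarith
  have k1 : c * a ≤ c * a ^ 2 := by gcongr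
  have k2 : (c * a) ^ 2 ≤ c * a ^ 2 := by rw [mul_pow]; gcongr
  have hLrL : L ≤ r * L := le_mul_of_one_le_left hL0 hr
  have e1 : r * L ≤ c * a ^ 2 := h2.trans k1
  have e2 : L ≤ c * a ^ 2 := hLrL.trans e1
  have e3 : (r * L) ^ 2 ≤ c * a ^ 2 := (pow_le_pow_left₀ (by positivity) h2 2).trans k2
  have e4 : r ^ 2 ≤ c * a ^ 2 := by
    refine le_trans ?_ e3
    exact pow_le_pow_left₀ hr0 (le_mul_of_one_le_right hr0 hL) 2
  have e5 : L ^ 2 ≤ c * a ^ 2 := le_trans (pow_le_pow_left₀ hL0 hLrL 2) e3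
  have e6 : r ^ 2 * ρ * L ≤ c * a ^ 2 := h1.trans k1
  have e7 : (r ^ 2 * ρ * L) ^ 2 ≤ c * a ^ 2 := (pow_le_pow_left₀ (by positivity) h1 2).trans k2
  have e8 : r ^ 2 * ρ * L * (r * L) ≤ c * a ^ 2 := by
    refine le_trans (mul_le_mul h1 h2 (by positivity) (by positivity)) ?_
    rw [← sq]; exact k2
  -- The growth condition on `N` enters here: it absorbs the extra factors `L ^ 2` in the terms `r L
  -- ^ 3` and `r ^ 2 ρ L ^ 3` created by the truncation level.
  have hLa : L ^ 2 ≤ a := le_trans (pow_le_pow_right₀ hL (by norm_num)) h3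
  have e9 : r * L * L ^ 2 ≤ c * a ^ 2 := by
    refine le_trans (mul_le_mul h2 hLa (by positivity) (by positivity)) ?_
    linarith [sq a]
  have e10 : r ^ 2 * ρ * L * L ^ 2 ≤ c * a ^ 2 := by
    refine le_trans (mul_le_mul h1 hLa (by positivity) (by positivity)) ?_
    linarith [sq a]
  have hρ2 : ρ ^ 2 ≤ ρ := by nlinarith
  have hca : 0 ≤ c * a ^ 2 := by positivity
  have mulρ : ∀ y z : ℝ, 0 ≤ y → y ≤ z → ρ * y ≤ z := fun y z hy hyz =>
    (mul_le_of_le_one_left hy hρ1).trans hyz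
  have f1 := mulρ _ _ (by positivity) e1
  have f3 := mulρ _ _ (by positivity) e3
  have f4 := mulρ _ _ (by positivity) e4
  have f2 := mulρ _ _ (by positivity) e2
  have f5 := mulρ _ _ (by positivity) e5
  have f6 := mulρ _ _ (by positivity) e6
  have f9 := mulρ _ _ (by positivity) e9
  have f10 := mulρ _ _ (by positivity) e10
  have f33 := mulρ _ _ (by positivity) (mulρ _ _ (by positivity) f3)
  have e7' : (r ^ 2 * ρ) ^ 2 * L ≤ c * a ^ 2 := by
    refine le_trans ?_ e7
    rw [mul_pow (r ^ 2 * ρ) L 2]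
    gcongr
    nlinarith
  have f7 := mulρ _ _ (by positivity) e7'
  have e7'' : (r ^ 2 * ρ) ^ 2 ≤ c * a ^ 2 := by
    refine le_trans ?_ e7
    rw [mul_pow (r ^ 2 * ρ) L 2]
    exact le_mul_of_one_le_right (by positivity) (one_le_pow₀ hL)
  have e3' : r ^ 2 * L ≤ c * a ^ 2 := by
    refine le_trans ?_ e3
    rw [mul_pow]; gcongr; nlinarith
  refine ⟨e2, by linarith, ?_, ?_, ?_, ?_, ?_, ?_⟩
  · have : (1 + ρ * (32 * (r * L))) ^ 2 ≤ 2 * (1 + 1024 * (ρ * (r * L)) ^ 2) := by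
      nlinarith [sq_nonneg (1 - 32 * (ρ * (r * L)))]
    refine (mul_le_mul_of_nonneg_left this (by positivity)).trans ?_
    have : L * (ρ * (r * L)) ^ 2 ≤ c * a ^ 2 := by
      have e : L * (ρ * (r * L)) ^ 2 = ρ * (r ^ 2 * ρ * L * L ^ 2) := by ring
      rw [e]; exact f10
    linarith
  · linarith
  · linarith
  · have : L * (ρ ^ 2 * r ^ 2) ≤ c * a ^ 2 := by
      have e : L * (ρ ^ 2 * r ^ 2) = ρ * (r ^ 2 * ρ * L) := by ring
      rw [e]; exact f6
    linarith
  · have : r ^ 2 * ρ * L * r ≤ c * a ^ 2 := by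
      refine le_trans ?_ e8
      gcongr
      exact le_mul_of_one_le_right hr0 hL
    linarith
  · linarith

/-- The parameter inequalities follow from the assumptions on `a = √N` and `r = √n`. -/
lemma parameterBounds_of_sqrt {N : ℕ} {n ρ L c η a r : ℝ} (hr : 1 ≤ r) (hρ : 0 < ρ)
    (hρ1 : ρ ≤ 1) (hL : 1 ≤ L) (hc : 0 < c) (ha : 1 ≤ a) (h1 : r ^ 2 * ρ * L ≤ c * a)
    (h2 : r * L ≤ c * a) (h3 : L ^ 3 ≤ a) (hη : 0 < η) (hη1 : η ≤ 1)
    (hcη : 10 ^ 9 * c ≤ η ^ 2) (hn : r ^ 2 = n) (hN : a ^ 2 = N)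
    (hexp : Real.exp (-L) ≤ 1 / a ^ 2) :
    ParameterBounds N n ρ L (32 * (√n * L)) η := by
  have hηη : η ^ 2 ≤ η := by nlinarith
  have hrn : √n = r := by rw [← hn, Real.sqrt_sq (by linarith)]
  have ha2 : 0 < a ^ 2 := by positivity
  obtain ⟨p1, p2, p3, p4, p5, p6, -, -⟩ :=
    parameter_inequalities hr hρ hρ1 hL hc (by linarith) ha h1 h2 h3
  have q : 10 ^ 9 * (c * a ^ 2) ≤ η ^ 2 * a ^ 2 := by
    rw [← mul_assoc]; exact mul_le_mul_of_nonneg_right hcη ha2.le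
  have q' : η ^ 2 * a ^ 2 ≤ η * a ^ 2 := mul_le_mul_of_nonneg_right hηη ha2.le
  have q0 : 0 < c * a ^ 2 := by positivity
  rw [hrn]
  refine ⟨by rw [← hn]; nlinarith, hL, by rw [hrn], hη, ?_, ?_, ?_, ?_, ?_, ?_, ?_⟩
  · rw [← hN]; linarith
  · rw [← hN, ← hn]; linarith
  · rw [← hN, ← hn]; linarith
  · rw [← hN, ← hn]
    have : (r ^ 2 + L) * √L * (1 + ρ * (32 * (r * L))) ≤
        (r ^ 2 + L) * L * (1 + ρ * (32 * (r * L))) := by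
      gcongr
      exact Real.sqrt_le_iff.2 ⟨by linarith, by nlinarith⟩
    linarith
  · rw [← hN, ← hn]; linarith
  · rw [hrn]
    have e1 : Real.exp (-(2 * L)) ≤ 1 / a ^ 2 :=
      (Real.exp_le_exp.2 (by linarith)).trans hexp
    have e2 : ρ * r ≤ c * a ^ 2 := by
      calc ρ * r ≤ 1 * (r * L) := by
            gcongr
            exact le_mul_of_one_le_right (by linarith) hL
        _ ≤ c * a := by linarith
        _ ≤ c * a ^ 2 := by gcongr; nlinarith
    have e3 : ρ * r * Real.exp (-(2 * L)) ≤ c := by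
      calc ρ * r * Real.exp (-(2 * L)) ≤ c * a ^ 2 * (1 / a ^ 2) := by gcongr
        _ = c := by field_simp
    linarith
  · rw [← hN, ← hn]; linarith

/-- This controls the weight bound times the squared row norm. The planted part `1 / (N ρ)` is not
small through `c`; it needs the lower bound `C` on the expected number of nonzero entries. -/
lemma tail_radius_le {N : ℕ} {n ρ L c η a r C : ℝ} (hr : 1 ≤ r) (hρ : 0 < ρ)
    (hρ1 : ρ ≤ 1) (hL : 1 ≤ L) (hc : 0 < c) (ha : 1 ≤ a) (h1 : r ^ 2 * ρ * L ≤ c * a)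
    (h2 : r * L ≤ c * a) (h3 : L ^ 3 ≤ a) (hη : 0 < η) (hη1 : η ≤ 1)
    (hcη : 10 ^ 9 * c ≤ η ^ 2) (hn : r ^ 2 = n) (hN : a ^ 2 = N)
    (hCη : 2 ≤ C * η) (hNρ : C ≤ N * ρ) :
    (1 + ρ * (32 * (√n * L))) * (1 / (N * ρ) + (n + 32 * (√n * L)) / N) ≤ η := by
  have hηη : η ^ 2 ≤ η := by nlinarith
  have hrn : √n = r := by rw [← hn, Real.sqrt_sq (by linarith)]
  have ha2 : 0 < a ^ 2 := by positivity
  obtain ⟨-, -, -, -, -, -, p7, -⟩ :=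
    parameter_inequalities hr hρ hρ1 hL hc (by linarith) ha h1 h2 h3
  rw [hrn, ← hn, ← hN]
  rw [← hN] at hNρ
  have e1 : 1 / (a ^ 2 * ρ) ≤ η / 2 := by
    rw [div_le_iff₀ (by positivity)]
    nlinarith
  have e2 : r * L / a ^ 2 ≤ c := by
    rw [div_le_iff₀ ha2]
    exact h2.trans (by gcongr; nlinarith)
  have e3 : (1 + ρ * (32 * (r * L))) * (r ^ 2 + 32 * (r * L)) / a ^ 2 ≤ 1089 * c := by
    rw [div_le_iff₀ ha2]; exact p7
  have e4 : (1 + ρ * (32 * (r * L))) * (1 / (a ^ 2 * ρ) + (r ^ 2 + 32 * (r * L)) / a ^ 2) =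
      1 / (a ^ 2 * ρ) + 32 * (r * L / a ^ 2) +
        (1 + ρ * (32 * (r * L))) * (r ^ 2 + 32 * (r * L)) / a ^ 2 := by
    field_simp
  rw [e4]
  linarith

/-- The Gaussian inner product of variance of order `μ ^ 2` must be below a multiple of `1 / √ρ` in
all `N` rows, which forces `ρ L μ ^ 2 ≤ 1`. The largest admissible `μ ≤ 1` is taken: `1` if `ρ L ≤
1`, and `1 / √(ρ L)` otherwise. -/
lemma exists_side_scale {N : ℕ} {n ρ L c η a r : ℝ} (hr : 1 ≤ r) (hρ : 0 < ρ)
    (hρ1 : ρ ≤ 1) (hL : 1 ≤ L) (hc : 0 < c) (ha : 1 ≤ a) (h1 : r ^ 2 * ρ * L ≤ c * a)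
    (h2 : r * L ≤ c * a) (h3 : L ^ 3 ≤ a) (hη : 0 < η) (hη1 : η ≤ 1)
    (hcη : 10 ^ 9 * c ≤ η ^ 2) (hn : r ^ 2 = n) (hN : a ^ 2 = N)
    (hR : (1 + ρ * (32 * (√n * L))) * (1 / (N * ρ) + (n + 32 * (√n * L)) / N) ≤ η) :
    ∃ μ : ℝ, (μ = 1 ∨ μ = 1 / √(ρ * L)) ∧ ρ * L * μ ^ 2 ≤ 1 ∧ μ ≤ 1 ∧
      (1 + ρ * (32 * (√n * L))) * (1 / √(N * ρ) * √((n + 32 * (√n * L)) / N)) ≤ η * μ := by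
  have hηη : η ^ 2 ≤ η := by nlinarith
  have hrn : √n = r := by rw [← hn, Real.sqrt_sq (by linarith)]
  have ha2 : 0 < a ^ 2 := by positivity
  have hL0 : 0 < L := by linarith
  have hr0 : 0 < r := by linarith
  obtain ⟨-, -, -, -, -, -, -, p8⟩ :=
    parameter_inequalities hr hρ hρ1 hL hc (by linarith) ha h1 h2 h3
  rw [hrn, ← hn, ← hN] at hR ⊢
  rcases le_total (ρ * L) 1 with h | h
  -- For `μ = 1` the product of the planted and Gaussian norms is bounded by the sum of their
  -- squares, that is, by `hR`.
  · refine ⟨1, Or.inl rfl, by linarith, le_rfl, ?_⟩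
    refine le_trans ?_ (hR.trans_eq (mul_one η).symm)
    gcongr
    have s1 : (1 / √(a ^ 2 * ρ)) ^ 2 = 1 / (a ^ 2 * ρ) := by
      rw [div_pow, one_pow, Real.sq_sqrt (by positivity)]
    have s2 : √((r ^ 2 + 32 * (r * L)) / a ^ 2) ^ 2 = (r ^ 2 + 32 * (r * L)) / a ^ 2 :=
      Real.sq_sqrt (by positivity)
    have s3 := two_mul_le_add_sq (1 / √(a ^ 2 * ρ)) √((r ^ 2 + 32 * (r * L)) / a ^ 2)
    have s4 : 0 ≤ 1 / √(a ^ 2 * ρ) * √((r ^ 2 + 32 * (r * L)) / a ^ 2) := by positivity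
    rw [s1, s2] at s3
    linarith
  · have hs1 : 1 ≤ √(ρ * L) := by rwa [Real.one_le_sqrt]
    have hs : √(ρ * L) ^ 2 = ρ * L := Real.sq_sqrt (by positivity)
    refine ⟨1 / √(ρ * L), Or.inr rfl, ?_, ?_, ?_⟩
    · rw [div_pow, one_pow, hs, mul_one_div, div_self (by positivity)]
    · rw [div_le_one (by linarith)]; exact hs1
    have hsL : 0 < √L := Real.sqrt_pos.2 hL0
    have hsρ : 0 < √ρ := Real.sqrt_pos.2 hρ
    have t1 : √((r ^ 2 + 32 * (r * L)) / a ^ 2) ≤ 6 * (r * L) / (√L * a) := by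
      refine Real.sqrt_le_iff.2 ⟨by positivity, ?_⟩
      rw [div_pow, mul_pow √L, Real.sq_sqrt hL0.le, div_le_div_iff₀ ha2 (by positivity)]
      have : (r ^ 2 + 32 * (r * L)) * L ≤ (6 * (r * L)) ^ 2 := by
        have u1 : r ^ 2 * L ≤ r ^ 2 * L ^ 2 := by gcongr; nlinarith
        have u2 : r * L ^ 2 ≤ r ^ 2 * L ^ 2 := by gcongr; nlinarith
        have u3 : 0 ≤ r ^ 2 * L ^ 2 := by positivity
        linarith
      calc (r ^ 2 + 32 * (r * L)) * (L * a ^ 2) = (r ^ 2 + 32 * (r * L)) * L * a ^ 2 := by ring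
        _ ≤ _ := by gcongr
    have t2 : √(a ^ 2 * ρ) = a * √ρ := by
      rw [Real.sqrt_mul (by positivity), Real.sqrt_sq (by linarith)]
    rw [t2, Real.sqrt_mul hρ.le]
    calc (1 + ρ * (32 * (r * L))) * (1 / (a * √ρ) * √((r ^ 2 + 32 * (r * L)) / a ^ 2))
        ≤ (1 + ρ * (32 * (r * L))) * (1 / (a * √ρ) * (6 * (r * L) / (√L * a))) := by gcongr
      _ = (1 + ρ * (32 * (r * L))) * (6 * (r * L)) / a ^ 2 * (1 / (√ρ * √L)) := by
          field_simp
      _ ≤ η * (1 / (√ρ * √L)) := by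
          gcongr
          rw [div_le_iff₀ ha2]
          nlinarith

/-- The assumptions on the parameters, in the form in which they are used. -/
lemma exists_parameterBounds {c₁ : ℝ} (hc₁ : 0 < c₁) (hc₁' : c₁ < 0.1) {N n : ℕ} (hn : 1 ≤ n)
    {ρ δ : ℝ} (hρ : 0 < ρ) (hρ1 : ρ ≤ 1) (hδ : 0 < δ) (hδ1 : δ < 1 / 2)
    (hnN : n ≤ N) (h7 : Real.log (N / δ) ^ 7 ≤ N)
    (hC : 100 / (3 * c₁ / 1000) ^ 2 * (Real.log (1 / δ) / N) ≤ ρ) (hκ : c₁ ≤ |ρ - 1 / 3|)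
    (hc : ((n : ℝ) * ρ / √(N : ℝ) + √((n : ℝ) / N)) * Real.log (N / δ) ≤
      (3 * c₁ / 1000) ^ 2 / 10 ^ 9) :
    ∃ L T μ : ℝ, Real.log (N / δ) = L ∧ ParameterBounds N n ρ L T (|1 - 3 * ρ| / 1000) ∧
      (μ = 1 ∨ μ = 1 / √(ρ * L)) ∧ ρ * L * μ ^ 2 ≤ 1 ∧ μ ≤ 1 ∧ 0 ≤ T ∧ 2 ≤ N ∧
      3 * c₁ / 1000 ≤ |1 - 3 * ρ| / 1000 ∧
      (1 + ρ * T) * (1 / (N * ρ) + (n + T) / N) ≤ |1 - 3 * ρ| / 1000 ∧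
      (1 + ρ * T) * (1 / √(N * ρ) * √((n + T) / N)) ≤ |1 - 3 * ρ| / 1000 * μ := by
  set η₀ := 3 * c₁ / 1000 with hη₀
  have hη₀0 : 0 < η₀ := by positivity
  have hη₀1 : η₀ ≤ 1 := by rw [hη₀]; linarith
  have hηη : η₀ ≤ |1 - 3 * ρ| / 1000 := by
    have : |1 - 3 * ρ| = 3 * |ρ - 1 / 3| := by
      rw [show 1 - 3 * ρ = -(3 * (ρ - 1 / 3)) by ring, abs_neg, abs_mul, abs_of_pos three_pos]
    rw [this, hη₀]; linarith
  have hη1 : |1 - 3 * ρ| / 1000 ≤ 1 := by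
    have : |1 - 3 * ρ| ≤ 1000 := by rw [abs_le]; constructor <;> linarith
    linarith
  set L := Real.log (N / δ) with hLdef
  set c := η₀ ^ 2 / 10 ^ 9 with hcdef
  have hc0 : 0 < c := by positivity
  have hc1 : c ≤ 1 / 10 ^ 9 := by rw [hcdef]; gcongr; exact pow_le_one₀ hη₀0.le hη₀1
  have hN1 : (1 : ℝ) ≤ N := by exact_mod_cast hn.trans hnN
  have hn1 : (1 : ℝ) ≤ n := by exact_mod_cast hn
  have hlog2 := Real.log_two_gt_d9
  set a := √(N : ℝ) with ha
  set r := √(n : ℝ) with hr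
  have haN : a ^ 2 = N := Real.sq_sqrt (by positivity)
  have hrn : r ^ 2 = n := Real.sq_sqrt (by positivity)
  have ha1 : 1 ≤ a := Real.one_le_sqrt.2 hN1
  have hr1 : 1 ≤ r := Real.one_le_sqrt.2 hn1
  have hNδ : 2 * (N : ℝ) ≤ N / δ := by
    rw [le_div_iff₀ hδ]; nlinarith
  have hLN : Real.log (2 * N) ≤ L := Real.log_le_log (by positivity) hNδ
  have hL2 : 1 / 2 ≤ L := by
    have : Real.log 2 ≤ Real.log (2 * N) := Real.log_le_log two_pos (by linarith)
    linarith
  rw [Real.sqrt_div (by positivity), ← hr, ← ha, ← add_div, div_mul_eq_mul_div,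
    div_le_iff₀ (by positivity), ← hrn] at hc
  have h1 : r ^ 2 * ρ * L ≤ c * a := by
    have : 0 ≤ r * L := by positivity
    linarith
  have h2 : r * L ≤ c * a := by
    have : 0 ≤ r ^ 2 * ρ * L := by positivity
    linarith
  -- As `c ≤ 10 ^ (-9)` and `L ≥ 1/2`, the bound `r L ≤ c a` already forces `N` to be large; this
  -- improves `L ≥ 1/2` to `L ≥ 1`.
  have ha2 : 2 ≤ a := by
    have h3 : L ≤ r * L := le_mul_of_one_le_left (by linarith) hr1
    have h4 : c * a ≤ 1 / 10 ^ 9 * a := by gcongr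
    linarith
  have hN4 : (4 : ℝ) ≤ N := by rw [← haN]; nlinarith
  have hL1 : 1 ≤ L := by
    have : Real.log (2 ^ 2) ≤ Real.log (2 * N) := Real.log_le_log (by norm_num) (by linarith)
    rw [Real.log_pow] at this
    push_cast at this
    linarith
  have h3 : L ^ 3 ≤ a := by
    refine Real.le_sqrt_of_sq_le (le_trans ?_ h7)
    rw [← pow_mul]
    exact pow_le_pow_right₀ hL1 (by norm_num)
  have hexp : Real.exp (-L) ≤ 1 / a ^ 2 := by
    rw [haN, hLdef, Real.exp_neg, Real.exp_log (by positivity), inv_div]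
    gcongr
    linarith
  have hη := hη₀0.trans_le hηη
  have hcη : 10 ^ 9 * c ≤ (|1 - 3 * ρ| / 1000) ^ 2 := by
    have : 10 ^ 9 * c = η₀ ^ 2 := by rw [hcdef]; ring
    rw [this]
    gcongr
  -- Since `δ < 1/2`, `log (1 / δ)` is at least `1/2`, so the lower bound on `ρ` also keeps `N ρ`
  -- above a constant.
  have hNρ : 50 / η₀ ^ 2 ≤ N * ρ := by
    have hld : 1 / 2 ≤ Real.log (1 / δ) := by
      have : Real.log 2 ≤ Real.log (1 / δ) :=
        Real.log_le_log two_pos (by rw [le_div_iff₀ hδ]; linarith)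
      linarith
    rw [← mul_div_assoc, div_le_iff₀ (by positivity)] at hC
    calc 50 / η₀ ^ 2 = 100 / η₀ ^ 2 * (1 / 2) := by ring
      _ ≤ 100 / η₀ ^ 2 * Real.log (1 / δ) := by gcongr
      _ ≤ N * ρ := by linarith
  have hR := tail_radius_le hr1 hρ hρ1 hL1 hc0 ha1 h1 h2 h3 hη hη1 hcη hrn haN
    (C := 50 / η₀ ^ 2) (by
      calc (2 : ℝ) ≤ 50 / η₀ := by rw [le_div_iff₀ hη₀0]; linarith
        _ = 50 / η₀ ^ 2 * η₀ := by field_simp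
        _ ≤ _ := by gcongr) hNρ
  obtain ⟨μ, hμ, hμL, hμ1, hRμ⟩ :=
    exists_side_scale hr1 hρ hρ1 hL1 hc0 ha1 h1 h2 h3 hη hη1 hcη hrn haN hR
  refine ⟨L, _, μ, rfl, parameterBounds_of_sqrt hr1 hρ hρ1 hL1 hc0 ha1 h1 h2 h3 hη hη1 hcη hrn
    haN hexp, hμ, hμL, hμ1, by positivity, ?_, hηη, hR, hRμ⟩
  have : (2 : ℝ) ≤ N := by linarith
  exact_mod_cast this

end Parameters

/-! ### Laws of the planted vector and of the Gaussian rows. -/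

section Laws

lemma isProbabilityMeasure_brEntryLaw {N : ℕ} {ρ : ℝ} (hρ : 0 ≤ ρ) (hρ1 : ρ ≤ 1) :
    IsProbabilityMeasure (brEntryLaw N ρ) := by
  constructor
  simp only [brEntryLaw, Measure.coe_add, Measure.coe_smul, Pi.add_apply, Pi.smul_apply,
    measure_univ, smul_eq_mul, mul_one]
  rw [← ENNReal.ofReal_add (by linarith) (by linarith),
    ← ENNReal.ofReal_add (by linarith) (by linarith), ← ENNReal.ofReal_one]
  congr 1
  ring

lemma ae_brEntryLaw (N : ℕ) (ρ : ℝ) :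
    ∀ᵐ y ∂brEntryLaw N ρ, ∃ s : SignType, y = (s : ℝ) / √((N : ℝ) * ρ) := by
  rw [brEntryLaw]
  simp only [ae_add_measure_iff]
  refine ⟨⟨Measure.ae_smul_measure ?_ _, Measure.ae_smul_measure ?_ _⟩,
    Measure.ae_smul_measure ?_ _⟩ <;> rw [ae_dirac_eq, Filter.eventually_pure]
  · exact ⟨0, by simp⟩
  · exact ⟨1, by simp⟩
  · exact ⟨-1, by simp [neg_div]⟩

lemma integrable_brEntryLaw (N : ℕ) (ρ : ℝ) (f : ℝ → ℝ) : Integrable f (brEntryLaw N ρ) := by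
  refine ((Integrable.smul_measure ?_ ENNReal.ofReal_ne_top).add_measure
    (Integrable.smul_measure ?_ ENNReal.ofReal_ne_top)).add_measure
    (Integrable.smul_measure ?_ ENNReal.ofReal_ne_top) <;>
  exact integrable_dirac (by simp)

lemma integral_brEntryLaw (N : ℕ) {ρ : ℝ} (hρ : 0 ≤ ρ) (hρ1 : ρ ≤ 1) (f : ℝ → ℝ) :
    ∫ y, f y ∂brEntryLaw N ρ = (1 - ρ) * f 0 + ρ / 2 * f (1 / √((N : ℝ) * ρ)) +
      ρ / 2 * f (-(1 / √((N : ℝ) * ρ))) := by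
  have h : ∀ (c : ℝ) (a : ℝ), Integrable f (ENNReal.ofReal c • Measure.dirac a) := fun c a =>
    (integrable_dirac (by simp)).smul_measure ENNReal.ofReal_ne_top
  rw [brEntryLaw, integral_add_measure ((h _ _).add_measure (h _ _)) (h _ _),
    integral_add_measure (h _ _) (h _ _)]
  simp only [integral_smul_measure, integral_dirac, smul_eq_mul]
  rw [ENNReal.toReal_ofReal (by linarith), ENNReal.toReal_ofReal (by linarith)]

/-- The number of nonzero entries of a Bernoulli-Rademacher vector concentrates. -/
lemma pi_brEntryLaw_real_sum_sq_le {N : ℕ} {ρ η : ℝ} (hN : 0 < N) (hρ : 0 < ρ) (hρ1 : ρ ≤ 1)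
    (hη : 0 < η) (hη1 : η ≤ 1) :
    (Measure.pi fun _ : Fin N => brEntryLaw N ρ).real
      {y | η * (N * ρ) ≤ |∑ i, (N * ρ * y i ^ 2 - ρ)|} ≤
        2 * Real.exp (-(N * ρ * η ^ 2 / 4)) := by
  have := isProbabilityMeasure_brEntryLaw (N := N) hρ.le hρ1
  have hN' : (0 : ℝ) < N := by exact_mod_cast hN
  have hNρ : 0 < (N : ℝ) * ρ := by positivity
  refine (pi_real_abs_sum_ge_le (μ := brEntryLaw N ρ) (s := η / 2)
    (f := fun _ y => N * ρ * y ^ 2 - ρ) (c := fun _ => ρ * (η / 2) ^ 2) (by positivity)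
    fun s hs _ => ⟨integrable_brEntryLaw _ _ _, ?_⟩).trans (le_of_eq ?_)
  · rw [integral_brEntryLaw N hρ.le hρ1]
    have hb : N * ρ * (1 / √((N : ℝ) * ρ)) ^ 2 = 1 := by
      rw [div_pow, one_pow, Real.sq_sqrt hNρ.le]; field_simp
    rw [neg_sq, hb]
    have hs1 : |s| ≤ 1 := by rw [hs]; linarith
    -- The estimate `exp s - 1 ≤ s + s ^ 2` for `|s| ≤ 1` turns the Bernoulli moment generating
    -- function into `exp (ρ s ^ 2)` after centring. At `|s| = η / 2` half of the linear gain
    -- remains.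
    have he := (abs_le.1 (Real.abs_exp_sub_one_sub_id_le hs1)).2
    calc (1 - ρ) * Real.exp (s * (N * ρ * 0 ^ 2 - ρ)) + ρ / 2 * Real.exp (s * (1 - ρ)) +
          ρ / 2 * Real.exp (s * (1 - ρ))
        = Real.exp (-(s * ρ)) * (ρ * (Real.exp s - 1) + 1) := by
          rw [show s * (N * ρ * 0 ^ 2 - ρ) = -(s * ρ) by ring,
            show s * (1 - ρ) = -(s * ρ) + s by ring, Real.exp_add]
          ring
      _ ≤ Real.exp (-(s * ρ)) * Real.exp (ρ * (s + s ^ 2)) := by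
          gcongr
          refine (Real.add_one_le_exp _).trans (Real.exp_le_exp.2 ?_)
          gcongr
          linarith
      _ = Real.exp (ρ * (η / 2) ^ 2) := by
          rw [← Real.exp_add, ← hs, sq_abs]; congr 1; ring
  · rw [Finset.sum_const, Finset.card_univ, Fintype.card_fin, nsmul_eq_mul]
    congr 2
    ring

lemma map_curry_pi {ι κ X : Type*} [Fintype ι] [Fintype κ] [MeasurableSpace X] (μ : Measure X)
    [IsProbabilityMeasure μ] :
    (Measure.pi fun _ : ι × κ => μ).map (fun z (i : ι) (j : κ) => z (i, j)) =
      Measure.pi fun _ : ι => Measure.pi fun _ : κ => μ := by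
  have hm : Measurable fun (z : ι × κ → X) (i : ι) (j : κ) => z (i, j) := by fun_prop
  have hm' : Measurable fun (w : ι → κ → X) (p : ι × κ) => w p.1 p.2 := by fun_prop
  have h : Measure.pi (fun _ : ι × κ => μ) =
      (Measure.pi fun _ : ι => Measure.pi fun _ : κ => μ).map
        fun w (p : ι × κ) => w p.1 p.2 := by
    refine Measure.pi_eq fun s hs => ?_
    rw [Measure.map_apply hm' (.univ_pi hs)]
    have e : (fun (w : ι → κ → X) (p : ι × κ) => w p.1 p.2) ⁻¹' Set.univ.pi s =
        Set.univ.pi fun i => Set.univ.pi fun j => s (i, j) := by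
      ext w; simp [Set.mem_pi]
    rw [e, Measure.pi_pi]
    simp_rw [Measure.pi_pi]
    rw [Fintype.prod_prod_type]
  rw [h, Measure.map_map hm hm']
  exact Measure.map_id

variable {Ω : Type*} [MeasurableSpace Ω] {P : Measure Ω} {N n : ℕ}
  {v : Ω → Fin N → ℝ} {ρ : ℝ}

lemma IsBernoulliRademacher.aemeasurable (h : IsBernoulliRademacher P ρ v) :
    AEMeasurable v P :=
  aemeasurable_pi_lambda _ fun i => (h.hasLaw i).aemeasurable

lemma IsBernoulliRademacher.map_eq (h : IsBernoulliRademacher P ρ v) :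
    P.map v = Measure.pi fun _ : Fin N => brEntryLaw N ρ := by
  have := h.indep.map_fun_eq_pi_map fun i => (h.hasLaw i).aemeasurable
  simp_rw [fun i => (h.hasLaw i).map_eq] at this
  exact this

variable [NeZero n] {Y : Ω → Matrix (Fin N) (Fin n) ℝ}

/-- The Gaussian parts of the rows, normalized to be standard Gaussian vectors. -/
def normalizedTail (Y : Matrix (Fin N) (Fin n) ℝ) (i : Fin N) :
    EuclideanSpace ℝ {j : Fin n // j ≠ 0} := √(N : ℝ) • tailPart (Y i)

lemma gaussianRow_normalizedTail (hN : 0 < N) (Y : Matrix (Fin N) (Fin n) ℝ) (i : Fin N) :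
    gaussianRow (normalizedTail Y) i = tailPart (Y i) := by
  have : 0 < √(N : ℝ) := Real.sqrt_pos.2 (by exact_mod_cast hN)
  rw [gaussianRow, normalizedTail, smul_smul, inv_mul_cancel₀ this.ne', one_smul]

lemma normalizedTail_eq {α : Type*} (Y : α → Matrix (Fin N) (Fin n) ℝ) :
    (fun ω => normalizedTail (Y ω)) =
      ((fun (w : Fin N → {j : Fin n // j ≠ 0} → ℝ) i => WithLp.toLp 2 (w i)) ∘
        (fun (z : Fin N × {j : Fin n // j ≠ 0} → ℝ) i j => z (i, j)) ∘
          fun (z : Fin N × {j : Fin n // j ≠ 0} → ℝ) p => √(N : ℝ) * z p) ∘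
        fun ω (p : Fin N × {j : Fin n // j ≠ 0}) => Y ω p.1 p.2 := by
  funext ω i
  ext j
  simp [normalizedTail, tailPart]

lemma measurable_toLp_rows : Measurable
    ((fun (w : Fin N → {j : Fin n // j ≠ 0} → ℝ) i =>
      (WithLp.toLp 2 (w i) : EuclideanSpace ℝ {j : Fin n // j ≠ 0})) ∘
        (fun (z : Fin N × {j : Fin n // j ≠ 0} → ℝ) i j => z (i, j)) ∘
          fun (z : Fin N × {j : Fin n // j ≠ 0} → ℝ) p => √(N : ℝ) * z p) := by
  refine Measurable.comp ?_ (Measurable.comp (by fun_prop) (by fun_prop))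
  fun_prop

lemma IsGaussianBasis.aemeasurable_entries (h : IsGaussianBasis P v Y) :
    AEMeasurable (fun ω (p : Fin N × {j : Fin n // j ≠ 0}) => Y ω p.1 p.2) P :=
  aemeasurable_pi_lambda _ fun p => (h.hasLaw p.1 p.2 p.2.2).aemeasurable

lemma IsGaussianBasis.aemeasurable_normalizedTail (h : IsGaussianBasis P v Y) :
    AEMeasurable (fun ω => normalizedTail (Y ω)) P := by
  rw [normalizedTail_eq]
  exact measurable_toLp_rows.comp_aemeasurable h.aemeasurable_entries

lemma IsGaussianBasis.indepFun_normalizedTail (h : IsGaussianBasis P v Y) :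
    IndepFun v (fun ω => normalizedTail (Y ω)) P := by
  rw [normalizedTail_eq]
  exact h.indep_planted.comp measurable_id measurable_toLp_rows

lemma gaussianReal_map_sqrt_mul (hN : 0 < N) :
    (gaussianReal 0 ((N : ℝ≥0)⁻¹)).map (fun t => √(N : ℝ) * t) = gaussianReal 0 1 := by
  have hN' : (0 : ℝ) < N := by exact_mod_cast hN
  rw [gaussianReal_map_const_mul, mul_zero]
  congr 1
  ext
  simp [Real.sq_sqrt hN'.le, hN'.ne']

lemma IsGaussianBasis.map_normalizedTail (h : IsGaussianBasis P v Y) (hN : 0 < N) :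
    P.map (fun ω => normalizedTail (Y ω)) =
      Measure.pi fun _ : Fin N => stdGaussian (EuclideanSpace ℝ {j : Fin n // j ≠ 0}) := by
  have h1 := h.indep.map_fun_eq_pi_map fun (p : Fin N × {j : Fin n // j ≠ 0}) =>
    (h.hasLaw p.1 p.2 p.2.2).aemeasurable
  simp_rw [fun p : Fin N × {j : Fin n // j ≠ 0} => (h.hasLaw p.1 p.2 p.2.2).map_eq] at h1
  have hm3 : Measurable fun (w : Fin N → {j : Fin n // j ≠ 0} → ℝ) (i : Fin N) =>
      (WithLp.toLp 2 (w i) : EuclideanSpace ℝ {j : Fin n // j ≠ 0}) := by fun_prop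
  rw [normalizedTail_eq, ← AEMeasurable.map_map_of_aemeasurable
    measurable_toLp_rows.aemeasurable h.aemeasurable_entries, h1,
    ← Measure.map_map hm3 (by fun_prop), ← Measure.map_map (by fun_prop) (by fun_prop),
    Measure.pi_map_pi (fun _ => by fun_prop)]
  simp_rw [gaussianReal_map_sqrt_mul hN]
  rw [map_curry_pi, Measure.pi_map_pi (fun _ => by fun_prop)]
  simp_rw [map_pi_eq_stdGaussian]

end Laws

/-! ### Conditioning on a discrete variable by a union bound. -/

section Discretization

/-- A union bound over the values of a discrete random vector that is independent of `X`. -/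
lemma exists_measurableSet_of_discrete {Ω 𝒱 𝒳 ι : Type*} [MeasurableSpace Ω] {P : Measure Ω}
    [IsProbabilityMeasure P] [MeasurableSpace 𝒱] [MeasurableSingletonClass 𝒱] [MeasurableSpace 𝒳]
    {v : Ω → 𝒱} {X : Ω → 𝒳} (hv : AEMeasurable v P) (hX : AEMeasurable X P)
    (hvX : IndepFun v X P) {p : ι → 𝒱} (hp : Function.Injective p) (A : Finset ι)
    {B : ι → Set 𝒳} {D : Set 𝒱} {ε₁ ε₂ : ℝ} (hε₂ : 0 ≤ ε₂) (hD : (P.map v).real D ≤ ε₁)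
    (hB : ∀ τ ∈ A, (P.map X).real (B τ) ≤ ε₂) (hA : ∀ y ∉ D, ∃ τ ∈ A, y = p τ) :
    ∃ G : Set Ω, MeasurableSet G ∧ 1 - (ε₁ + ε₂) ≤ P.real G ∧
      ∀ ω ∈ G, ∃ τ ∈ A, v ω = p τ ∧ X ω ∉ B τ := by
  have := Measure.isProbabilityMeasure_map hv
  have := Measure.isProbabilityMeasure_map hX
  set D' := toMeasurable (P.map v) D with hD'
  -- Measurable hulls of equal measure replace the bad sets, whose measurability is then never
  -- required.
  set B' := fun τ => toMeasurable (P.map X) (B τ) with hB'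
  set F := v ⁻¹' D' ∪ ⋃ τ ∈ A, v ⁻¹' {p τ} ∩ X ⁻¹' B' τ with hF
  have hD'm : P.real (v ⁻¹' D') ≤ ε₁ := by
    rw [← map_measureReal_apply_of_aemeasurable hv (measurableSet_toMeasurable _ _)]
    rwa [measureReal_def, measure_toMeasurable]
  -- Injectivity of `p` makes the events `v = p τ` disjoint. The union bound is thus weighted by
  -- probabilities of total mass at most one and does not pay for the cardinality of `A`.
  have hsum : ∑ τ ∈ A, P.real (v ⁻¹' {p τ}) ≤ 1 := by
    classical
    calc ∑ τ ∈ A, P.real (v ⁻¹' {p τ}) = ∑ τ ∈ A, (P.map v).real {p τ} :=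
          Finset.sum_congr rfl fun τ _ =>
            (map_measureReal_apply_of_aemeasurable hv (measurableSet_singleton _)).symm
      _ = ∑ y ∈ A.image p, (P.map v).real {y} := (Finset.sum_image (f := fun y => (P.map v).real {y}) hp.injOn).symm
      _ = (P.map v).real (A.image p) := sum_measureReal_singleton _
      _ ≤ 1 := measureReal_le_one
  have hFm : P.real F ≤ ε₁ + ε₂ := by
    refine (measureReal_union_le _ _).trans (add_le_add hD'm ?_)
    refine (measureReal_biUnion_finset_le _ _).trans ?_
    calc ∑ τ ∈ A, P.real (v ⁻¹' {p τ} ∩ X ⁻¹' B' τ)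
        ≤ ∑ τ ∈ A, P.real (v ⁻¹' {p τ}) * ε₂ := by
          refine Finset.sum_le_sum fun τ hτ => ?_
          rw [measureReal_def, hvX.measure_inter_preimage_eq_mul _ _ (measurableSet_singleton _)
            (measurableSet_toMeasurable _ _), ENNReal.toReal_mul]
          refine mul_le_mul_of_nonneg_left ?_ measureReal_nonneg
          rw [← measureReal_def,
            ← map_measureReal_apply_of_aemeasurable hX (measurableSet_toMeasurable _ _),
            measureReal_def, measure_toMeasurable]
          exact hB τ hτ
      _ = (∑ τ ∈ A, P.real (v ⁻¹' {p τ})) * ε₂ := (Finset.sum_mul _ _ _).symm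
      _ ≤ 1 * ε₂ := by gcongr
      _ = ε₂ := one_mul _
  refine ⟨(toMeasurable P F)ᶜ, (measurableSet_toMeasurable _ _).compl, ?_, fun ω hω => ?_⟩
  · rw [probReal_compl_eq_one_sub (measurableSet_toMeasurable _ _), measureReal_def,
      measure_toMeasurable]
    rw [measureReal_def] at hFm
    linarith
  · have hωF : ω ∉ F := fun h => hω (subset_toMeasurable _ _ h)
    rw [hF, Set.mem_union, not_or] at hωF
    obtain ⟨τ, hτ, hvτ⟩ := hA (v ω) fun h => hωF.1 (subset_toMeasurable _ _ h)
    refine ⟨τ, hτ, hvτ, fun h => hωF.2 ?_⟩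
    exact Set.mem_biUnion hτ ⟨hvτ, subset_toMeasurable _ _ h⟩

end Discretization

/-! ### The good event for the planted model. -/

section Sample

variable {Ω : Type*} [MeasurableSpace Ω] {P : Measure Ω} [IsProbabilityMeasure P] {N n : ℕ}
  [NeZero n] {v : Ω → Fin N → ℝ} {Y : Ω → Matrix (Fin N) (Fin n) ℝ} {ρ L T μ η : ℝ} {k : ℕ}
  {𝒩 : Finset (EuclideanSpace ℝ {j : Fin n // j ≠ 0})}

lemma plantedEntry_sign_injective (hN : 0 < N) (hρ : 0 < ρ) :
    Function.Injective fun τ : Fin N → SignType =>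
      plantedEntry ρ fun i => ((τ i : SignType) : ℝ) := by
  have hN' : (0 : ℝ) < N := by exact_mod_cast hN
  have h : 0 < √((N : ℝ) * ρ) := Real.sqrt_pos.2 (by positivity)
  intro τ τ' hτ
  funext i
  have h1 := congrFun hτ i
  simp only [plantedEntry, div_left_inj' h.ne'] at h1
  revert h1
  generalize τ i = s
  generalize τ' i = s'
  cases s <;> cases s' <;> norm_num [SignType.cast]

/-- With high probability the planted vector has about `N ρ` nonzero entries and the Gaussian
part is regular. -/
lemma exists_regular_event (hv : IsBernoulliRademacher P ρ v) (hY : IsGaussianBasis P v Y)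
    (hp : ParameterBounds N n ρ L T (|1 - 3 * ρ| / 1000)) (hN : 0 < N) (hρ : 0 < ρ)
    (hρ1 : ρ ≤ 1) (hη : 0 < η) (hη1 : η ≤ 1) (hμ : μ = 1 ∨ μ = 1 / √(ρ * L))
    (hμL : ρ * L * μ ^ 2 ≤ 1)
    (hcard : 𝒩.card ≤ 5 ^ Module.finrank ℝ (EuclideanSpace ℝ {j : Fin n // j ≠ 0}))
    (hnorm : ∀ q ∈ 𝒩, ‖q‖ ≤ 1) :
    ∃ G : Set Ω, MeasurableSet G ∧
      1 - (2 * Real.exp (-(N * ρ * η ^ 2 / 4)) + 13 * N * Real.exp (-(5 * L))) ≤ P.real G ∧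
      ∀ ω ∈ G, ∃ σ : Fin N → ℝ, (∀ i, σ i = -1 ∨ σ i = 0 ∨ σ i = 1) ∧
        |∑ i, σ i ^ 2 - N * ρ| ≤ η * (N * ρ) ∧ v ω = plantedEntry ρ σ ∧
        IsRegularSample ρ T μ k 𝒩 σ (normalizedTail (Y ω)) := by
  have hN' : (0 : ℝ) < N := by exact_mod_cast hN
  have hNρ : 0 < (N : ℝ) * ρ := by positivity
  have hsign : ∀ s : SignType, (s : ℝ) = -1 ∨ (s : ℝ) = 0 ∨ (s : ℝ) = 1 := by
    intro s; cases s <;> simp [SignType.cast]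
  have := isProbabilityMeasure_brEntryLaw (N := N) hρ.le hρ1
  refine (exists_measurableSet_of_discrete hv.aemeasurable
    hY.aemeasurable_normalizedTail hY.indepFun_normalizedTail
    (plantedEntry_sign_injective hN hρ)
    (A := {τ | |∑ i, ((τ i : SignType) : ℝ) ^ 2 - N * ρ| ≤ η * (N * ρ)})
    (B := fun τ => {x | ¬ IsRegularSample ρ T μ k 𝒩 (fun i => ((τ i : SignType) : ℝ)) x})
    -- The second set is null: almost surely every entry comes from a sign. The first discards sign
    -- patterns with an atypical number of nonzero entries.
    (D := {y | η * (N * ρ) ≤ |∑ i, (N * ρ * y i ^ 2 - ρ)|} ∪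
      {y | ¬ ∀ i, ∃ s : SignType, y i = (s : ℝ) / √((N : ℝ) * ρ)})
    (ε₁ := 2 * Real.exp (-(N * ρ * η ^ 2 / 4))) (ε₂ := 13 * N * Real.exp (-(5 * L)))
    (by positivity) ?_ ?_ ?_).imp fun G hG => ⟨hG.1, hG.2.1, fun ω hω => ?_⟩
  · rw [hv.map_eq]
    refine (measureReal_union_le _ _).trans ?_
    have h0 : (Measure.pi fun _ : Fin N => brEntryLaw N ρ).real
        {y | ¬ ∀ i, ∃ s : SignType, y i = (s : ℝ) / √((N : ℝ) * ρ)} = 0 := by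
      have : ∀ᵐ y ∂(Measure.pi fun _ : Fin N => brEntryLaw N ρ),
          ∀ i, ∃ s : SignType, y i = (s : ℝ) / √((N : ℝ) * ρ) :=
        ae_all_iff.2 fun i =>
          (Measure.quasiMeasurePreserving_eval (fun _ : Fin N => brEntryLaw N ρ) i).ae
            (ae_brEntryLaw N ρ)
      rw [measureReal_def, ae_iff.1 this, ENNReal.toReal_zero]
    rw [h0, add_zero]
    exact pi_brEntryLaw_real_sum_sq_le hN hρ hρ1 hη hη1
  · intro τ hτ
    rw [hY.map_normalizedTail hN]
    have hτ' : |∑ i, ((τ i : SignType) : ℝ) ^ 2 - N * ρ| ≤ η * (N * ρ) := by simpa using hτ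
    refine hp.measureReal_not_isRegularSample_le ?_ hN hρ (fun i => ?_) ?_ hμ hμL hcard hnorm
    · rw [finrank_tail]; linarith
    · rcases hsign (τ i) with h | h | h <;> simp [h]
    · have h1 := (abs_le.1 hτ').2
      have h2 : η * (N * ρ) ≤ 1 * (N * ρ) := by gcongr
      linarith
  · intro y hy
    simp only [Set.mem_union, Set.mem_ofPred_eq, not_or, not_le, not_not] at hy
    obtain ⟨hy1, hy2⟩ := hy
    choose τ hτ using hy2
    refine ⟨τ, ?_, ?_⟩
    · have e : ∑ i, (N * ρ * y i ^ 2 - ρ) = ∑ i, ((τ i : SignType) : ℝ) ^ 2 - N * ρ := by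
        rw [Finset.sum_sub_distrib, Finset.sum_const, Finset.card_univ, Fintype.card_fin,
          nsmul_eq_mul]
        congr 1
        refine Finset.sum_congr rfl fun i _ => ?_
        rw [hτ, div_pow, Real.sq_sqrt hNρ.le]
        field_simp
      rw [e] at hy1
      simpa using hy1.le
    · exact funext hτ
  · obtain ⟨τ, hτ, hvτ, hX⟩ := hG.2.2 ω hω
    exact ⟨_, fun i => hsign (τ i), by simpa using hτ, hvτ, not_not.1 hX⟩

end Sample

/-- Each of the two exponentials is at most `δ ^ 4`, so the total is at most `3 δ ^ 4 ≤ 3 δ / 8`. -/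
lemma failure_probability_le {N : ℕ} {ρ δ η : ℝ} (hN : 2 ≤ N) (hδ : 0 < δ) (hδ1 : δ < 1 / 2)
    (hη : 0 < η) (hC : 100 / η ^ 2 * (Real.log (1 / δ) / N) ≤ ρ) :
    2 * Real.exp (-(N * ρ * η ^ 2 / 4)) + 13 * N * Real.exp (-(5 * Real.log (N / δ))) ≤ δ := by
  have hN2 : (2 : ℝ) ≤ N := by exact_mod_cast hN
  have hN0 : (0 : ℝ) < N := by linarith
  have h1 : Real.exp (-(N * ρ * η ^ 2 / 4)) ≤ δ ^ 4 := by
    have h2 : Real.log (1 / δ) * 100 ≤ N * ρ * η ^ 2 := by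
      rw [← mul_div_assoc, div_le_iff₀ hN0, div_mul_eq_mul_div, div_le_iff₀ (by positivity)] at hC
      linarith
    have h0 : 0 ≤ Real.log (1 / δ) := Real.log_nonneg (by rw [le_div_iff₀ hδ]; linarith)
    have h3 : -(N * ρ * η ^ 2 / 4) ≤ (4 : ℕ) * Real.log δ := by
      rw [one_div, Real.log_inv] at h2 h0
      push_cast
      linarith
    calc Real.exp (-(N * ρ * η ^ 2 / 4)) ≤ Real.exp ((4 : ℕ) * Real.log δ) :=
          Real.exp_le_exp.2 h3
      _ = δ ^ 4 := by rw [Real.exp_nat_mul, Real.exp_log hδ]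
  have h2 : Real.exp (-(5 * Real.log (N / δ))) = (δ / N) ^ 5 := by
    rw [show -(5 * Real.log (N / δ)) = (5 : ℕ) * Real.log (δ / N) by
      rw [← inv_div, Real.log_inv]; push_cast; ring, Real.exp_nat_mul,
      Real.exp_log (by positivity)]
  have h3 : 13 * N * (δ / N) ^ 5 ≤ δ ^ 4 := by
    have e : 13 * N * (δ / N) ^ 5 = 13 * δ * δ ^ 4 / N ^ 4 := by field_simp
    rw [e, div_le_iff₀ (by positivity)]
    have : (2 : ℝ) ^ 4 ≤ N ^ 4 := by gcongr
    have : 13 * δ ≤ N ^ 4 := by linarith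
    calc 13 * δ * δ ^ 4 ≤ N ^ 4 * δ ^ 4 := by gcongr
      _ = _ := mul_comm _ _
  have h4 : δ ^ 4 ≤ δ / 8 := by
    have : δ ^ 3 ≤ (1 / 2) ^ 3 := by gcongr
    calc δ ^ 4 = δ * δ ^ 3 := by ring
      _ ≤ δ * (1 / 2) ^ 3 := by gcongr
      _ = δ / 8 := by ring
  rw [h2]
  linarith

end PlantedVector

end

theorem corollary2p3 (c₁ : ℝ) (hc₁ : c₁ ∈ Set.Ioo (0 : ℝ) 0.1) :
    ∃ C₂ c₃ : ℝ, 0 < C₂ ∧ 0 < c₃ ∧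
      ∀ (N n : ℕ) [NeZero n], n ≤ N →
      ∀ ρ δ : ℝ, ρ ∈ Set.Ioc (0 : ℝ) 1 → δ ∈ Set.Ioo (0 : ℝ) (1 / 2) →
      Real.log (N / δ) ^ 7 ≤ N →
      C₂ * (Real.log (1 / δ) / N) ≤ ρ →
      c₁ ≤ |ρ - 1 / 3| →
      ((n : ℝ) * ρ / √(N : ℝ) + √((n : ℝ) / N)) * Real.log (N / δ) ≤ c₃ →
      ∀ {Ω : Type*} [MeasurableSpace Ω] (P : Measure Ω) [IsProbabilityMeasure P]
        (v : Ω → Fin N → ℝ) (Y : Ω → Matrix (Fin N) (Fin n) ℝ)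
        (Q : Ω → Matrix (Fin n) (Fin n) ℝ),
      PlantedVector.IsBernoulliRademacher P ρ v →
      PlantedVector.IsGaussianBasis P v Y →
      (∀ ω, Q ω ∈ Matrix.orthogonalGroup (Fin n) ℝ) →
      ∃ G : Set Ω, MeasurableSet G ∧ 1 - δ ≤ P.real G ∧
        ∀ ω ∈ G, ∀ u : Fin n → ℝ,
          PlantedVector.IsLeadingEigenvector (PlantedVector.spectralMatrix (Y ω * Q ω)) u →
          PlantedVector.signThreshold ρ ((Y ω * Q ω) *ᵥ u) = v ω ∨
            PlantedVector.signThreshold ρ ((Y ω * Q ω) *ᵥ (-u)) = v ω := by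
  obtain ⟨hc0, hc1⟩ := hc₁
  have hη₀ : 0 < 3 * c₁ / 1000 := by positivity
  -- Here `3 c₁ / 1000` is a lower bound for the tolerance `|1 - 3 ρ| / 1000`, because `|1 - 3 ρ| =
  -- 3 |ρ - 1/3|`.
  refine ⟨100 / (3 * c₁ / 1000) ^ 2, (3 * c₁ / 1000) ^ 2 / 10 ^ 9, by positivity, by positivity, ?_⟩
  intro N n _ hnN ρ δ ⟨hρ, hρ1⟩ ⟨hδ, hδ1⟩ h7 hC hκ hc Ω _ P _ v Y Q hv hY hQ
  obtain ⟨L, T, μ, hL, hp, hμ, hμL, hμ1, hT, hN2, hη, hR, hRμ⟩ :=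
    PlantedVector.exists_parameterBounds hc0 hc1 NeZero.one_le hρ hρ1 hδ hδ1 hnN h7 hC hκ hc
  have hN : 0 < N := by omega
  have hN' : (0 : ℝ) < N := by exact_mod_cast hN
  obtain ⟨𝒩, hcard, hnorm, hnet⟩ :=
    PlantedVector.exists_half_net (EuclideanSpace ℝ {j : Fin n // j ≠ 0})
  -- Enough iterations for the geometric error to be negligible against an entry of `v`, whose size
  -- is at least `1 / √N`. The number `k` is deterministic, and none of the tail bounds depends on
  -- it.
  obtain ⟨k, hk⟩ := exists_pow_lt_of_lt_one (show (0 : ℝ) < 1 / 100 / √(N : ℝ) by positivity)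
    (show (1 / 2 : ℝ) < 1 by norm_num)
  obtain ⟨G, hG, hPG, h⟩ := PlantedVector.exists_regular_event (k := k) hv hY hp hN hρ hρ1 hη₀
    (by linarith) hμ hμL hcard hnorm
  refine ⟨G, hG, ?_, fun ω hω u hu => ?_⟩
  · have := PlantedVector.failure_probability_le hN2 hδ hδ1 hη₀ hC
    rw [← hL] at hPG
    linarith
  · obtain ⟨σ, hσ, hm, hvσ, hreg⟩ := h ω hω
    -- The good event does not involve `Q`: on it every leading eigenvector of the unrotated matrix
    -- recovers `v`, in particular `Q ω *ᵥ u`.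
    rw [PlantedVector.spectralMatrix_mul_orthogonal _ (hQ ω)] at hu
    rw [← Matrix.mulVec_mulVec, ← Matrix.mulVec_mulVec, Matrix.mulVec_neg, hvσ]
    have hκ' : 1 - 3 * ρ ≠ 0 := fun h0 => by
      rw [h0, abs_zero, zero_div] at hη
      linarith
    refine hreg.signThreshold_eq hnet hnorm hN hρ hρ1 hκ' hσ (hm.trans (by gcongr)) hT hμ1 hR hRμ
      hk.le (fun i => ?_) (fun i => ?_) (hu.orthogonal_mulVec (hQ ω))
    · rw [hY.firstCol, hvσ]
    · rw [PlantedVector.gaussianRow_normalizedTail hN]
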